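/- Let $\Omega, A, Z, X, Y$ be finite sets ($A$, $X$ nonempty), and write $\Delta(S)$ for the set of probability distributions on a finite set $S$. For every type $z\in Z$ let $\mu(\cdot|z)\in\Delta(\Omega)$ be a prior and let $u_i(\cdot,\cdot,z):\Omega\times A\to\mathbb R$, $i=S,R$, be the payoff functions of a sender $S$ and a receiver $R$. Let $Q:X\to\Delta(Y)$ be a channel. For $q\in\Delta(S)$ let $H(q)=-\sum_s q(s)\log_2 q(s)$, with $0\log_2 0=0$, and let $C(Q)=\max_{p\in\Delta(X)}\big[H\big(\sum_x p(x)Q(\cdot|x)\big)-\sum_x p(x)H(Q(\cdot|x))\big]$ be the capacity of $Q$. For integers $n\ge1$, $k\ge0$ and $z^n\in Z^n$, set $\mu^n(\omega^n|z^n)=\prod_{t=1}^n\mu(\omega_t|z_t)$, $Q^k(y^k|x^k)=\prod_{t=1}^kQ(y_t|x_t)$ and $\bar u_i(\omega^n,a^n)=\frac1n\sum_{t=1}^n u_i(\omega_t,a_t,z_t)$. A strategy of the sender is a map $\sigma:\Omega^n\to\Delta(X^k)$; the set $BR(\sigma)$ of best replies consists of the maps $\tau:Y^k\to A^n$ such that,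 for every $y^k$, $\tau(y^k)$ maximizes $\sum_{\omega^n,x^k}\mu^n(\omega^n|z^n)\sigma(x^k|\omega^n)Q^k(y^k|x^k)\bar u_R(\omega^n,a^n)$ over $a^n\in A^n$. The optimal robust payoff of the sender is $$U^*_S(\mu^n,Q^k,z^n)=\sup_\sigma\min_{\tau\in BR(\sigma)}\sum_{\omega^n,x^k,y^k}\mu^n(\omega^n|z^n)\sigma(x^k|\omega^n)Q^k(y^k|x^k)\,\bar u_S(\omega^n,\tau(y^k)).$$ For $\nu\in\Delta(\Omega)$ let $A^{*z}(\nu)=\operatorname{argmax}_{a\in A}\sum_\omega\nu(\omega)u_R(\omega,a,z)$ and $u^{*z}_S(\nu)=\min_{a\in A^{*z}(\nu)}\sum_\omega\nu(\omega)u_S(\omega,a,z)$. For $\pi\in\Delta(Z)$ and $c\in[0,+\infty]$ let $$V^Z(\mu,c,\pi)=\sup\ \sum_z\pi(z)\sum_m\lambda^z_m\,u^{*z}_S(\nu^z_m),$$ where the supremum is over all choices, for every $z\in Z$, of a finite family $(\lambda^z_m,\nu^z_m)_m$ with $\nu^z_m\in\Delta(\Omega)$, $\lambda^z_m\ge0$,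 $\sum_m\lambda^z_m=1$ and $\sum_m\lambda^z_m\nu^z_m=\mu(\cdot|z)$, subject to $$\sum_z\pi(z)\Big(H(\mu(\cdot|z))-\sum_m\lambda^z_mH(\nu^z_m)\Big)\le c.$$ For $z^n\in Z^n$ let $\pi_n(z)=\frac1n|\{t:z_t=z\}|$ be its empirical frequency. Then: 1. For all integers $n\ge1$, $k\ge0$ and all $z^n\in Z^n$, $$U^*_S(\mu^n,Q^k,z^n)\le V^Z\Big(\mu,\frac kn C(Q),\pi_n\Big).$$ 2. Let $\pi\in\Delta(Z)$ and $r\in[0,+\infty]$. If $r=0$ and $C(Q)>0$, assume in addition that for every $z$ with $\pi(z)>0$ the function $u^{*z}_S$, restricted to the beliefs $\nu\in\Delta(\Omega)$ whose support is contained in that of $\mu(\cdot|z)$, is continuous at $\mu(\cdot|z)$. Then for all sequences of integers $k_j\ge0$, $n_j\ge1$ and all $z^{n_j}\in Z^{n_j}$ such that $\max(n_j,k_j)\to\infty$, $k_j/n_j\to r$ and $\pi_{n_j}\to\pi$ as $j\to\infty$, $$\lim_{j\to\infty}U^*_S(\mu^{n_j},Q^{k_j},z^{n_j})=V^Z\big(\mu,rC(Q),\pi\big),$$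 with the convention $(+\infty)\cdot0=0$. -/

import Mathlib

open Filter Topology
open scoped ENNReal

noncomputable section

/-! Probability distributions on a finite set `S` are the elements of `stdSimplex ℝ S`. -/

namespace Persuasion

variable {Ω A Z X Y : Type*} [Fintype Ω] [Fintype A] [Fintype Z] [Fintype X] [Fintype Y]

/-- Shannon entropy in base `2` (`Real.logb 2 0 = 0`, so `0 log 0 = 0`). -/
def entropy {S : Type*} [Fintype S] (q : S → ℝ) : ℝ :=
  -∑ s, q s * Real.logb 2 (q s)

/-- Mutual information between the input, drawn from `p`, and the output of the channel `Q`. -/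
def mutualInfo (Q : X → Y → ℝ) (p : X → ℝ) : ℝ :=
  entropy (fun y => ∑ x, p x * Q x y) - ∑ x, p x * entropy (Q x)

/-- Capacity of the channel `Q`: the maximum over input distributions of the mutual information. -/
def capacity (Q : X → Y → ℝ) : ℝ :=
  sSup (mutualInfo Q '' stdSimplex ℝ X)

/-! ### The game with `n` problems of types `z 0, …, z (n - 1)` and `k` uses of the channel -/

/-- Distribution of the sequence of states given the sequence of types. -/
def seqPrior {n : ℕ} (μ : Z → Ω → ℝ) (z : Fin n → Z) (ω : Fin n → Ω) : ℝ :=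
  ∏ t, μ (z t) (ω t)

/-- The memoryless channel `Q` used `k` times. -/
def seqChannel {k : ℕ} (Q : X → Y → ℝ) (x : Fin k → X) (y : Fin k → Y) : ℝ :=
  ∏ t, Q (x t) (y t)

/-- Average payoff over the `n` problems. -/
def avgPayoff {n : ℕ} (u : Ω → A → Z → ℝ) (z : Fin n → Z) (ω : Fin n → Ω) (a : Fin n → A) : ℝ :=
  (1 / (n : ℝ)) * ∑ t, u (ω t) (a t) (z t)

/-- Strategies of the sender: `σ ω x` is the probability of the inputs `x` at the states `ω`. -/
def senderStrategies (Ω X : Type*) [Fintype X] (n k : ℕ) :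
    Set ((Fin n → Ω) → (Fin k → X) → ℝ) :=
  {σ | ∀ ω, σ ω ∈ stdSimplex ℝ (Fin k → X)}

/-- Strategies `τ` of the receiver that are best replies to `σ`: for every output sequence `y`,
the actions `τ y` maximize the receiver's expected average payoff. -/
def bestReplies {n k : ℕ} (uR : Ω → A → Z → ℝ) (μ : Z → Ω → ℝ) (Q : X → Y → ℝ) (z : Fin n → Z)
    (σ : (Fin n → Ω) → (Fin k → X) → ℝ) : Set ((Fin k → Y) → (Fin n → A)) :=
  {τ | ∀ y, ∀ a : Fin n → A,
    ∑ ω, ∑ x, seqPrior μ z ω * σ ω x * seqChannel Q x y * avgPayoff uR z ω a ≤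
      ∑ ω, ∑ x, seqPrior μ z ω * σ ω x * seqChannel Q x y * avgPayoff uR z ω (τ y)}

/-- Expected average payoff of the sender at the strategies `σ` and `τ`. -/
def senderPayoff {n k : ℕ} (uS : Ω → A → Z → ℝ) (μ : Z → Ω → ℝ) (Q : X → Y → ℝ) (z : Fin n → Z)
    (σ : (Fin n → Ω) → (Fin k → X) → ℝ) (τ : (Fin k → Y) → (Fin n → A)) : ℝ :=
  ∑ ω, ∑ x, ∑ y, seqPrior μ z ω * σ ω x * seqChannel Q x y * avgPayoff uS z ω (τ y)

/-- Optimal robust payoff of the sender: supremum over the strategies `σ` of the minimum over the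
(finite, nonempty) set of best replies of the receiver. -/
def optimalRobustPayoff {n : ℕ} (uS uR : Ω → A → Z → ℝ) (μ : Z → Ω → ℝ) (Q : X → Y → ℝ)
    (k : ℕ) (z : Fin n → Z) : ℝ :=
  sSup ((fun σ => sInf (senderPayoff uS μ Q z σ '' bestReplies uR μ Q z σ)) ''
    senderStrategies Ω X n k)

/-! ### The optimal splitting problem -/

/-- Optimal actions of the receiver at the belief `ν` in a problem of type `z`. -/
def optActions (uR : Ω → A → Z → ℝ) (z : Z) (ν : Ω → ℝ) : Set A :=
  {a | ∀ b, ∑ ω, ν ω * uR ω b z ≤ ∑ ω, ν ω * uR ω a z}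

/-- Robust payoff of the sender at the belief `ν` in a problem of type `z`: the minimum of the
sender's payoff over the (finite, nonempty) set of optimal actions of the receiver. -/
def robustPayoff (uS uR : Ω → A → Z → ℝ) (z : Z) (ν : Ω → ℝ) : ℝ :=
  sInf ((fun a => ∑ ω, ν ω * uS ω a z) '' optActions uR z ν)

/-- A splitting of the belief `p`: a finite convex combination of beliefs that equals `p`. -/
structure Splitting (p : Ω → ℝ) where
  card : ℕ
  weight : Fin card → ℝ
  posterior : Fin card → Ω → ℝ
  weight_mem : weight ∈ stdSimplex ℝ (Fin card)
  posterior_mem : ∀ m, posterior m ∈ stdSimplex ℝ Ω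
  sum_eq : ∑ m, weight m • posterior m = p

/-- Mutual information of a splitting (expected reduction of entropy). -/
def Splitting.info {p : Ω → ℝ} (s : Splitting p) : ℝ :=
  entropy p - ∑ m, s.weight m * entropy (s.posterior m)

/-- Value of the optimal splitting problem with information constraint `c ∈ [0, ∞]`. -/
def splittingValue (uS uR : Ω → A → Z → ℝ) (μ : Z → Ω → ℝ) (c : ℝ≥0∞) (π : Z → ℝ) : ℝ :=
  sSup {v | ∃ s : (z : Z) → Splitting (μ z),
    ((∑ z, π z * (s z).info : ℝ) : EReal) ≤ (c : EReal) ∧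
    v = ∑ z, π z * ∑ m, (s z).weight m * robustPayoff uS uR z ((s z).posterior m)}

/-- Empirical frequency of the types in the sequence `z`. -/
def empFreq {n : ℕ} (z : Fin n → Z) (z₀ : Z) : ℝ :=
  (Nat.card {t : Fin n // z t = z₀} : ℝ) / n

end Persuasion

end

/-!
*Upper bound.* Whatever the sender does, the beliefs of the receiver on the state of each problem
split the prior of its type. By superadditivity of information over independent problems and by data
processing, these splittings together carry at most `k * capacity Q` bits, and their average over
the problems of a given type is a feasible splitting for the empirical frequency of types.

*Lower bound.* Mixing all posteriors of an optimal splitting with the prior costs little and makes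
the information constraint slack and the supports equal. Then about `exp (n * I)` message sequences,
where `I` is the information of the splitting, cover the typical state sequences; the sender sends
the index of the covering sequence through a Feinstein code for the channel. By Pinsker's inequality
and superadditivity, the beliefs of the receiver are on average close to the targeted posteriors,
and the payoff from any optimal action is bounded below near a posterior, linearly in the distance.
When `k / n` tends to infinity the messages are sent uncompressed; when `r * capacity Q = 0` the
value of the splitting problem is that of the prior, by continuity if `0 < capacity Q`.
-/

namespace Persuasion

section Averages

variable {S : Type*} [Fintype S] {p : S → ℝ}

lemma exists_apply_le_sum_mul (hp : p ∈ stdSimplex ℝ S) (f : S → ℝ) :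
    ∃ s, f s ≤ ∑ s, p s * f s := by
  obtain ⟨s, -, hs⟩ := (concaveOn_id convex_univ).exists_le_of_centerMass
    (t := Finset.univ) (w := p) (p := f) (fun s _ => hp.1 s) (by simp [hp.2])
    (fun _ _ => Set.mem_univ _)
  exact ⟨s, by simpa [Finset.centerMass_eq_of_sum_1 _ _ hp.2] using hs⟩

lemma exists_sum_mul_le_apply (hp : p ∈ stdSimplex ℝ S) (f : S → ℝ) :
    ∃ s, ∑ s, p s * f s ≤ f s := by
  simpa using exists_apply_le_sum_mul hp fun s => -f s

lemma abs_le_sum_abs_univ (f : S → ℝ) (s : S) : |f s| ≤ ∑ s, |f s| :=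
  Finset.single_le_sum (f := fun s => |f s|) (fun _ _ => abs_nonneg _) (Finset.mem_univ s)

lemma abs_sum_le_card_mul {f : S → ℝ} {B : ℝ} (hf : ∀ s, |f s| ≤ B) :
    |∑ s, f s| ≤ Fintype.card S * B :=
  (Finset.abs_sum_le_sum_abs _ _).trans <|
    (Finset.sum_le_card_nsmul _ _ B fun s _ => hf s).trans_eq (by simp)

lemma abs_sum_mul_le {w f : S → ℝ} {B : ℝ} (hf : ∀ s, |f s| ≤ B) :
    |∑ s, w s * f s| ≤ B * ∑ s, |w s| := by
  rw [Finset.mul_sum]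
  refine (Finset.abs_sum_le_sum_abs _ _).trans (Finset.sum_le_sum fun s _ => ?_)
  rw [abs_mul, mul_comm]
  exact mul_le_mul_of_nonneg_right (hf s) (abs_nonneg _)

lemma abs_sum_mul_le_of_mem {f : S → ℝ} {B : ℝ} (hp : p ∈ stdSimplex ℝ S)
    (hf : ∀ s, |f s| ≤ B) : |∑ s, p s * f s| ≤ B := by
  refine (abs_sum_mul_le hf).trans_eq ?_
  rw [Finset.sum_congr rfl fun s _ => abs_of_nonneg (hp.1 s), hp.2, mul_one]

/-- Mass that the (not necessarily normalized) weights `p` give to the event `E`. -/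
noncomputable def mass (p : S → ℝ) (E : Set S) : ℝ :=
  ∑ s, E.indicator p s

lemma mass_nonneg (hp : ∀ s, 0 ≤ p s) (E : Set S) : 0 ≤ mass p E :=
  Finset.sum_nonneg fun s _ => Set.indicator_nonneg (fun s _ => hp s) s

lemma mass_mono (hp : ∀ s, 0 ≤ p s) {E F : Set S} (h : ∀ s ∈ E, p s ≠ 0 → s ∈ F) :
    mass p E ≤ mass p F := by
  refine Finset.sum_le_sum fun s _ => ?_
  by_cases hs : s ∈ E ∧ p s ≠ 0
  · rw [Set.indicator_of_mem hs.1, Set.indicator_of_mem (h s hs.1 hs.2)]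
  · rw [Set.indicator_apply_eq_zero.2 (by simpa using hs)]
    exact Set.indicator_nonneg (fun s _ => hp s) s

lemma mass_add_mass_compl (p : S → ℝ) (E : Set S) : mass p E + mass p Eᶜ = ∑ s, p s := by
  simp only [mass, ← Finset.sum_add_distrib, Set.indicator_self_add_compl_apply]

lemma mass_le_sum (hp : ∀ s, 0 ≤ p s) (E : Set S) : mass p E ≤ ∑ s, p s :=
  Finset.sum_le_sum fun s _ => Set.indicator_le_self' (fun s _ => hp s) s

lemma mass_union_le (hp : ∀ s, 0 ≤ p s) (E F : Set S) :
    mass p (E ∪ F) ≤ mass p E + mass p F := by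
  rw [mass, mass, mass, ← Finset.sum_add_distrib]
  refine Finset.sum_le_sum fun s _ => ?_
  have hEF := Set.indicator_union_add_inter_apply p E F s
  have hinter : 0 ≤ (E ∩ F).indicator p s := Set.indicator_nonneg (fun s _ => hp s) s
  linarith

lemma mass_le_sum_mul_div {f : S → ℝ} {η : ℝ} {E : Set S} (hp : ∀ s, 0 ≤ p s)
    (hf : ∀ s, 0 ≤ f s) (hη : 0 < η) (hE : ∀ s ∈ E, η ≤ f s) :
    mass p E ≤ (∑ s, p s * f s) / η := by
  rw [mass, Finset.sum_div]
  refine Finset.sum_le_sum fun s _ => Set.indicator_apply_le' (fun hs => ?_) fun _ => ?_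
  · rw [le_div_iff₀ hη]
    exact mul_le_mul_of_nonneg_left (hE s hs) (hp s)
  · exact div_nonneg (mul_nonneg (hp s) (hf s)) hη.le

lemma neg_mul_mass_le_sum_mul {f : S → ℝ} {G : ℝ} {E : Set S} (hp : ∀ s, 0 ≤ p s)
    (hf : ∀ s ∉ E, 0 ≤ f s) (hG : ∀ s, -G ≤ f s) : -(G * mass p E) ≤ ∑ s, p s * f s := by
  rw [mass, Finset.mul_sum, ← Finset.sum_neg_distrib]
  refine Finset.sum_le_sum fun s _ => ?_
  by_cases hs : s ∈ E
  · rw [Set.indicator_of_mem hs, mul_comm, ← mul_neg]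
    exact mul_le_mul_of_nonneg_left (hG s) (hp s)
  · rw [Set.indicator_of_notMem hs, mul_zero, neg_zero]
    exact mul_nonneg (hp s) (hf s hs)

end Averages

section RelativeEntropy

/-- Relative entropy, in nats, of the weights `p` with respect to the weights `q`. The junk value
`x / 0 = 0` makes it meaningless unless `p` vanishes wherever `q` does. -/
noncomputable def relEntropy {S : Type*} [Fintype S] (p q : S → ℝ) : ℝ :=
  ∑ s, p s * Real.log (p s / q s)

lemma sq_sqrt_sub_sqrt_le {x y : ℝ} (hx : 0 ≤ x) (hy : 0 ≤ y) (hxy : y = 0 → x = 0) :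
    (√x - √y) ^ 2 ≤ x * Real.log (x / y) - x + y := by
  rcases hx.eq_or_lt with rfl | hx
  · simp [Real.sq_sqrt hy]
  have hy : 0 < y := hy.lt_of_ne fun hy0 => hx.ne' (hxy hy0.symm)
  have hlog : Real.log (x / y) = -2 * Real.log (√y / √x) := by
    rw [Real.log_div hx.ne' hy.ne', Real.log_div (by positivity) (by positivity),
      Real.log_sqrt hy.le, Real.log_sqrt hx.le]
    ring
  have hsqrt : x * (√y / √x) = √x * √y := by
    rw [mul_div_left_comm, Real.div_sqrt, mul_comm]
  have hle : x * Real.log (√y / √x) ≤ x * (√y / √x - 1) := by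
    gcongr
    exact Real.log_le_sub_one_of_pos (by positivity)
  rw [hlog]
  nlinarith [Real.mul_self_sqrt hx.le, Real.mul_self_sqrt hy.le]

variable {S : Type*} [Fintype S] {p q : S → ℝ}

lemma sum_sq_sqrt_sub_sqrt_le (hp : ∀ s, 0 ≤ p s) (hq : ∀ s, 0 ≤ q s)
    (hpq : ∀ s, q s = 0 → p s = 0) :
    ∑ s, (√(p s) - √(q s)) ^ 2 ≤ relEntropy p q - ∑ s, p s + ∑ s, q s := by
  rw [relEntropy, ← Finset.sum_sub_distrib, ← Finset.sum_add_distrib]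
  exact Finset.sum_le_sum fun s _ => sq_sqrt_sub_sqrt_le (hp s) (hq s) (hpq s)

lemma sum_sub_sum_le_relEntropy (hp : ∀ s, 0 ≤ p s) (hq : ∀ s, 0 ≤ q s)
    (hpq : ∀ s, q s = 0 → p s = 0) : ∑ s, p s - ∑ s, q s ≤ relEntropy p q := by
  have hhellinger := sum_sq_sqrt_sub_sqrt_le hp hq hpq
  have hnonneg : 0 ≤ ∑ s, (√(p s) - √(q s)) ^ 2 := Finset.sum_nonneg fun s _ => sq_nonneg _
  linarith

lemma abs_sub_le_sq_sqrt_sub_sqrt {x y θ : ℝ} (hx : 0 ≤ x) (hy : 0 ≤ y) (hθ : 0 < θ) :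
    |x - y| ≤ 1 / (2 * θ) * (√x - √y) ^ 2 + θ * (x + y) := by
  have hfactor : |x - y| = |√x - √y| * (√x + √y) := by
    rw [← abs_of_nonneg (by positivity : 0 ≤ √x + √y), ← abs_mul, mul_comm,
      ← mul_self_sub_mul_self, Real.mul_self_sqrt hx, Real.mul_self_sqrt hy]
  have hsum : (√x + √y) ^ 2 ≤ 2 * (x + y) := by
    nlinarith [Real.mul_self_sqrt hx, Real.mul_self_sqrt hy, sq_nonneg (√x - √y)]
  have hamgm (d e : ℝ) : d * e ≤ 1 / (2 * θ) * d ^ 2 + θ / 2 * e ^ 2 := by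
    have hsq : 1 / (2 * θ) * d ^ 2 + θ / 2 * e ^ 2 - d * e = 1 / (2 * θ) * (d - θ * e) ^ 2 := by
      field
    have hsq0 : 0 ≤ 1 / (2 * θ) * (d - θ * e) ^ 2 := by positivity
    linarith
  calc |x - y| ≤ 1 / (2 * θ) * |√x - √y| ^ 2 + θ / 2 * (√x + √y) ^ 2 := hfactor ▸ hamgm _ _
    _ ≤ 1 / (2 * θ) * |√x - √y| ^ 2 + θ / 2 * (2 * (x + y)) := by gcongr
    _ = _ := by rw [sq_abs]; ring

/-- Pinsker's inequality in a linearized form: the usual one is the case of the optimal `θ`. -/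
lemma sum_abs_sub_le_relEntropy {θ : ℝ} (hp : ∀ s, 0 ≤ p s) (hq : ∀ s, 0 ≤ q s)
    (hpq : ∀ s, q s = 0 → p s = 0) (hsum : ∑ s, q s = ∑ s, p s) (hθ : 0 < θ) :
    ∑ s, |p s - q s| ≤ 1 / (2 * θ) * relEntropy p q + 2 * θ * ∑ s, p s := by
  have hhellinger : ∑ s, (√(p s) - √(q s)) ^ 2 ≤ relEntropy p q := by
    linarith [sum_sq_sqrt_sub_sqrt_le hp hq hpq]
  calc ∑ s, |p s - q s|
      ≤ ∑ s, (1 / (2 * θ) * (√(p s) - √(q s)) ^ 2 + θ * (p s + q s)) :=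
        Finset.sum_le_sum fun s _ => abs_sub_le_sq_sqrt_sub_sqrt (hp s) (hq s) hθ
    _ = 1 / (2 * θ) * ∑ s, (√(p s) - √(q s)) ^ 2 + θ * (∑ s, p s + ∑ s, q s) := by
        rw [Finset.sum_add_distrib, ← Finset.mul_sum, ← Finset.mul_sum, Finset.sum_add_distrib]
    _ ≤ 1 / (2 * θ) * relEntropy p q + θ * (∑ s, p s + ∑ s, q s) := by
        gcongr 1 / (2 * θ) * ?_ + _
    _ = _ := by rw [hsum]; ring

end RelativeEntropy

section Products

variable {ι S : Type*} [Fintype ι]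

/-- Law of independent coordinates with laws `w i`. -/
def prodLaw (w : ι → S → ℝ) (s : ι → S) : ℝ :=
  ∏ i, w i (s i)

variable {w : ι → S → ℝ}

lemma prodLaw_ne_zero {s : ι → S} (h : ∀ i, w i (s i) ≠ 0) : prodLaw w s ≠ 0 :=
  Finset.prod_ne_zero_iff.2 fun i _ => h i

lemma log_prodLaw {s : ι → S} (h : ∀ i, w i (s i) ≠ 0) :
    Real.log (prodLaw w s) = ∑ i, Real.log (w i (s i)) :=
  Real.log_prod fun i _ => h i

variable [Fintype S]

lemma sum_prodLaw [DecidableEq ι] (w : ι → S → ℝ) : ∑ s, prodLaw w s = ∏ i, ∑ a, w i a := by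
  simp only [prodLaw, Finset.prod_univ_sum, Fintype.piFinset_univ]

lemma prodLaw_mem_stdSimplex [DecidableEq ι] (hw : ∀ i, w i ∈ stdSimplex ℝ S) :
    prodLaw w ∈ stdSimplex ℝ (ι → S) :=
  ⟨fun s => Finset.prod_nonneg fun i _ => (hw i).1 (s i), by
    rw [sum_prodLaw]; exact Finset.prod_eq_one fun i _ => (hw i).2⟩

lemma sum_prodLaw_mul_apply [DecidableEq ι] (hw : ∀ i, ∑ a, w i a = 1) (i : ι) (f : S → ℝ) :
    ∑ s, prodLaw w s * f (s i) = ∑ a, w i a * f a := by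
  calc ∑ s, prodLaw w s * f (s i)
      = ∑ s, prodLaw (fun j a => w j a * if j = i then f a else 1) s := by
        simp only [prodLaw, Finset.prod_mul_distrib, Finset.prod_ite_eq', Finset.mem_univ, if_true]
    _ = ∏ j, ∑ a, w j a * (if j = i then f a else 1) := sum_prodLaw _
    _ = ∑ a, w i a * (if i = i then f a else 1) :=
        Fintype.prod_eq_single i fun j hj => by simp [hj, hw]
    _ = ∑ a, w i a * f a := by simp

lemma sum_prodLaw_mul_sum [DecidableEq ι] (hw : ∀ i, ∑ a, w i a = 1) (f : ι → S → ℝ) :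
    ∑ s, prodLaw w s * ∑ i, f i (s i) = ∑ i, ∑ a, w i a * f i a := by
  simp_rw [Finset.mul_sum]
  rw [Finset.sum_comm]
  exact Finset.sum_congr rfl fun i _ => sum_prodLaw_mul_apply hw i (f i)

lemma sum_prodLaw_mul_apply_mul_apply_eq_zero [DecidableEq ι] {i j : ι} (hij : i ≠ j)
    {f g : S → ℝ} (hf : ∑ a, w i a * f a = 0) :
    ∑ s, prodLaw w s * (f (s i) * g (s j)) = 0 := by
  calc ∑ s, prodLaw w s * (f (s i) * g (s j))
      = ∑ s, prodLaw (fun l a => w l a * ((if l = i then f a else 1) *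
          if l = j then g a else 1)) s := by
        simp only [prodLaw, Finset.prod_mul_distrib, Finset.prod_ite_eq', Finset.mem_univ, if_true]
    _ = ∏ l, ∑ a, w l a * ((if l = i then f a else 1) * if l = j then g a else 1) :=
        sum_prodLaw _
    _ = 0 := Finset.prod_eq_zero (Finset.mem_univ i) (by simp [hij, hf])

lemma sum_prodLaw_mul_sq_sum [DecidableEq ι] (hw : ∀ i, ∑ a, w i a = 1) {f : ι → S → ℝ}
    (hf : ∀ i, ∑ a, w i a * f i a = 0) :
    ∑ s, prodLaw w s * (∑ i, f i (s i)) ^ 2 = ∑ i, ∑ a, w i a * f i a ^ 2 := by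
  simp_rw [sq, Finset.sum_mul_sum, Finset.mul_sum]
  rw [Finset.sum_comm]
  refine Finset.sum_congr rfl fun i _ => ?_
  rw [Finset.sum_comm, Fintype.sum_eq_single i fun j hj =>
    sum_prodLaw_mul_apply_mul_apply_eq_zero hj.symm (hf i)]
  exact sum_prodLaw_mul_apply hw i fun a => f i a * f i a

lemma sum_mul_sq_sub_sum_mul_le {p f : S → ℝ} {B : ℝ} (hp : p ∈ stdSimplex ℝ S)
    (hf : ∀ s, |f s| ≤ B) : ∑ s, p s * (f s - ∑ s', p s' * f s') ^ 2 ≤ B ^ 2 := by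
  set m := ∑ s, p s * f s with hm
  calc ∑ s, p s * (f s - m) ^ 2
      = ∑ s, (p s * f s ^ 2 - 2 * m * (p s * f s) + p s * m ^ 2) :=
        Finset.sum_congr rfl fun s _ => by ring
    _ = ∑ s, p s * f s ^ 2 - m ^ 2 := by
        rw [Finset.sum_add_distrib, Finset.sum_sub_distrib, ← Finset.mul_sum, ← hm,
          ← Finset.sum_mul, hp.2]
        ring
    _ ≤ ∑ s, p s * f s ^ 2 := sub_le_self _ (sq_nonneg m)
    _ ≤ ∑ s, p s * B ^ 2 := Finset.sum_le_sum fun s _ =>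
        mul_le_mul_of_nonneg_left (sq_le_sq' (abs_le.1 (hf s)).1 (abs_le.1 (hf s)).2) (hp.1 s)
    _ = B ^ 2 := by rw [← Finset.sum_mul, hp.2, one_mul]

lemma mass_prodLaw_le_of_abs_sub_sum_ge [DecidableEq ι] [Nonempty ι]
    (hw : ∀ i, w i ∈ stdSimplex ℝ S) {f : ι → S → ℝ} {B δ : ℝ} (hf : ∀ i a, |f i a| ≤ B)
    (hδ : 0 < δ) :
    mass (prodLaw w) {s | Fintype.card ι * δ ≤ |∑ i, f i (s i) - ∑ i, ∑ a, w i a * f i a|} ≤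
      B ^ 2 / (Fintype.card ι * δ ^ 2) := by
  have : (0 : ℝ) < Fintype.card ι := by exact_mod_cast Fintype.card_pos
  set m : ι → ℝ := fun i => ∑ a, w i a * f i a with hm
  have hcentered (i : ι) : ∑ a, w i a * (f i a - m i) = 0 := by
    simp [mul_sub, ← Finset.sum_mul, (hw i).2, hm]
  have hvariance : ∑ s, prodLaw w s * (∑ i, (f i (s i) - m i)) ^ 2 ≤ Fintype.card ι * B ^ 2 := by
    rw [sum_prodLaw_mul_sq_sum (fun i => (hw i).2) hcentered, ← nsmul_eq_mul, ← Finset.card_univ]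
    exact Finset.sum_le_card_nsmul _ _ _ fun i _ => sum_mul_sq_sub_sum_mul_le (hw i) (hf i)
  calc _ ≤ (∑ s, prodLaw w s * (∑ i, (f i (s i) - m i)) ^ 2) / (Fintype.card ι * δ) ^ 2 := by
        refine mass_le_sum_mul_div (prodLaw_mem_stdSimplex hw).1 (fun s => sq_nonneg _)
          (by positivity) fun s hs => ?_
        rw [Finset.sum_sub_distrib, ← sq_abs (_ - _)]
        exact pow_le_pow_left₀ (by positivity) hs 2
    _ ≤ Fintype.card ι * B ^ 2 / (Fintype.card ι * δ) ^ 2 := by gcongr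
    _ = _ := by field

end Products

section Marginals

variable {ι Ω : Type*} [Fintype ι] [DecidableEq ι] [Fintype Ω] {P : (ι → Ω) → ℝ} {ν : ι → Ω → ℝ}

/-- Law of the coordinate `t` under the (not necessarily normalized) law `P` of a family. -/
noncomputable def marginal (P : (ι → Ω) → ℝ) (t : ι) (a : Ω) : ℝ :=
  mass P {ω | ω t = a}

lemma sum_marginal_mul (P : (ι → Ω) → ℝ) (t : ι) (f : Ω → ℝ) :
    ∑ a, marginal P t a * f a = ∑ ω, P ω * f (ω t) := by
  classical
  simp only [marginal, mass, Set.indicator_apply, Set.mem_ofPred_eq, Finset.sum_mul, ite_mul,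
    zero_mul]
  rw [Finset.sum_comm]
  simp only [Finset.sum_ite_eq, Finset.mem_univ, if_true]

lemma sum_marginal (P : (ι → Ω) → ℝ) (t : ι) : ∑ a, marginal P t a = ∑ ω, P ω := by
  simpa using sum_marginal_mul P t fun _ => 1

lemma marginal_nonneg (hP : ∀ ω, 0 ≤ P ω) (t : ι) (a : Ω) : 0 ≤ marginal P t a :=
  mass_nonneg hP _

lemma le_marginal (hP : ∀ ω, 0 ≤ P ω) (t : ι) (ω : ι → Ω) : P ω ≤ marginal P t (ω t) := by
  have hsingle := Finset.single_le_sum (f := {ω' | ω' t = ω t}.indicator P)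
    (fun ω' _ => Set.indicator_nonneg (fun ω _ => hP ω) ω') (Finset.mem_univ ω)
  rwa [Set.indicator_of_mem (show ω ∈ {ω' | ω' t = ω t} from rfl)] at hsingle

lemma sum_marginal_comm {Y : Type*} [Fintype Y] (W : Y → (ι → Ω) → ℝ) (t : ι) (a : Ω) :
    ∑ y, marginal (W y) t a = marginal (fun ω => ∑ y, W y ω) t a := by
  classical
  simp only [marginal, mass, Set.indicator_apply]
  rw [Finset.sum_comm]
  simp

lemma marginal_prodLaw (hν : ∀ t, ∑ a, ν t a = 1) (t : ι) (a : Ω) :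
    marginal (prodLaw ν) t a = ν t a := by
  classical
  simpa [marginal, mass, Set.indicator_apply] using
    sum_prodLaw_mul_apply hν t fun b => if b = a then 1 else 0

lemma marginal_div_sum_pos (hP : ∀ ω, 0 ≤ P ω) (t : ι) {ω : ι → Ω} (hω : P ω ≠ 0) :
    0 < marginal P t (ω t) / ∑ ω', P ω' := by
  have hpos : 0 < P ω := (hP ω).lt_of_ne' hω
  refine div_pos (hpos.trans_le (le_marginal hP t ω)) (hpos.trans_le ?_)
  exact Finset.single_le_sum (fun ω _ => hP ω) (Finset.mem_univ ω)

/-- Chain rule: the total correlation of `P` is what separates its divergence from a product law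
from the divergences of its marginals. -/
lemma relEntropy_mul_prodLaw (hP : ∀ ω, 0 ≤ P ω) (hPν : ∀ ω t, P ω ≠ 0 → ν t (ω t) ≠ 0) :
    relEntropy P (fun ω => (∑ ω', P ω') * prodLaw ν ω) =
      (∑ t, relEntropy (marginal P t) fun a => (∑ ω', P ω') * ν t a) +
        relEntropy P fun ω =>
          (∑ ω', P ω') * prodLaw (fun t a => marginal P t a / ∑ ω', P ω') ω := by
  simp only [relEntropy, sum_marginal_mul P _ fun a => Real.log (marginal P _ a / _)]
  rw [Finset.sum_comm, ← Finset.sum_add_distrib]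
  refine Finset.sum_congr rfl fun ω _ => ?_
  by_cases hω : P ω = 0
  · simp [hω]
  have hsum : ∑ ω', P ω' ≠ 0 :=
    (((hP ω).lt_of_ne' hω).trans_le
      (Finset.single_le_sum (fun ω _ => hP ω) (Finset.mem_univ ω))).ne'
  have hmarg : ∀ t, marginal P t (ω t) / ∑ ω', P ω' ≠ 0 := fun t =>
    (marginal_div_sum_pos hP t hω).ne'
  have hν : ∀ t, ν t (ω t) ≠ 0 := fun t => hPν ω t hω
  simp only [← div_div, Real.log_div (hmarg _) (hν _)]
  rw [Real.log_div (div_ne_zero hω hsum) (prodLaw_ne_zero hν), log_prodLaw hν,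
    Real.log_div (div_ne_zero hω hsum)
      (prodLaw_ne_zero (w := fun t a => marginal P t a / ∑ ω', P ω') hmarg),
    log_prodLaw (w := fun t a => marginal P t a / ∑ ω', P ω') hmarg, ← Finset.mul_sum,
    Finset.sum_sub_distrib]
  ring

lemma sum_relEntropy_marginal_le (hP : ∀ ω, 0 ≤ P ω) (hPν : ∀ ω t, P ω ≠ 0 → ν t (ω t) ≠ 0) :
    ∑ t, relEntropy (marginal P t) (fun a => (∑ ω, P ω) * ν t a) ≤
      relEntropy P fun ω => (∑ ω, P ω) * prodLaw ν ω := by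
  rw [relEntropy_mul_prodLaw hP hPν]
  have hsum : 0 ≤ ∑ ω, P ω := Finset.sum_nonneg fun ω _ => hP ω
  have hgibbs := sum_sub_sum_le_relEntropy hP
    (q := fun ω => (∑ ω', P ω') * prodLaw (fun t a => marginal P t a / ∑ ω', P ω') ω)
    (fun ω => mul_nonneg hsum <| Finset.prod_nonneg fun t _ =>
      div_nonneg (marginal_nonneg hP t _) hsum)
    fun ω hω => by
      by_contra hPω
      rcases mul_eq_zero.1 hω with h | h
      · rw [Fintype.sum_eq_zero_iff_of_nonneg hP] at h
        exact hPω (congrFun h ω)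
      · exact prodLaw_ne_zero (w := fun t a => marginal P t a / ∑ ω', P ω')
          (fun t => (marginal_div_sum_pos hP t hPω).ne') h
  have hmass : ∑ ω, (∑ ω', P ω') * prodLaw (fun t a => marginal P t a / ∑ ω', P ω') ω ≤
      ∑ ω, P ω := by
    rw [← Finset.mul_sum, sum_prodLaw]
    simp only [← Finset.sum_div, sum_marginal]
    exact mul_le_of_le_one_right hsum
      (Finset.prod_le_one (fun _ _ => div_nonneg hsum hsum) fun _ _ => div_self_le_one _)
  linarith

lemma sum_relEntropy_sum_mul_le {Y S : Type*} [Fintype Y] [Fintype S] {W g : Y → S → ℝ}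
    {q : Y → ℝ} (hW : ∀ y s, 0 ≤ W y s) (hq : ∀ y, 0 ≤ q y) (hqW : ∑ y, q y ≤ ∑ y, ∑ s, W y s)
    (hWq : ∀ y s, W y s ≠ 0 → q y ≠ 0) (hWg : ∀ y s, W y s ≠ 0 → g y s ≠ 0) :
    ∑ y, relEntropy (W y) (fun s => (∑ s', W y s') * g y s) ≤
      ∑ y, relEntropy (W y) fun s => q y * g y s := by
  have hgibbs := sum_sub_sum_le_relEntropy (p := fun y => ∑ s, W y s) (q := q)
    (fun y => Finset.sum_nonneg fun s _ => hW y s) hq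
    fun y hy => Finset.sum_eq_zero fun s _ => by_contra fun h => hWq y s h hy
  have hchange : ∀ y, relEntropy (W y) (fun s => q y * g y s) =
      relEntropy (W y) (fun s => (∑ s', W y s') * g y s) +
        (∑ s, W y s) * Real.log ((∑ s, W y s) / q y) := fun y => by
    rw [relEntropy, relEntropy, Finset.sum_mul, ← Finset.sum_add_distrib]
    refine Finset.sum_congr rfl fun s _ => ?_
    by_cases hs : W y s = 0
    · simp [hs]
    have hsum : ∑ s, W y s ≠ 0 := (((hW y s).lt_of_ne' hs).trans_le
      (Finset.single_le_sum (fun s _ => hW y s) (Finset.mem_univ s))).ne'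
    have hqy := hWq y s hs
    have hgy := hWg y s hs
    rw [Real.log_div hs (mul_ne_zero hqy hgy), Real.log_div hs (mul_ne_zero hsum hgy),
      Real.log_mul hqy hgy, Real.log_mul hsum hgy, Real.log_div hsum hqy]
    ring
  simp only [hchange, Finset.sum_add_distrib]
  rw [relEntropy] at hgibbs
  linarith

end Marginals

section Mixtures

variable {U V : Type*}

/-- Joint law of the input and the output of the kernel `K` when its input has law `p`. -/
def compProd (p : U → ℝ) (K : U → V → ℝ) (a : U × V) : ℝ :=
  p a.1 * K a.1 a.2

lemma compProd_nonneg {p : U → ℝ} {K : U → V → ℝ} (hp : ∀ u, 0 ≤ p u) (hK : ∀ u v, 0 ≤ K u v)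
    (a : U × V) : 0 ≤ compProd p K a :=
  mul_nonneg (hp _) (hK _ _)

variable [Fintype U]

/-- Law of the output of the kernel `K` when its input has law `p`. -/
def mixture (p : U → ℝ) (K : U → V → ℝ) (v : V) : ℝ :=
  ∑ u, p u * K u v

lemma mul_le_mixture {p : U → ℝ} {K : U → V → ℝ} (hp : ∀ u, 0 ≤ p u) (hK : ∀ u v, 0 ≤ K u v)
    (u : U) (v : V) : p u * K u v ≤ mixture p K v :=
  Finset.single_le_sum (f := fun u => p u * K u v) (fun u _ => mul_nonneg (hp u) (hK u v))
    (Finset.mem_univ u)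

lemma mixture_nonneg {p : U → ℝ} {K : U → V → ℝ} (hp : ∀ u, 0 ≤ p u) (hK : ∀ u v, 0 ≤ K u v)
    (v : V) : 0 ≤ mixture p K v :=
  Finset.sum_nonneg fun u _ => mul_nonneg (hp u) (hK u v)

lemma mixture_prodLaw {ι : Type*} [Fintype ι] [DecidableEq ι] (p : ι → U → ℝ)
    (K : ι → U → V → ℝ) :
    mixture (prodLaw p) (fun u => prodLaw fun i => K i (u i)) =
      prodLaw fun i => mixture (p i) (K i) := by
  funext v
  simp only [mixture, prodLaw, ← Finset.prod_mul_distrib]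
  exact sum_prodLaw fun i u => p i u * K i u (v i)

variable [Fintype V]

lemma sum_mixture_mul (p : U → ℝ) (K : U → V → ℝ) (f : V → ℝ) :
    ∑ v, mixture p K v * f v = ∑ u, p u * ∑ v, K u v * f v := by
  simp only [mixture, Finset.sum_mul, Finset.mul_sum, mul_assoc]
  exact Finset.sum_comm

lemma sum_mixture {K : U → V → ℝ} (hK : ∀ u, ∑ v, K u v = 1) (p : U → ℝ) :
    ∑ v, mixture p K v = ∑ u, p u := by
  simpa [hK] using sum_mixture_mul p K fun _ => 1

lemma mixture_mem_stdSimplex {p : U → ℝ} {K : U → V → ℝ} (hp : p ∈ stdSimplex ℝ U)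
    (hK : ∀ u, K u ∈ stdSimplex ℝ V) : mixture p K ∈ stdSimplex ℝ V :=
  ⟨mixture_nonneg hp.1 fun u => (hK u).1, (sum_mixture (fun u => (hK u).2) p).trans hp.2⟩

lemma compProd_mem_stdSimplex {p : U → ℝ} {K : U → V → ℝ} (hp : p ∈ stdSimplex ℝ U)
    (hK : ∀ u, K u ∈ stdSimplex ℝ V) : compProd p K ∈ stdSimplex ℝ (U × V) :=
  ⟨compProd_nonneg hp.1 fun u => (hK u).1, by
    simp [compProd, Fintype.sum_prod_type, ← Finset.mul_sum, (hK _).2, hp.2]⟩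

lemma sum_compProd_mul_fst {K : U → V → ℝ} (hK : ∀ u, K u ∈ stdSimplex ℝ V) (p : U → ℝ)
    (f : U → ℝ) : ∑ a, compProd p K a * f a.1 = ∑ u, p u * f u := by
  simp only [compProd, Fintype.sum_prod_type, ← Finset.sum_mul, ← Finset.mul_sum, (hK _).2, mul_one]

lemma sum_compProd_mul_snd (p : U → ℝ) (K : U → V → ℝ) (f : V → ℝ) :
    ∑ a, compProd p K a * f a.2 = ∑ v, mixture p K v * f v := by
  simp only [compProd, mixture, Fintype.sum_prod_type_right, Finset.sum_mul]

lemma mass_prod_left (J : U × V → ℝ) (E : Set (U × V)) :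
    mass J E = ∑ u, mass (fun v => J (u, v)) {v | (u, v) ∈ E} := by
  classical
  simp only [mass, Fintype.sum_prod_type, Set.indicator_apply, Set.mem_ofPred_eq]

lemma mass_prod_right (J : U × V → ℝ) (E : Set (U × V)) :
    mass J E = ∑ v, mass (fun u => J (u, v)) {u | (u, v) ∈ E} := by
  classical
  simp only [mass, Fintype.sum_prod_type_right, Set.indicator_apply, Set.mem_ofPred_eq]

lemma mass_mul_left (c : ℝ) (p : U → ℝ) (E : Set U) :
    mass (fun u => c * p u) E = c * mass p E := by
  classical
  simp only [mass, Set.indicator_apply, Finset.mul_sum, mul_ite, mul_zero]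

lemma mass_compProd (p : U → ℝ) (K : U → V → ℝ) (E : Set (U × V)) :
    mass (compProd p K) E = ∑ u, p u * mass (K u) {v | (u, v) ∈ E} := by
  simp only [mass_prod_left, compProd, mass_mul_left]

lemma mass_mixture (p : U → ℝ) (K : U → V → ℝ) (E : Set V) :
    mass (mixture p K) E = mass (compProd p K) {a | a.2 ∈ E} := by
  classical
  rw [mass_compProd]
  simpa [mass, Set.indicator_apply] using sum_mixture_mul p K (E.indicator 1)

lemma mass_compProd_prodLaw {ι : Type*} [Fintype ι] [DecidableEq ι] (p : ι → U → ℝ)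
    (K : ι → U → V → ℝ) (E : Set ((ι → U) × (ι → V))) :
    mass (compProd (prodLaw p) fun u => prodLaw fun i => K i (u i)) E =
      mass (prodLaw fun i => compProd (p i) (K i))
        {a | (fun i => (a i).1, fun i => (a i).2) ∈ E} := by
  classical
  rw [mass, mass, ← (Equiv.arrowProdEquivProdArrow ι (fun _ => U) (fun _ => V)).sum_comp]
  refine Finset.sum_congr rfl fun a _ => ?_
  simp only [Set.indicator_apply, Equiv.arrowProdEquivProdArrow_apply, Set.mem_ofPred_eq, compProd,
    prodLaw, Finset.prod_mul_distrib]

lemma entropy_mul_log_two (q : V → ℝ) :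
    entropy q * Real.log 2 = -∑ v, q v * Real.log (q v) := by
  have : Real.log 2 ≠ 0 := (Real.log_pos one_lt_two).ne'
  rw [entropy, neg_mul, Finset.sum_mul]
  congr 1
  refine Finset.sum_congr rfl fun v _ => ?_
  rw [Real.logb]
  field_simp

lemma entropy_mixture_sub_mul_log_two {p : U → ℝ} {K : U → V → ℝ} (hp : ∀ u, 0 ≤ p u)
    (hK : ∀ u v, 0 ≤ K u v) :
    (entropy (mixture p K) - ∑ u, p u * entropy (K u)) * Real.log 2 =
      ∑ u, p u * relEntropy (K u) (mixture p K) := by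
  rw [sub_mul, entropy_mul_log_two, Finset.sum_mul, sum_mixture_mul, ← Finset.sum_neg_distrib,
    ← Finset.sum_sub_distrib]
  refine Finset.sum_congr rfl fun u _ => ?_
  rw [mul_assoc, entropy_mul_log_two, relEntropy, mul_neg, sub_neg_eq_add, neg_add_eq_sub,
    ← mul_sub, ← Finset.sum_sub_distrib, Finset.mul_sum, Finset.mul_sum]
  refine Finset.sum_congr rfl fun v _ => ?_
  by_cases huv : p u * K u v = 0
  · rcases mul_eq_zero.1 huv with h | h <;> simp [h]
  have hmix : mixture p K v ≠ 0 := (((mul_nonneg (hp u) (hK u v)).lt_of_ne' huv).trans_le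
    (mul_le_mixture hp hK u v)).ne'
  rw [Real.log_div (right_ne_zero_of_mul huv) hmix]
  ring

end Mixtures

section Covering

variable {U V : Type*} [Fintype V] {p : V → ℝ} {G : Set (V × U)} {J : V × U → ℝ} {m : U → ℝ}

lemma one_div_le_mass_section {a : ℝ} {u : U} (ha : 0 < a) (hm : 0 < m u)
    (hgood : m u ≤ 2 * mass (fun v => J (v, u)) {v | (v, u) ∈ G})
    (hG : ∀ v, (v, u) ∈ G → J (v, u) ≤ a * (p v * m u)) :
    1 / (2 * a) ≤ mass p {v | (v, u) ∈ G} := by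
  have hle : mass (fun v => J (v, u)) {v | (v, u) ∈ G} ≤ a * m u * mass p {v | (v, u) ∈ G} := by
    rw [← mass_mul_left]
    refine Finset.sum_le_sum fun v _ => Set.indicator_rel_indicator le_rfl fun hv => ?_
    linarith [hG v hv]
  rw [div_le_iff₀ (by positivity)]
  exact le_of_mul_le_mul_left (by linarith : m u * 1 ≤ _) hm

variable [Fintype U]

lemma exists_mass_uncovered_le {f : U → ℝ} {θ : ℝ} (hf : ∀ u, 0 ≤ f u) (hp : p ∈ stdSimplex ℝ V)
    (hθ : ∀ u, f u ≠ 0 → θ ≤ mass p {v | (v, u) ∈ G}) :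
    ∃ v, mass f {u | (v, u) ∉ G} ≤ (1 - θ) * ∑ u, f u := by
  have hmean : ∑ v, p v * mass f {u | (v, u) ∉ G} ≤ (1 - θ) * ∑ u, f u := by
    calc ∑ v, p v * mass f {u | (v, u) ∉ G}
        = mass (compProd p fun _ => f) Gᶜ := (mass_compProd p (fun _ => f) Gᶜ).symm
      _ = ∑ u, f u * mass p {v | (v, u) ∈ G}ᶜ := by
        simp only [mass_prod_right, compProd, mul_comm _ (f _), mass_mul_left]
        rfl
      _ ≤ ∑ u, f u * (1 - θ) := Finset.sum_le_sum fun u _ => by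
        by_cases hu : f u = 0
        · simp [hu]
        have hcompl := mass_add_mass_compl p {v | (v, u) ∈ G}
        rw [hp.2] at hcompl
        exact mul_le_mul_of_nonneg_left (by linarith [hθ u hu]) (hf u)
      _ = (1 - θ) * ∑ u, f u := by rw [← Finset.sum_mul, mul_comm]
  obtain ⟨v, hv⟩ := exists_apply_le_sum_mul hp fun v => mass f {u | (v, u) ∉ G}
  exact ⟨v, hv.trans hmean⟩

lemma exists_mass_forall_uncovered_le {f : U → ℝ} {θ : ℝ} (hf : ∀ u, 0 ≤ f u)
    (hp : p ∈ stdSimplex ℝ V) (hθ1 : θ ≤ 1) (hθ : ∀ u, f u ≠ 0 → θ ≤ mass p {v | (v, u) ∈ G})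
    (M : ℕ) :
    ∃ c : Fin M → V, mass f {u | ∀ j, (c j, u) ∉ G} ≤ (1 - θ) ^ M * ∑ u, f u := by
  induction M with
  | zero => exact ⟨Fin.elim0, by simp [mass]⟩
  | succ M ih =>
    obtain ⟨c, hc⟩ := ih
    obtain ⟨v, hv⟩ := exists_mass_uncovered_le (f := {u | ∀ j, (c j, u) ∉ G}.indicator f)
      (Set.indicator_nonneg fun u _ => hf u) hp
      fun u hu => hθ u fun hfu => hu (by simp [hfu])
    refine ⟨Fin.cons v c, ?_⟩
    calc mass f {u | ∀ j, (Fin.cons (α := fun _ => V) v c j, u) ∉ G}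
        = mass ({u | ∀ j, (c j, u) ∉ G}.indicator f) {u | (v, u) ∉ G} := by
          simp only [mass, Set.indicator_indicator, Fin.forall_fin_succ, Fin.cons_zero,
            Fin.cons_succ]
          rfl
      _ ≤ (1 - θ) * ((1 - θ) ^ M * ∑ u, f u) :=
          hv.trans (mul_le_mul_of_nonneg_left hc (by linarith))
      _ = (1 - θ) ^ (M + 1) * ∑ u, f u := by ring

lemma mass_setOf_two_mul_lt_le (hJ : ∀ a, 0 ≤ J a)
    (hJm : ∀ u, ∑ v, J (v, u) = m u) (G : Set (V × U)) :
    mass m {u | 2 * mass (fun v => J (v, u)) {v | (v, u) ∈ G} < m u} ≤ 2 * mass J Gᶜ := by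
  rw [mass_prod_right, Finset.mul_sum, mass]
  refine Finset.sum_le_sum fun u _ => Set.indicator_apply_le' (fun hu => ?_) fun _ => ?_
  · have hcompl := mass_add_mass_compl (fun v => J (v, u)) {v | (v, u) ∈ G}
    rw [hJm] at hcompl
    change m u ≤ 2 * mass (fun v => J (v, u)) {v | (v, u) ∈ G}ᶜ
    linarith [Set.mem_ofPred_eq ▸ hu]
  · have := mass_nonneg (fun v => hJ (v, u)) {v | (v, u) ∈ Gᶜ}
    positivity

lemma one_sub_pow_le_exp_neg {x : ℝ} (hx : x ≤ 1) (M : ℕ) : (1 - x) ^ M ≤ Real.exp (-(M * x)) := by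
  rw [← mul_neg, Real.exp_nat_mul]
  exact pow_le_pow_left₀ (by linarith) (Real.one_sub_le_exp_neg x) M

/-- Points `u` to which the good pairs leave at least half of their mass `m u` are covered by a
random codeword with probability at least `1 / (2 * a)`; the others have small total mass. -/
lemma exists_cover {a : ℝ} (hJ : ∀ b, 0 ≤ J b) (hp : p ∈ stdSimplex ℝ V) (hm : m ∈ stdSimplex ℝ U)
    (hJm : ∀ u, ∑ v, J (v, u) = m u) (ha : 1 ≤ a)
    (hG : ∀ v u, (v, u) ∈ G → J (v, u) ≤ a * (p v * m u)) (M : ℕ) :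
    ∃ c : Fin M → V,
      mass m {u | ∀ j, (c j, u) ∉ G} ≤ 2 * mass J Gᶜ + Real.exp (-(M / (2 * a))) := by
  have ha0 : 0 < a := by linarith
  have hθ1 : 1 / (2 * a) ≤ 1 := by rw [div_le_one (by positivity)]; linarith
  set bad : Set U := {u | 2 * mass (fun v => J (v, u)) {v | (v, u) ∈ G} < m u}
  have hcovered : ∀ u, badᶜ.indicator m u ≠ 0 → 1 / (2 * a) ≤ mass p {v | (v, u) ∈ G} :=
    fun u hu => one_div_le_mass_section ha0
      ((hm.1 u).lt_of_ne' fun h => hu (by simp [Set.indicator_apply, h]))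
      (not_lt.1 (Set.mem_of_indicator_ne_zero hu)) fun v => hG v u
  obtain ⟨c, hc⟩ := exists_mass_forall_uncovered_le
    (Set.indicator_nonneg fun u _ => hm.1 u) hp hθ1 hcovered M
  refine ⟨c, ?_⟩
  set rest : Set U := {u | ∀ j, (c j, u) ∉ G}
  have hexp : mass (badᶜ.indicator m) rest ≤ Real.exp (-(M / (2 * a))) := by
    calc mass (badᶜ.indicator m) rest ≤ (1 - 1 / (2 * a)) ^ M * mass m badᶜ := hc
      _ ≤ (1 - 1 / (2 * a)) ^ M := mul_le_of_le_one_right (pow_nonneg (by linarith) M)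
          ((mass_le_sum hm.1 _).trans_eq hm.2)
      _ ≤ Real.exp (-(M / (2 * a))) := by
          simpa only [mul_one_div] using one_sub_pow_le_exp_neg hθ1 M
  calc mass m rest ≤ mass m (bad ∪ (rest ∩ badᶜ)) :=
        mass_mono hm.1 fun u hu _ => (em (u ∈ bad)).imp id fun h => ⟨hu, h⟩
    _ ≤ mass m bad + mass m (rest ∩ badᶜ) := mass_union_le hm.1 _ _
    _ ≤ 2 * mass J Gᶜ + Real.exp (-(M / (2 * a))) :=
        add_le_add (mass_setOf_two_mul_lt_le hJ hJm G) (by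
          simpa only [mass, Set.indicator_indicator] using hexp)

end Covering

section ChannelCoding

variable {U V : Type*} {K : U → V → ℝ} {γ ε : ℝ}

lemma exists_decoder_succ {M : ℕ} (d : V → Option (Fin M)) (E : Set V) :
    ∃ d' : V → Option (Fin (M + 1)), (∀ v, d' v = some 0 ↔ d v = none ∧ v ∈ E) ∧
      ∀ v j, d' v = some (Fin.succ j) ↔ d v = some j := by
  classical
  refine ⟨fun v => (d v).elim (if v ∈ E then some 0 else none) fun j => some j.succ,
    fun v => ?_, fun v j => ?_⟩ <;>
  rcases hd : d v with _ | i <;> by_cases hv : v ∈ E <;> simp [hd, hv, (Fin.succ_ne_zero _).symm]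

variable [Fintype V]

lemma mass_decoded_le {q : V → ℝ} {M : ℕ} {c : Fin M → U} {d : V → Option (Fin M)}
    (hK : ∀ u, K u ∈ stdSimplex ℝ V) (hγ : 0 < γ)
    (hd : ∀ j v, d v = some j → γ * q v ≤ K (c j) v) :
    mass q {v | d v ≠ none} ≤ M / γ := by
  rw [le_div_iff₀ hγ, mul_comm, ← mass_mul_left]
  calc mass (fun v => γ * q v) {v | d v ≠ none}
      ≤ ∑ v, ∑ j, K (c j) v := Finset.sum_le_sum fun v _ =>
        Set.indicator_apply_le' (fun hv => ?_) fun _ => Finset.sum_nonneg fun j _ => (hK _).1 v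
    _ = M := by rw [Finset.sum_comm]; simp [(hK _).2]
  obtain ⟨j, hj⟩ := Option.ne_none_iff_exists'.1 hv
  exact (hd j v hj).trans
    (Finset.single_le_sum (f := fun j => K (c j) v) (fun j _ => (hK _).1 v) (Finset.mem_univ j))

variable [Fintype U] {p : U → ℝ} {B : Set (U × V)}

lemma exists_le_mass_section {D : Set V} (hK : ∀ u, K u ∈ stdSimplex ℝ V)
    (hp : p ∈ stdSimplex ℝ U) (hε : mass (compProd p K) Bᶜ + mass (mixture p K) D ≤ ε) :
    ∃ u, 1 - ε ≤ mass (K u) {v | v ∉ D ∧ (u, v) ∈ B} := by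
  have hJ := compProd_mem_stdSimplex hp hK
  set F : Set (U × V) := {a | a.2 ∉ D ∧ a ∈ B} with hF
  have hcompl : mass (compProd p K) Fᶜ ≤ ε := by
    refine le_trans ?_ hε
    rw [mass_mixture]
    refine (mass_mono hJ.1 fun a ha _ => ?_).trans (mass_union_le hJ.1 _ _)
    by_contra h
    simp only [Set.mem_union, Set.mem_compl_iff, Set.mem_ofPred_eq, hF] at ha h
    tauto
  obtain ⟨u, hu⟩ := exists_sum_mul_le_apply hp fun u => mass (K u) {v | (u, v) ∈ F}
  rw [← mass_compProd] at hu
  have htotal := mass_add_mass_compl (compProd p K) F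
  rw [hJ.2] at htotal
  exact ⟨u, le_trans (by linarith) hu⟩

/-- Feinstein's greedy construction: as long as few outputs are decoded, some input still reaches
its undecoded good outputs with probability at least `1 - ε`. -/
lemma exists_feinstein_code (hK : ∀ u, K u ∈ stdSimplex ℝ V) (hp : p ∈ stdSimplex ℝ U)
    (hγ : 0 < γ) (hB : ∀ u v, (u, v) ∈ B → γ * mixture p K v ≤ K u v) (M : ℕ)
    (hε : mass (compProd p K) Bᶜ + M / γ ≤ ε) :
    ∃ (c : Fin M → U) (d : V → Option (Fin M)), (∀ j v, d v = some j → (c j, v) ∈ B) ∧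
      ∀ j, 1 - ε ≤ mass (K (c j)) {v | d v = some j} := by
  induction M with
  | zero => exact ⟨Fin.elim0, fun _ => none, by simp, fun j => j.elim0⟩
  | succ M ih =>
    have hmono : (M : ℝ) / γ ≤ ((M + 1 : ℕ) : ℝ) / γ := by gcongr; simp
    obtain ⟨c, d, hdB, hd⟩ := ih (by linarith)
    have hdecoded := mass_decoded_le hK hγ fun j v hj => hB _ _ (hdB j v hj)
    obtain ⟨u, hu⟩ := exists_le_mass_section (B := B) (D := {v | d v ≠ none}) hK hp (ε := ε)
      (by linarith)
    obtain ⟨d', hzero, hsucc⟩ := exists_decoder_succ d {v | (u, v) ∈ B}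
    refine ⟨Fin.cons u c, d', fun j v => ?_, fun j => ?_⟩ <;> refine Fin.cases ?_ (fun i => ?_) j
    · exact fun hv => ((hzero v).1 hv).2
    · exact fun hv => hdB i v ((hsucc v i).1 hv)
    · simpa only [Fin.cons_zero, hzero, Set.mem_ofPred_eq, not_not] using hu
    · simpa only [Fin.cons_succ, hsucc] using hd i

variable {X Y : Type*} {Q : X → Y → ℝ}

lemma seqChannel_mem_stdSimplex [Fintype Y] {k : ℕ} (hQ : ∀ x, Q x ∈ stdSimplex ℝ Y)
    (x : Fin k → X) :
    seqChannel Q x ∈ stdSimplex ℝ (Fin k → Y) :=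
  prodLaw_mem_stdSimplex fun t => hQ (x t)

variable [Fintype X] {p : X → ℝ}

lemma exp_mul_prodLaw_mixture_le_seqChannel {k : ℕ} (hp : ∀ x, 0 ≤ p x) (hQ : ∀ x y, 0 ≤ Q x y)
    {x : Fin k → X} {y : Fin k → Y} {R : ℝ} (hpQ : ∀ t, p (x t) * Q (x t) (y t) ≠ 0)
    (hR : R ≤ ∑ t, Real.log (Q (x t) (y t) / mixture p Q (y t))) :
    Real.exp R * prodLaw (fun _ => mixture p Q) y ≤ seqChannel Q x y := by
  have hQpos : ∀ t, 0 < Q (x t) (y t) := fun t =>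
    (hQ _ _).lt_of_ne' (right_ne_zero_of_mul (hpQ t))
  have hmix : ∀ t, 0 < mixture p Q (y t) := fun t =>
    ((mul_nonneg (hp _) (hQ _ _)).lt_of_ne' (hpQ t)).trans_le (mul_le_mixture hp hQ _ _)
  calc Real.exp R * prodLaw (fun _ => mixture p Q) y
      ≤ Real.exp (∑ t, Real.log (Q (x t) (y t) / mixture p Q (y t))) *
          prodLaw (fun _ => mixture p Q) y :=
        mul_le_mul_of_nonneg_right (Real.exp_le_exp.2 hR)
          (Finset.prod_nonneg fun t _ => (hmix t).le)
    _ = seqChannel Q x y := by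
        rw [Real.exp_sum, prodLaw, ← Finset.prod_mul_distrib]
        refine Finset.prod_congr rfl fun t _ => ?_
        rw [Real.exp_log (div_pos (hQpos t) (hmix t)), div_mul_cancel₀ _ (hmix t).ne']

variable [Fintype Y]

/-- Law of large numbers for the information density of independent uses of the channel. -/
lemma mass_compProd_seqChannel_le {k : ℕ} (hk : 0 < k) (hp : p ∈ stdSimplex ℝ X)
    (hQ : ∀ x, Q x ∈ stdSimplex ℝ Y) {δ : ℝ} (hδ : 0 < δ) :
    mass (compProd (prodLaw fun _ : Fin k => p) (seqChannel Q))
        {a | Real.exp (k * (mutualInfo Q p * Real.log 2 - δ)) *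
          prodLaw (fun _ => mixture p Q) a.2 ≤ seqChannel Q a.1 a.2}ᶜ ≤
      (∑ a : X × Y, |Real.log (Q a.1 a.2 / mixture p Q a.2)|) ^ 2 / (k * δ ^ 2) := by
  have hne : Nonempty (Fin k) := ⟨⟨0, hk⟩⟩
  set density : X × Y → ℝ := fun a => Real.log (Q a.1 a.2 / mixture p Q a.2)
  have hmean : ∑ _t : Fin k, ∑ a, compProd p Q a * density a =
      k * (mutualInfo Q p * Real.log 2) := by
    rw [mutualInfo, show (fun y => ∑ x, p x * Q x y) = mixture p Q from rfl,
      entropy_mixture_sub_mul_log_two hp.1 fun x => (hQ x).1]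
    simp only [Finset.sum_const, Finset.card_univ, Fintype.card_fin, nsmul_eq_mul, compProd,
      Fintype.sum_prod_type, relEntropy, Finset.mul_sum, mul_assoc, density]
  have hcheb := mass_prodLaw_le_of_abs_sub_sum_ge
    (fun _ : Fin k => compProd_mem_stdSimplex hp hQ) (f := fun _ => density)
    (fun _ => abs_le_sum_abs_univ density) hδ
  rw [Fintype.card_fin, hmean] at hcheb
  refine (mass_compProd_prodLaw (fun _ => p) (fun _ => Q) _).trans_le ?_
  refine (mass_mono (prodLaw_mem_stdSimplex fun _ => compProd_mem_stdSimplex hp hQ).1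
    fun a ha ha0 => ?_).trans hcheb
  by_contra hlt
  simp only [Set.mem_ofPred_eq, not_le] at hlt
  refine ha (exp_mul_prodLaw_mixture_le_seqChannel hp.1 (fun x => (hQ x).1)
    (fun t => Finset.prod_ne_zero_iff.1 ha0 t (Finset.mem_univ t)) ?_)
  linarith [(abs_lt.1 hlt).1]

lemma exists_lt_mutualInfo [Nonempty X] {ρ : ℝ} (hρ : ρ < capacity Q) :
    ∃ p ∈ stdSimplex ℝ X, ρ < mutualInfo Q p := by
  classical
  have hne : (mutualInfo Q '' stdSimplex ℝ X).Nonempty :=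
    ⟨_, Pi.single (Classical.arbitrary X) 1, single_mem_stdSimplex ℝ _, rfl⟩
  obtain ⟨_, ⟨p, hp, rfl⟩, hlt⟩ := exists_lt_of_lt_csSup hne hρ
  exact ⟨p, hp, hlt⟩

lemma eventually_div_add_exp_le (c : ℝ) {δ ε : ℝ} (hδ : 0 < δ) (hε : 0 < ε) :
    ∀ᶠ k : ℕ in atTop, c / (k * δ ^ 2) + Real.exp (-(k * δ)) ≤ ε := by
  have hk : Tendsto (fun k : ℕ => (k : ℝ)) atTop atTop := tendsto_natCast_atTop_atTop
  have hdiv : Tendsto (fun k : ℕ => c / (k * δ ^ 2)) atTop (𝓝 0) :=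
    (hk.atTop_mul_const (by positivity)).const_div_atTop _
  have hexp : Tendsto (fun k : ℕ => Real.exp (-(k * δ))) atTop (𝓝 0) :=
    Real.tendsto_exp_neg_atTop_nhds_zero.comp (hk.atTop_mul_const hδ)
  have hlim := hdiv.add hexp
  rw [add_zero] at hlim
  exact hlim.eventually (ge_mem_nhds hε)

/-- Shannon's channel coding theorem with maximal error probability. The decoder may give up, and
the rate `ρ` is in nats, whence the factor `Real.log 2`. -/
theorem eventually_exists_code [Nonempty X] (hQ : ∀ x, Q x ∈ stdSimplex ℝ Y) {ρ ε : ℝ}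
    (hρ : ρ < capacity Q * Real.log 2) (hε : 0 < ε) :
    ∀ᶠ k : ℕ in atTop, ∀ M : ℕ, (M : ℝ) ≤ Real.exp (k * ρ) →
      ∃ (c : Fin M → Fin k → X) (d : (Fin k → Y) → Option (Fin M)),
        ∀ j, 1 - ε ≤ mass (seqChannel Q (c j)) {y | d y = some j} := by
  have hlog : 0 < Real.log 2 := Real.log_pos one_lt_two
  obtain ⟨p, hp, hpρ⟩ := exists_lt_mutualInfo ((div_lt_iff₀ hlog).2 hρ)
  rw [div_lt_iff₀ hlog] at hpρ
  set I := mutualInfo Q p * Real.log 2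
  have hδ : 0 < (I - ρ) / 2 := by linarith
  filter_upwards [eventually_gt_atTop 0, eventually_div_add_exp_le
    ((∑ a : X × Y, |Real.log (Q a.1 a.2 / mixture p Q a.2)|) ^ 2) hδ hε] with k hk0 hk M hM
  have hdensity := mass_compProd_seqChannel_le hk0 hp hQ hδ
  have hsize : M / Real.exp (k * (I - (I - ρ) / 2)) ≤ Real.exp (-(k * ((I - ρ) / 2))) := by
    rw [div_le_iff₀ (Real.exp_pos _), ← Real.exp_add]
    exact hM.trans_eq (by ring_nf)
  obtain ⟨c, d, -, hcode⟩ := exists_feinstein_code (ε := ε) (seqChannel_mem_stdSimplex hQ)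
    (prodLaw_mem_stdSimplex fun _ : Fin k => hp) (Real.exp_pos _)
    (fun x y hxy => (mixture_prodLaw (fun _ : Fin k => p) fun _ => Q) ▸ hxy) M
    ((add_le_add hdensity hsize).trans hk)
  exact ⟨c, d, hcode⟩

lemma eventually_exists_code_of_card_le [Nonempty X] (hQ : ∀ x, Q x ∈ stdSimplex ℝ Y) {ρ ε : ℝ}
    (hρ : ρ < capacity Q * Real.log 2) (hε : 0 < ε) :
    ∀ᶠ k : ℕ in atTop, ∀ (T : Type*) [Fintype T] [Nonempty T],
      (Fintype.card T : ℝ) ≤ Real.exp (k * ρ) →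
        ∃ (c : T → Fin k → X) (d : (Fin k → Y) → T),
          ∀ i, mass (seqChannel Q (c i)) {y | i ≠ d y} ≤ ε := by
  filter_upwards [eventually_exists_code hQ hρ hε] with k hk T _ _ hT
  obtain ⟨c, d, hcd⟩ := hk _ hT
  let e := Fintype.equivFin T
  refine ⟨fun i => c (e i), fun y => (d y).elim (Classical.arbitrary T) e.symm, fun i => ?_⟩
  have hmem := seqChannel_mem_stdSimplex hQ (c (e i))
  have htotal := mass_add_mass_compl (seqChannel Q (c (e i))) {y | d y = some (e i)}
  have hmono : mass (seqChannel Q (c (e i)))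
      {y | i ≠ (d y).elim (Classical.arbitrary T) e.symm} ≤
        mass (seqChannel Q (c (e i))) {y | d y = some (e i)}ᶜ :=
    mass_mono hmem.1 fun y hy _ hdy => hy (by simp [show d y = some (e i) from hdy])
  linarith [hcd (e i), hmem.2]

end ChannelCoding

section RobustPayoff

variable {Ω A Z : Type*} [Fintype Ω] {uS uR : Ω → A → Z → ℝ} {z : Z} {ν : Ω → ℝ}

lemma exists_abs_le {S : Type*} [Finite S] (f : S → ℝ) : ∃ B, 0 ≤ B ∧ ∀ s, |f s| ≤ B := by
  obtain ⟨B, hB⟩ := (Set.finite_range fun s => |f s|).bddAbove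
  exact ⟨max B 0, le_max_right _ _, fun s => le_max_of_le_left (hB ⟨s, rfl⟩)⟩

/-- Distance in `ℓ¹` from the unnormalized belief `w` to the multiple of the belief `ν` that has
the same total mass. -/
def deviation (w ν : Ω → ℝ) : ℝ :=
  ∑ ω, |w ω - (∑ ω', w ω') * ν ω|

lemma deviation_nonneg (w ν : Ω → ℝ) : 0 ≤ deviation w ν :=
  Finset.sum_nonneg fun _ _ => abs_nonneg _

lemma abs_sum_mul_sub_le_mul_deviation {w f : Ω → ℝ} {B : ℝ} (hf : ∀ ω, |f ω| ≤ B) :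
    |∑ ω, w ω * f ω - (∑ ω, w ω) * ∑ ω, ν ω * f ω| ≤ B * deviation w ν := by
  refine le_trans (le_of_eq ?_) (abs_sum_mul_le (w := fun ω => w ω - (∑ ω', w ω') * ν ω) hf)
  rw [Finset.mul_sum, ← Finset.sum_sub_distrib]
  exact congrArg _ (Finset.sum_congr rfl fun ω _ => by ring)

/-- `K` is a constant for the linear lower bound of the sender's payoff near the belief `ν`: at any
unnormalized belief `w`, every optimal action gives the sender the robust payoff at `ν` up to `K`
times the deviation of `w` from `ν`. -/
def LowerBoundAt (uS uR : Ω → A → Z → ℝ) (z : Z) (ν : Ω → ℝ) (K : ℝ) : Prop :=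
  ∀ w : Ω → ℝ, (∀ ω, 0 ≤ w ω) → ∀ a ∈ optActions uR z w,
    (∑ ω, w ω) * robustPayoff uS uR z ν - K * deviation w ν ≤ ∑ ω, w ω * uS ω a z

lemma LowerBoundAt.mono {K K' : ℝ} (h : LowerBoundAt uS uR z ν K) (hK : K ≤ K') :
    LowerBoundAt uS uR z ν K' := fun w hw a ha =>
  (sub_le_sub_left (mul_le_mul_of_nonneg_right hK (deviation_nonneg w ν)) _).trans (h w hw a ha)

lemma sum_mul_le_deviation_of_mem_optActions {w : Ω → ℝ} {a b : A} {R : ℝ}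
    (hR : ∀ ω a, |uR ω a z| ≤ R) (ha : a ∈ optActions uR z w) :
    (∑ ω, w ω) * (∑ ω, ν ω * uR ω b z - ∑ ω, ν ω * uR ω a z) ≤ 2 * R * deviation w ν := by
  have hopt := ha b
  have hdev_a := abs_le.1 (abs_sum_mul_sub_le_mul_deviation (w := w) (ν := ν) fun ω => hR ω a)
  have hdev_b := abs_le.1 (abs_sum_mul_sub_le_mul_deviation (w := w) (ν := ν) fun ω => hR ω b)
  rw [mul_sub]
  linarith [hdev_a.2, hdev_b.1]

variable [Finite A]

lemma robustPayoff_le {a : A} (ha : a ∈ optActions uR z ν) :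
    robustPayoff uS uR z ν ≤ ∑ ω, ν ω * uS ω a z :=
  csInf_le (Set.toFinite _).bddBelow ⟨a, ha, rfl⟩

lemma le_sum_mul_of_mem_optActions {w : Ω → ℝ} {a : A} {B : ℝ} (hB : ∀ ω a, |uS ω a z| ≤ B)
    (hw : ∀ ω, 0 ≤ w ω) (ha : a ∈ optActions uR z ν) :
    (∑ ω, w ω) * robustPayoff uS uR z ν - B * deviation w ν ≤ ∑ ω, w ω * uS ω a z := by
  have hrobust := mul_le_mul_of_nonneg_left (robustPayoff_le (uS := uS) ha)
    (Finset.sum_nonneg fun ω (_ : ω ∈ Finset.univ) => hw ω)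
  have hdev := abs_le.1 (abs_sum_mul_sub_le_mul_deviation (w := w) (ν := ν) fun ω => hB ω a)
  linarith [hdev.1]

variable [Nonempty A]

lemma exists_robustPayoff_eq (uS uR : Ω → A → Z → ℝ) (z : Z) (ν : Ω → ℝ) :
    ∃ a ∈ optActions uR z ν, robustPayoff uS uR z ν = ∑ ω, ν ω * uS ω a z := by
  have hne : (optActions uR z ν).Nonempty := Finite.exists_max fun a => ∑ ω, ν ω * uR ω a z
  obtain ⟨a, ha, heq⟩ := (hne.image fun a => ∑ ω, ν ω * uS ω a z).csInf_mem (Set.toFinite _)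
  exact ⟨a, ha, heq.symm⟩

lemma abs_robustPayoff_le (uR : Ω → A → Z → ℝ) {B : ℝ} (hB : ∀ ω a, |uS ω a z| ≤ B)
    (hν : ν ∈ stdSimplex ℝ Ω) : |robustPayoff uS uR z ν| ≤ B := by
  obtain ⟨a, -, heq⟩ := exists_robustPayoff_eq uS uR z ν
  rw [heq]
  exact abs_sum_mul_le_of_mem hν fun ω => hB ω a

/-- An action that is suboptimal at `ν` by a gap `g` is optimal at `w` only if the total mass of
`w` is at most a multiple of its deviation from `ν`. -/
lemma exists_le_sum_mul_of_mem_optActions (uS uR : Ω → A → Z → ℝ) (z : Z)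
    (hν : ν ∈ stdSimplex ℝ Ω) (a : A) :
    ∃ K, 0 ≤ K ∧ ∀ w : Ω → ℝ, (∀ ω, 0 ≤ w ω) → a ∈ optActions uR z w →
      (∑ ω, w ω) * robustPayoff uS uR z ν - K * deviation w ν ≤ ∑ ω, w ω * uS ω a z := by
  obtain ⟨B, hB0, hB⟩ := exists_abs_le fun i : Ω × A => uS i.1 i.2 z
  obtain ⟨R, hR0, hR⟩ := exists_abs_le fun i : Ω × A => uR i.1 i.2 z
  replace hB := fun ω a => hB (ω, a)
  by_cases ha : a ∈ optActions uR z ν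
  · exact ⟨B, hB0, fun w hw _ => le_sum_mul_of_mem_optActions hB hw ha⟩
  simp only [optActions, Set.mem_ofPred_eq, not_forall, not_le] at ha
  obtain ⟨b, hb⟩ := ha
  set g := ∑ ω, ν ω * uR ω b z - ∑ ω, ν ω * uR ω a z
  have hg0 : 0 < g := sub_pos.2 hb
  refine ⟨2 * B * (2 * R) / g, by positivity, fun w hw hopt => ?_⟩
  have hmass : ∑ ω, w ω ≤ 2 * R * deviation w ν / g := (le_div_iff₀ hg0).2
    (sum_mul_le_deviation_of_mem_optActions (fun ω a => hR (ω, a)) hopt)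
  have hrobust : (∑ ω, w ω) * robustPayoff uS uR z ν ≤ (∑ ω, w ω) * B :=
    mul_le_mul_of_nonneg_left (abs_le.1 (abs_robustPayoff_le uR hB hν)).2
      (Finset.sum_nonneg fun ω _ => hw ω)
  have hlow : -(B * ∑ ω, w ω) ≤ ∑ ω, w ω * uS ω a z := by
    have habs := (abs_le.1 (abs_sum_mul_le (w := w) fun ω => hB ω a)).1
    rwa [Finset.sum_congr rfl fun ω _ => abs_of_nonneg (hw ω)] at habs
  have hscaled := mul_le_mul_of_nonneg_left hmass (mul_nonneg zero_le_two hB0)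
  have hK : 2 * B * (2 * R) / g * deviation w ν = 2 * B * (2 * R * deviation w ν / g) := by ring
  linarith

lemma exists_lowerBoundAt (uS uR : Ω → A → Z → ℝ) (z : Z) (hν : ν ∈ stdSimplex ℝ Ω) :
    ∃ K, 0 ≤ K ∧ LowerBoundAt uS uR z ν K := by
  have := Fintype.ofFinite A
  choose K hK0 hK using exists_le_sum_mul_of_mem_optActions uS uR z hν
  refine ⟨∑ a, K a, Finset.sum_nonneg fun a _ => hK0 a, fun w hw a ha => ?_⟩
  have hle : K a ≤ ∑ a, K a := Finset.single_le_sum (fun a _ => hK0 a) (Finset.mem_univ a)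
  have hmul := mul_le_mul_of_nonneg_right hle (deviation_nonneg w ν)
  linarith [hK a w hw ha]

end RobustPayoff

section Game

variable {Ω A Z X Y : Type*} [Fintype X] {n k : ℕ} {μ : Z → Ω → ℝ} {Q : X → Y → ℝ}
  {z : Fin n → Z} {σ : (Fin n → Ω) → (Fin k → X) → ℝ}

/-- Joint law of the outputs `y` of the channel and of the states `ω` when the sender uses the
strategy `σ`. As a function of `ω` it is the receiver's unnormalized belief after `y`. -/
def jointLaw (μ : Z → Ω → ℝ) (Q : X → Y → ℝ) (z : Fin n → Z)
    (σ : (Fin n → Ω) → (Fin k → X) → ℝ) (y : Fin k → Y) (ω : Fin n → Ω) : ℝ :=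
  seqPrior μ z ω * mixture (σ ω) (seqChannel Q) y

lemma sum_jointLaw [Fintype Y] (hQ : ∀ x, Q x ∈ stdSimplex ℝ Y)
    (hσ : σ ∈ senderStrategies Ω X n k) (ω : Fin n → Ω) :
    ∑ y, jointLaw μ Q z σ y ω = seqPrior μ z ω := by
  simp only [jointLaw]
  rw [← Finset.mul_sum,
    (mixture_mem_stdSimplex (hσ ω) fun x => seqChannel_mem_stdSimplex hQ x).2, mul_one]

open scoped Classical in
/-- The strategy of the sender that sends the inputs `x ω` at the states `ω`. -/
noncomputable def pureStrategy (x : (Fin n → Ω) → Fin k → X) (ω : Fin n → Ω) : (Fin k → X) → ℝ :=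
  Pi.single (x ω) 1

lemma pureStrategy_mem (x : (Fin n → Ω) → Fin k → X) :
    pureStrategy x ∈ senderStrategies Ω X n k := fun ω => by
  classical exact single_mem_stdSimplex ℝ (x ω)

lemma jointLaw_pureStrategy (μ : Z → Ω → ℝ) (Q : X → Y → ℝ) (z : Fin n → Z)
    (x : (Fin n → Ω) → Fin k → X) (y : Fin k → Y) (ω : Fin n → Ω) :
    jointLaw μ Q z (pureStrategy x) y ω = seqPrior μ z ω * seqChannel Q (x ω) y := by
  classical
  rw [jointLaw, mixture, Finset.sum_eq_single (x ω)
    (fun b _ hb => by rw [pureStrategy, Pi.single_eq_of_ne hb, zero_mul]) (by simp), pureStrategy,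
    Pi.single_eq_same, one_mul]

variable [Fintype Ω]

lemma seqPrior_mem_stdSimplex (hμ : ∀ z, μ z ∈ stdSimplex ℝ Ω) (z : Fin n → Z) :
    seqPrior μ z ∈ stdSimplex ℝ (Fin n → Ω) :=
  prodLaw_mem_stdSimplex fun t => hμ (z t)

lemma sum_sum_seqPrior_mul_avgPayoff (u : Ω → A → Z → ℝ) (y : Fin k → Y) (a : Fin n → A) :
    ∑ ω, ∑ x, seqPrior μ z ω * σ ω x * seqChannel Q x y * avgPayoff u z ω a =
      1 / n * ∑ t, ∑ b, marginal (jointLaw μ Q z σ y) t b * u b (a t) (z t) := by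
  simp_rw [sum_marginal_mul (jointLaw μ Q z σ y) _ fun b => u b (a _) (z _)]
  rw [Finset.sum_comm (γ := Fin n), Finset.mul_sum]
  refine Finset.sum_congr rfl fun ω _ => ?_
  simp only [jointLaw, mixture, avgPayoff, Finset.mul_sum, Finset.sum_mul]
  exact Finset.sum_comm.trans
    (Finset.sum_congr rfl fun t _ => Finset.sum_congr rfl fun x _ => by ring)

lemma mem_bestReplies_iff (hn : 0 < n) {uR : Ω → A → Z → ℝ} {τ : (Fin k → Y) → Fin n → A} :
    τ ∈ bestReplies uR μ Q z σ ↔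
      ∀ y t, τ y t ∈ optActions uR (z t) (marginal (jointLaw μ Q z σ y) t) := by
  have hn_inv : (0 : ℝ) < 1 / n := by positivity
  simp only [bestReplies, Set.mem_ofPred_eq, sum_sum_seqPrior_mul_avgPayoff,
    mul_le_mul_iff_right₀ hn_inv]
  refine ⟨fun hτ y t b => ?_, fun hτ y a => Finset.sum_le_sum fun t _ => hτ y t (a t)⟩
  have hdev := hτ y (Function.update (τ y) t b)
  rw [← sub_nonneg, ← Finset.sum_sub_distrib, Finset.sum_eq_single t
    (fun s _ hs => by rw [Function.update_of_ne hs, sub_self]) (by simp), Function.update_self,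
    sub_nonneg] at hdev
  exact hdev

lemma bestReplies_nonempty [Finite A] [Nonempty A] (uR : Ω → A → Z → ℝ) (μ : Z → Ω → ℝ)
    (Q : X → Y → ℝ) (z : Fin n → Z) (σ : (Fin n → Ω) → (Fin k → X) → ℝ) :
    (bestReplies uR μ Q z σ).Nonempty := by
  choose τ hτ using fun y : Fin k → Y => Finite.exists_max fun a : Fin n → A =>
    ∑ ω, ∑ x, seqPrior μ z ω * σ ω x * seqChannel Q x y * avgPayoff uR z ω a
  exact ⟨τ, hτ⟩

variable [Fintype Y]

lemma jointLaw_nonneg (hμ : ∀ z, μ z ∈ stdSimplex ℝ Ω) (hQ : ∀ x, Q x ∈ stdSimplex ℝ Y)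
    (hσ : σ ∈ senderStrategies Ω X n k) (y : Fin k → Y) (ω : Fin n → Ω) :
    0 ≤ jointLaw μ Q z σ y ω :=
  mul_nonneg ((seqPrior_mem_stdSimplex hμ z).1 ω)
    (mixture_nonneg (hσ ω).1 (fun x => (seqChannel_mem_stdSimplex hQ x).1) y)

lemma sum_sum_jointLaw (hμ : ∀ z, μ z ∈ stdSimplex ℝ Ω) (hQ : ∀ x, Q x ∈ stdSimplex ℝ Y)
    (hσ : σ ∈ senderStrategies Ω X n k) : ∑ y, ∑ ω, jointLaw μ Q z σ y ω = 1 := by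
  rw [Finset.sum_comm, Finset.sum_congr rfl fun ω _ => sum_jointLaw hQ hσ ω]
  exact (seqPrior_mem_stdSimplex hμ z).2

lemma sum_marginal_jointLaw (hμ : ∀ z, μ z ∈ stdSimplex ℝ Ω) (hQ : ∀ x, Q x ∈ stdSimplex ℝ Y)
    (hσ : σ ∈ senderStrategies Ω X n k) (t : Fin n) (a : Ω) :
    ∑ y, marginal (jointLaw μ Q z σ y) t a = μ (z t) a := by
  rw [sum_marginal_comm, funext fun ω => sum_jointLaw hQ hσ ω]
  exact marginal_prodLaw (fun t => (hμ (z t)).2) t a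

lemma senderPayoff_eq (u : Ω → A → Z → ℝ) (τ : (Fin k → Y) → Fin n → A) :
    senderPayoff u μ Q z σ τ =
      1 / n * ∑ y, ∑ t, ∑ b, marginal (jointLaw μ Q z σ y) t b * u b (τ y t) (z t) := by
  rw [Finset.mul_sum]
  simp_rw [← sum_sum_seqPrior_mul_avgPayoff u _ (τ _)]
  rw [senderPayoff, Finset.sum_comm (s := (Finset.univ : Finset (Fin k → Y)))]
  exact Finset.sum_congr rfl fun ω _ => Finset.sum_comm

lemma senderPayoff_le (hμ : ∀ z, μ z ∈ stdSimplex ℝ Ω) (hQ : ∀ x, Q x ∈ stdSimplex ℝ Y)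
    (hσ : σ ∈ senderStrategies Ω X n k) (hn : 0 < n) {uS : Ω → A → Z → ℝ} {B : ℝ}
    (hB : ∀ ω a t, |uS ω a (z t)| ≤ B) (τ : (Fin k → Y) → Fin n → A) :
    senderPayoff uS μ Q z σ τ ≤ B := by
  rw [senderPayoff_eq, one_div, inv_mul_le_iff₀ (by positivity)]
  calc ∑ y, ∑ t, ∑ b, marginal (jointLaw μ Q z σ y) t b * uS b (τ y t) (z t)
      ≤ ∑ y, ∑ t : Fin n, ∑ b, marginal (jointLaw μ Q z σ y) t b * B :=
        Finset.sum_le_sum fun y _ => Finset.sum_le_sum fun t _ => Finset.sum_le_sum fun b _ =>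
          mul_le_mul_of_nonneg_left (abs_le.1 (hB _ _ _)).2
            (marginal_nonneg (jointLaw_nonneg hμ hQ hσ y) _ _)
    _ = n * B := by
        rw [Finset.sum_comm]
        simp_rw [← Finset.sum_mul, sum_marginal, sum_sum_jointLaw hμ hQ hσ]
        simp

variable [Finite A]

lemma sInf_senderPayoff_le (uS uR : Ω → A → Z → ℝ) {τ : (Fin k → Y) → Fin n → A}
    (hτ : τ ∈ bestReplies uR μ Q z σ) :
    sInf (senderPayoff uS μ Q z σ '' bestReplies uR μ Q z σ) ≤ senderPayoff uS μ Q z σ τ :=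
  csInf_le (Set.toFinite _).bddBelow ⟨τ, hτ, rfl⟩

variable [Nonempty A]

lemma bddAbove_sInf_senderPayoff (hμ : ∀ z, μ z ∈ stdSimplex ℝ Ω)
    (hQ : ∀ x, Q x ∈ stdSimplex ℝ Y) (hn : 0 < n) (uS uR : Ω → A → Z → ℝ) :
    BddAbove ((fun σ => sInf (senderPayoff uS μ Q z σ '' bestReplies uR μ Q z σ)) ''
      senderStrategies Ω X n k) := by
  obtain ⟨B, -, hB⟩ := exists_abs_le fun i : Ω × A × Fin n => uS i.1 i.2.1 (z i.2.2)
  refine ⟨B, ?_⟩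
  rintro _ ⟨σ, hσ, rfl⟩
  obtain ⟨τ, hτ⟩ := bestReplies_nonempty uR μ Q z σ
  exact (sInf_senderPayoff_le uS uR hτ).trans
    (senderPayoff_le hμ hQ hσ hn (fun ω a t => hB (ω, a, t)) τ)

lemma le_optimalRobustPayoff_of_deviation (hμ : ∀ z, μ z ∈ stdSimplex ℝ Ω)
    (hQ : ∀ x, Q x ∈ stdSimplex ℝ Y) (hσ : σ ∈ senderStrategies Ω X n k) (hn : 0 < n)
    {uS uR : Ω → A → Z → ℝ} {β : (Fin k → Y) → Fin n → Ω → ℝ} {K : ℝ}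
    (hβ : ∀ y t, LowerBoundAt uS uR (z t) (β y t) K) :
    1 / n * (∑ y, (∑ ω, jointLaw μ Q z σ y ω) * (∑ t, robustPayoff uS uR (z t) (β y t)) -
      K * ∑ y, ∑ t, deviation (marginal (jointLaw μ Q z σ y) t) (β y t)) ≤
      optimalRobustPayoff uS uR μ Q k z := by
  refine le_trans ?_ (le_csSup (bddAbove_sInf_senderPayoff hμ hQ hn uS uR) ⟨σ, hσ, rfl⟩)
  refine le_csInf ((bestReplies_nonempty uR μ Q z σ).image _) ?_
  rintro _ ⟨τ, hτ, rfl⟩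
  rw [senderPayoff_eq]
  refine mul_le_mul_of_nonneg_left ?_ (by positivity)
  simp_rw [Finset.mul_sum, ← Finset.sum_sub_distrib]
  refine Finset.sum_le_sum fun y _ => Finset.sum_le_sum fun t _ => ?_
  have hlow := hβ y t (marginal (jointLaw μ Q z σ y) t)
    (marginal_nonneg (jointLaw_nonneg hμ hQ hσ y) t) (τ y t) ((mem_bestReplies_iff hn).1 hτ y t)
  rwa [sum_marginal] at hlow

lemma sum_robustPayoff_prior_le_optimalRobustPayoff [Nonempty X]
    (hμ : ∀ z, μ z ∈ stdSimplex ℝ Ω) (hQ : ∀ x, Q x ∈ stdSimplex ℝ Y) (hn : 0 < n)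
    (uS uR : Ω → A → Z → ℝ) :
    1 / n * ∑ t, robustPayoff uS uR (z t) (μ (z t)) ≤ optimalRobustPayoff uS uR μ Q k z := by
  choose K hK0 hK using fun z => exists_lowerBoundAt uS uR z (hμ z)
  set x₀ : Fin k → X := fun _ => Classical.arbitrary X
  set σ : (Fin n → Ω) → (Fin k → X) → ℝ := pureStrategy fun _ => x₀
  have hσ : σ ∈ senderStrategies Ω X n k := pureStrategy_mem _
  have hjoint : ∀ y, jointLaw μ Q z σ y = fun ω => seqChannel Q x₀ y * seqPrior μ z ω :=
    fun y => funext fun ω => by rw [jointLaw_pureStrategy, mul_comm]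
  have hdev : ∀ y t, deviation (marginal (jointLaw μ Q z σ y) t) (μ (z t)) = 0 := by
    intro y t
    refine Finset.sum_eq_zero fun a _ => abs_eq_zero.2 (sub_eq_zero.2 ?_)
    rw [sum_marginal, hjoint, ← Finset.mul_sum, (seqPrior_mem_stdSimplex hμ z).2, mul_one, marginal,
      mass_mul_left]
    exact congrArg _ (marginal_prodLaw (fun t => (hμ (z t)).2) t a)
  have hle := le_optimalRobustPayoff_of_deviation (z := z) hμ hQ hσ hn (β := fun _ t => μ (z t))
    (K := ∑ t, K (z t)) fun _ t => (hK (z t)).mono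
      (Finset.single_le_sum (fun t _ => hK0 (z t)) (Finset.mem_univ t))
  simpa [hdev, ← Finset.sum_mul, sum_sum_jointLaw hμ hQ hσ] using hle

end Game

section Splittings

variable {Ω : Type*} [Fintype Ω] {p : Ω → ℝ}

/-- A splitting indexed by an arbitrary finite type. -/
noncomputable def Splitting.ofFintype {ι : Type*} [Fintype ι] {w : ι → ℝ} {ν : ι → Ω → ℝ}
    (hw : w ∈ stdSimplex ℝ ι) (hν : ∀ i, ν i ∈ stdSimplex ℝ Ω) (hp : mixture w ν = p) :
    Splitting p where
  card := Fintype.card ι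
  weight m := w ((Fintype.equivFin ι).symm m)
  posterior m := ν ((Fintype.equivFin ι).symm m)
  weight_mem := ⟨fun _ => hw.1 _, by rw [(Fintype.equivFin ι).symm.sum_comp w]; exact hw.2⟩
  posterior_mem _ := hν _
  sum_eq := by
    rw [(Fintype.equivFin ι).symm.sum_comp fun i => w i • ν i, ← hp]
    ext ω
    simp [mixture]

lemma Splitting.sum_ofFintype {ι : Type*} [Fintype ι] {w : ι → ℝ} {ν : ι → Ω → ℝ}
    (hw : w ∈ stdSimplex ℝ ι) (hν : ∀ i, ν i ∈ stdSimplex ℝ Ω) (hp : mixture w ν = p)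
    (f : (Ω → ℝ) → ℝ) :
    ∑ m, (Splitting.ofFintype hw hν hp).weight m * f ((Splitting.ofFintype hw hν hp).posterior m) =
      ∑ i, w i * f (ν i) :=
  (Fintype.equivFin ι).symm.sum_comp fun i => w i * f (ν i)

lemma Splitting.mixture_eq (s : Splitting p) : mixture s.weight s.posterior = p := by
  conv_rhs => rw [← s.sum_eq]
  ext ω
  simp [mixture]

lemma Splitting.info_mul_log_two (s : Splitting p) :
    s.info * Real.log 2 = ∑ m, s.weight m * relEntropy (s.posterior m) p := by
  have hinfo := entropy_mixture_sub_mul_log_two s.weight_mem.1 fun m => (s.posterior_mem m).1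
  rwa [s.mixture_eq] at hinfo

lemma Splitting.posterior_eq_zero (s : Splitting p) {m : Fin s.card} (hm : s.weight m ≠ 0) {ω : Ω}
    (hω : p ω = 0) : s.posterior m ω = 0 := by
  have hle := mul_le_mixture s.weight_mem.1 (fun m => (s.posterior_mem m).1) m ω
  rw [s.mixture_eq, hω] at hle
  exact (mul_eq_zero.1 (hle.antisymm (mul_nonneg (s.weight_mem.1 m)
    ((s.posterior_mem m).1 ω)))).resolve_left hm

lemma Splitting.info_nonneg (hp : p ∈ stdSimplex ℝ Ω) (s : Splitting p) : 0 ≤ s.info := by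
  refine nonneg_of_mul_nonneg_left (b := Real.log 2) ?_ (Real.log_pos one_lt_two)
  rw [s.info_mul_log_two]
  refine Finset.sum_nonneg fun m _ => ?_
  by_cases hm : s.weight m = 0
  · simp [hm]
  have hgibbs := sum_sub_sum_le_relEntropy (s.posterior_mem m).1 hp.1
    fun ω hω => s.posterior_eq_zero hm hω
  rw [(s.posterior_mem m).2, hp.2, sub_self] at hgibbs
  exact mul_nonneg (s.weight_mem.1 m) hgibbs

/-- The splitting that reveals nothing. -/
noncomputable def Splitting.trivial (hp : p ∈ stdSimplex ℝ Ω) : Splitting p :=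
  Splitting.ofFintype (ι := Unit) (w := fun _ => 1) (ν := fun _ => p)
    ⟨fun _ => zero_le_one, by simp⟩ (fun _ => hp) (by ext; simp [mixture])

lemma Splitting.sum_trivial (hp : p ∈ stdSimplex ℝ Ω) (f : (Ω → ℝ) → ℝ) :
    ∑ m, (Splitting.trivial hp).weight m * f ((Splitting.trivial hp).posterior m) = f p :=
  (Splitting.sum_ofFintype _ _ _ f).trans (by simp)

lemma Splitting.info_trivial (hp : p ∈ stdSimplex ℝ Ω) : (Splitting.trivial hp).info = 0 := by
  rw [Splitting.info, Splitting.sum_trivial hp entropy, sub_self]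

/-- The belief proportional to the nonnegative weights `w`, with default value `ν` when the
weights vanish. -/
noncomputable def normalize (ν w : Ω → ℝ) : Ω → ℝ :=
  if ∑ ω, w ω = 0 then ν else fun ω => w ω / ∑ ω', w ω'

lemma sum_mul_normalize (ν : Ω → ℝ) {w : Ω → ℝ} (hw : ∀ ω, 0 ≤ w ω) (ω : Ω) :
    (∑ ω', w ω') * normalize ν w ω = w ω := by
  by_cases h : ∑ ω', w ω' = 0
  · rw [h, zero_mul, (Finset.sum_eq_zero_iff_of_nonneg fun ω _ => hw ω).1 h ω (Finset.mem_univ ω)]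
  · rw [normalize, if_neg h, mul_div_cancel₀ _ h]

lemma normalize_mem_stdSimplex {ν w : Ω → ℝ} (hν : ν ∈ stdSimplex ℝ Ω) (hw : ∀ ω, 0 ≤ w ω) :
    normalize ν w ∈ stdSimplex ℝ Ω := by
  rw [normalize]
  split_ifs with h
  · exact hν
  · refine ⟨fun ω => div_nonneg (hw ω) (Finset.sum_nonneg fun ω _ => hw ω), ?_⟩
    rw [← Finset.sum_div, div_self h]

lemma exists_splitting_of_sum_eq {ι : Type*} [Fintype ι] {W : ι → Ω → ℝ} {N : ℝ}
    (hp : p ∈ stdSimplex ℝ Ω) (hW : ∀ i ω, 0 ≤ W i ω) (hsum : ∀ ω, ∑ i, W i ω = N * p ω) :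
    ∃ s : Splitting p, ∀ f : (Ω → ℝ) → ℝ,
      N * ∑ m, s.weight m * f (s.posterior m) = ∑ i, (∑ ω, W i ω) * f (normalize p (W i)) := by
  have hmass0 : ∀ i, 0 ≤ ∑ ω, W i ω := fun i => Finset.sum_nonneg fun ω _ => hW i ω
  have hmass : ∑ i, ∑ ω, W i ω = N := by
    rw [Finset.sum_comm, Finset.sum_congr rfl fun ω _ => hsum ω, ← Finset.mul_sum, hp.2, mul_one]
  rcases eq_or_ne N 0 with rfl | hN
  · rw [Finset.sum_eq_zero_iff_of_nonneg fun i _ => hmass0 i] at hmass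
    refine ⟨Splitting.trivial hp, fun f => ?_⟩
    rw [zero_mul, Finset.sum_eq_zero fun i hi => by rw [hmass i hi, zero_mul]]
  have hN0 : 0 ≤ N := hmass ▸ Finset.sum_nonneg fun i _ => hmass0 i
  have hw : (fun i => (∑ ω, W i ω) / N) ∈ stdSimplex ℝ ι :=
    ⟨fun i => div_nonneg (hmass0 i) hN0, by rw [← Finset.sum_div, hmass, div_self hN]⟩
  have hmix : mixture (fun i => (∑ ω, W i ω) / N) (fun i => normalize p (W i)) = p := by
    ext ω
    simp only [mixture, div_mul_eq_mul_div, sum_mul_normalize p (hW _)]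
    rw [← Finset.sum_div, hsum, mul_div_cancel_left₀ _ hN]
  refine ⟨Splitting.ofFintype hw (fun i => normalize_mem_stdSimplex hp (hW i)) hmix, fun f => ?_⟩
  rw [Splitting.sum_ofFintype]
  simp only [div_mul_eq_mul_div]
  rw [← Finset.sum_div, mul_div_cancel₀ _ hN]

variable {A Z : Type*}
  {uS uR : Ω → A → Z → ℝ} {μ : Z → Ω → ℝ} {c : ℝ≥0∞} {π : Z → ℝ}

/-- Sender's robust payoff at the splitting `s` of the prior in a problem of type `z`. -/
noncomputable def Splitting.payoff (uS uR : Ω → A → Z → ℝ) (z : Z) (s : Splitting p) : ℝ :=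
  ∑ m, s.weight m * robustPayoff uS uR z (s.posterior m)

lemma Splitting.abs_payoff_le [Finite A] [Nonempty A] {z : Z} {B : ℝ} (hB : ∀ ω a, |uS ω a z| ≤ B)
    (s : Splitting p) : |s.payoff uS uR z| ≤ B :=
  abs_sum_mul_le_of_mem s.weight_mem fun m => abs_robustPayoff_le uR hB (s.posterior_mem m)

variable [Fintype Z]

lemma splittingValue_le (hμ : ∀ z, μ z ∈ stdSimplex ℝ Ω) {b : ℝ}
    (h : ∀ s : (z : Z) → Splitting (μ z), ((∑ z, π z * (s z).info : ℝ) : EReal) ≤ (c : EReal) →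
      ∑ z, π z * (s z).payoff uS uR z ≤ b) :
    splittingValue uS uR μ c π ≤ b := by
  refine csSup_le ⟨_, fun z => Splitting.trivial (hμ z), ?_, rfl⟩ ?_
  · simpa [Splitting.info_trivial] using EReal.coe_ennreal_nonneg c
  · rintro _ ⟨s, hs, rfl⟩
    exact h s hs

lemma exists_splitting_of_lt_splittingValue (hμ : ∀ z, μ z ∈ stdSimplex ℝ Ω) {a : ℝ}
    (ha : a < splittingValue uS uR μ c π) :
    ∃ s : (z : Z) → Splitting (μ z), ((∑ z, π z * (s z).info : ℝ) : EReal) ≤ (c : EReal) ∧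
      a < ∑ z, π z * (s z).payoff uS uR z := by
  by_contra! h
  exact ha.not_ge (splittingValue_le hμ h)

lemma le_splittingValue [Finite A] [Nonempty A] (s : (z : Z) → Splitting (μ z))
    (hs : ((∑ z, π z * (s z).info : ℝ) : EReal) ≤ (c : EReal)) :
    ∑ z, π z * (s z).payoff uS uR z ≤ splittingValue uS uR μ c π := by
  refine le_csSup ?_ ⟨s, hs, rfl⟩
  obtain ⟨B, -, hB⟩ := exists_abs_le fun i : Ω × A × Z => uS i.1 i.2.1 i.2.2
  refine ⟨B * ∑ z, |π z|, ?_⟩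
  rintro _ ⟨s, -, rfl⟩
  exact (le_abs_self _).trans (abs_sum_mul_le fun z => (s z).abs_payoff_le fun ω a => hB (ω, a, z))

end Splittings

section DataProcessing

variable {U V : Type*} [Fintype U] [Fintype V] {p : U → ℝ} {K : U → V → ℝ} {q : V → ℝ}

lemma relEntropy_mixture_add_sum (hp : ∀ u, 0 ≤ p u) (hK : ∀ u v, 0 ≤ K u v)
    (hKq : ∀ u v, p u ≠ 0 → q v = 0 → K u v = 0) :
    relEntropy (mixture p K) q + ∑ u, p u * relEntropy (K u) (mixture p K) =
      ∑ u, p u * relEntropy (K u) q := by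
  rw [relEntropy, sum_mixture_mul, ← Finset.sum_add_distrib]
  refine Finset.sum_congr rfl fun u _ => ?_
  rw [← mul_add, relEntropy, ← Finset.sum_add_distrib]
  by_cases hu : p u = 0
  · rw [hu, zero_mul, zero_mul]
  congr 1
  refine Finset.sum_congr rfl fun v _ => ?_
  by_cases hv : K u v = 0
  · simp [hv]
  have hqv : q v ≠ 0 := fun h => hv (hKq u v hu h)
  have hmix : mixture p K v ≠ 0 :=
    ((mul_pos (lt_of_le_of_ne' (hp u) hu) (lt_of_le_of_ne' (hK u v) hv)).trans_le
      (mul_le_mixture hp hK u v)).ne'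
  rw [Real.log_div hmix hqv, Real.log_div hv hmix, Real.log_div hv hqv]
  ring

lemma relEntropy_mixture_le (hp : p ∈ stdSimplex ℝ U) (hK : ∀ u, K u ∈ stdSimplex ℝ V)
    (hKq : ∀ u v, p u ≠ 0 → q v = 0 → K u v = 0) :
    relEntropy (mixture p K) q ≤ ∑ u, p u * relEntropy (K u) q := by
  have hmix := mixture_mem_stdSimplex hp hK
  rw [← relEntropy_mixture_add_sum hp.1 (fun u => (hK u).1) hKq]
  refine le_add_of_nonneg_right (Finset.sum_nonneg fun u _ => ?_)
  by_cases hu : p u = 0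
  · rw [hu, zero_mul]
  have hgibbs := sum_sub_sum_le_relEntropy (hK u).1 hmix.1 fun v hv => by
    have hle := mul_le_mixture hp.1 (fun u => (hK u).1) u v
    rw [hv] at hle
    exact (mul_eq_zero.1 (hle.antisymm (mul_nonneg (hp.1 u) ((hK u).1 v)))).resolve_left hu
  rw [(hK u).2, hmix.2, sub_self] at hgibbs
  exact mul_nonneg (hp.1 u) hgibbs

lemma relEntropy_prodLaw {ι S : Type*} [Fintype ι] [DecidableEq ι] [Fintype S] {w v : ι → S → ℝ}
    (hw : ∀ i, ∑ a, w i a = 1) (hwv : ∀ i a, v i a = 0 → w i a = 0) :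
    relEntropy (prodLaw w) (prodLaw v) = ∑ i, relEntropy (w i) (v i) := by
  rw [relEntropy]
  refine Eq.trans (Finset.sum_congr rfl fun s _ => ?_)
    (sum_prodLaw_mul_sum hw fun i a => Real.log (w i a / v i a))
  by_cases hs : prodLaw w s = 0
  · rw [hs, zero_mul, zero_mul]
  have hws : ∀ i, w i (s i) ≠ 0 := fun i => Finset.prod_ne_zero_iff.1 hs i (Finset.mem_univ i)
  have hvs : ∀ i, v i (s i) ≠ 0 := fun i hi => hws i (hwv i _ hi)
  rw [Real.log_div hs (prodLaw_ne_zero hvs), log_prodLaw hws, log_prodLaw hvs,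
    ← Finset.sum_sub_distrib]
  exact congrArg _ (Finset.sum_congr rfl fun i _ => (Real.log_div (hws i) (hvs i)).symm)

end DataProcessing

section Capacity

variable {X Y : Type*} [Fintype X] {Q : X → Y → ℝ} {k : ℕ} {p : (Fin k → X) → ℝ}

lemma channel_eq_zero_of_mixture_marginal_eq_zero (hp : ∀ x, 0 ≤ p x) (hQ : ∀ x y, 0 ≤ Q x y)
    {x : Fin k → X} {s : Fin k} {b : Y} (hx : p x ≠ 0) (hb : mixture (marginal p s) Q b = 0) :
    Q (x s) b = 0 := by
  have hpos : 0 < marginal p s (x s) := (lt_of_le_of_ne' (hp x) hx).trans_le (le_marginal hp s x)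
  have hle := mul_le_mixture (marginal_nonneg hp s) hQ (x s) b
  rw [hb] at hle
  exact (mul_eq_zero.1 (hle.antisymm (mul_nonneg hpos.le (hQ _ _)))).resolve_left hpos.ne'

lemma seqChannel_eq_zero_of_prodLaw_mixture_eq_zero (hp : ∀ x, 0 ≤ p x) (hQ : ∀ x y, 0 ≤ Q x y)
    {x : Fin k → X} {y : Fin k → Y} (hx : p x ≠ 0)
    (hy : prodLaw (fun s => mixture (marginal p s) Q) y = 0) : seqChannel Q x y = 0 := by
  obtain ⟨s, -, hs⟩ := Finset.prod_eq_zero_iff.1 hy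
  exact Finset.prod_eq_zero (Finset.mem_univ s)
    (channel_eq_zero_of_mixture_marginal_eq_zero hp hQ hx hs)

lemma continuous_entropy : Continuous (entropy (S := X)) := by
  have hlog : (entropy (S := X)) = fun q => -∑ s, q s * Real.log (q s) / Real.log 2 := by
    ext q
    simp only [entropy, Real.logb, mul_div_assoc]
  rw [hlog]
  exact (continuous_finsetSum _ fun s _ =>
    (Real.continuous_mul_log.comp (continuous_apply s)).div_const _).neg

variable [Fintype Y]

lemma mutualInfo_le_capacity (Q : X → Y → ℝ) {p : X → ℝ} (hp : p ∈ stdSimplex ℝ X) :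
    mutualInfo Q p ≤ capacity Q := by
  have hcont : Continuous (mutualInfo Q) :=
    (continuous_entropy.comp (by fun_prop)).sub (by fun_prop)
  exact le_csSup ((isCompact_stdSimplex ℝ X).image hcont).bddAbove ⟨p, hp, rfl⟩

lemma capacity_nonneg [Nonempty X] (Q : X → Y → ℝ) : 0 ≤ capacity Q := by
  classical
  have x : X := Classical.arbitrary X
  refine le_trans (le_of_eq ?_) (mutualInfo_le_capacity Q (single_mem_stdSimplex ℝ x))
  simp [mutualInfo, Pi.single_apply]

lemma sum_mul_relEntropy_seqChannel_le (hQ : ∀ x, Q x ∈ stdSimplex ℝ Y)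
    (hp : p ∈ stdSimplex ℝ (Fin k → X)) :
    ∑ x, p x * relEntropy (seqChannel Q x) (prodLaw fun s => mixture (marginal p s) Q) ≤
      k * (capacity Q * Real.log 2) := by
  have hmarginal : ∀ s, marginal p s ∈ stdSimplex ℝ X := fun s =>
    ⟨marginal_nonneg hp.1 s, (sum_marginal p s).trans hp.2⟩
  have htensor : ∀ x,
      p x * relEntropy (seqChannel Q x) (prodLaw fun s => mixture (marginal p s) Q) =
        p x * ∑ s, relEntropy (Q (x s)) (mixture (marginal p s) Q) := by
    intro x
    by_cases hx : p x = 0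
    · rw [hx, zero_mul, zero_mul]
    exact congrArg _ (relEntropy_prodLaw (fun s => (hQ (x s)).2) fun s b hb =>
      channel_eq_zero_of_mixture_marginal_eq_zero hp.1 (fun x => (hQ x).1) hx hb)
  calc ∑ x, p x * relEntropy (seqChannel Q x) (prodLaw fun s => mixture (marginal p s) Q)
      = ∑ s, ∑ x, p x * relEntropy (Q (x s)) (mixture (marginal p s) Q) := by
        rw [Finset.sum_comm]
        simp_rw [htensor, Finset.mul_sum]
    _ = ∑ s, mutualInfo Q (marginal p s) * Real.log 2 := by
        refine Finset.sum_congr rfl fun s _ => ?_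
        rw [← sum_marginal_mul p s fun a => relEntropy (Q a) (mixture (marginal p s) Q)]
        exact (entropy_mixture_sub_mul_log_two (hmarginal s).1 fun x => (hQ x).1).symm
    _ ≤ ∑ _s : Fin k, capacity Q * Real.log 2 := Finset.sum_le_sum fun s _ =>
        mul_le_mul_of_nonneg_right (mutualInfo_le_capacity Q (hmarginal s))
          (Real.log_pos one_lt_two).le
    _ = k * (capacity Q * Real.log 2) := by simp

end Capacity

section Converse

variable {Ω A Z X Y : Type*} [Fintype Ω] [Fintype X] [Fintype Y] {n k : ℕ} {μ : Z → Ω → ℝ}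
  {Q : X → Y → ℝ} {z : Fin n → Z} {σ : (Fin n → Ω) → (Fin k → X) → ℝ}

lemma sum_relEntropy_jointLaw_mul_seqPrior {q : (Fin k → Y) → ℝ} :
    ∑ y, relEntropy (jointLaw μ Q z σ y) (fun ω => q y * seqPrior μ z ω) =
      ∑ ω, seqPrior μ z ω * relEntropy (mixture (σ ω) (seqChannel Q)) q := by
  simp only [relEntropy, Finset.mul_sum]
  rw [Finset.sum_comm]
  refine Finset.sum_congr rfl fun ω _ => Finset.sum_congr rfl fun y _ => ?_
  by_cases hω : seqPrior μ z ω = 0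
  · simp [jointLaw, hω]
  · rw [jointLaw, mul_comm (q y), mul_div_mul_left _ _ hω, mul_assoc]

lemma sum_relEntropy_jointLaw_le (hμ : ∀ z, μ z ∈ stdSimplex ℝ Ω) (hQ : ∀ x, Q x ∈ stdSimplex ℝ Y)
    (hσ : σ ∈ senderStrategies Ω X n k) :
    ∑ y, relEntropy (jointLaw μ Q z σ y)
        (fun ω => (∑ ω', jointLaw μ Q z σ y ω') * seqPrior μ z ω) ≤
      k * (capacity Q * Real.log 2) := by
  have hprior := seqPrior_mem_stdSimplex hμ z
  have hchannel : ∀ x : Fin k → X, seqChannel Q x ∈ stdSimplex ℝ (Fin k → Y) := fun x =>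
    seqChannel_mem_stdSimplex hQ x
  have hinput : mixture (seqPrior μ z) σ ∈ stdSimplex ℝ (Fin k → X) :=
    mixture_mem_stdSimplex hprior hσ
  set q : (Fin k → Y) → ℝ :=
    prodLaw fun s => mixture (marginal (mixture (seqPrior μ z) σ) s) Q
  have hq : q ∈ stdSimplex ℝ (Fin k → Y) := prodLaw_mem_stdSimplex fun s =>
    mixture_mem_stdSimplex
      ⟨marginal_nonneg hinput.1 s, (sum_marginal _ s).trans hinput.2⟩ hQ
  have hsupport : ∀ ω, seqPrior μ z ω ≠ 0 → ∀ x y, σ ω x ≠ 0 → q y = 0 → seqChannel Q x y = 0 := by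
    intro ω hω x y hx hy
    refine seqChannel_eq_zero_of_prodLaw_mixture_eq_zero hinput.1 (fun x => (hQ x).1) ?_ hy
    exact ((mul_pos (lt_of_le_of_ne' (hprior.1 ω) hω) (lt_of_le_of_ne' ((hσ ω).1 x) hx)).trans_le
      (mul_le_mixture hprior.1 (fun ω => (hσ ω).1) ω x)).ne'
  have hne : ∀ y ω, jointLaw μ Q z σ y ω ≠ 0 → q y ≠ 0 := by
    intro y ω hW hy
    obtain ⟨x, -, hx⟩ := Finset.exists_ne_zero_of_sum_ne_zero (right_ne_zero_of_mul hW)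
    exact right_ne_zero_of_mul hx
      (hsupport ω (left_ne_zero_of_mul hW) x y (left_ne_zero_of_mul hx) hy)
  calc ∑ y, relEntropy (jointLaw μ Q z σ y)
        (fun ω => (∑ ω', jointLaw μ Q z σ y ω') * seqPrior μ z ω)
      ≤ ∑ y, relEntropy (jointLaw μ Q z σ y) (fun ω => q y * seqPrior μ z ω) :=
        sum_relEntropy_sum_mul_le (jointLaw_nonneg hμ hQ hσ) hq.1
          (by rw [hq.2, sum_sum_jointLaw hμ hQ hσ]) hne fun _ _ => left_ne_zero_of_mul
    _ = ∑ ω, seqPrior μ z ω * relEntropy (mixture (σ ω) (seqChannel Q)) q :=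
        sum_relEntropy_jointLaw_mul_seqPrior
    _ ≤ ∑ ω, seqPrior μ z ω * ∑ x, σ ω x * relEntropy (seqChannel Q x) q := by
        refine Finset.sum_le_sum fun ω _ => ?_
        by_cases hω : seqPrior μ z ω = 0
        · rw [hω, zero_mul, zero_mul]
        · exact mul_le_mul_of_nonneg_left
            (relEntropy_mixture_le (hσ ω) hchannel (hsupport ω hω)) (hprior.1 ω)
    _ = ∑ x, mixture (seqPrior μ z) σ x * relEntropy (seqChannel Q x) q :=
        (sum_mixture_mul _ _ _).symm
    _ ≤ k * (capacity Q * Real.log 2) := sum_mul_relEntropy_seqChannel_le hQ hinput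

lemma sum_relEntropy_marginal_jointLaw_le (hμ : ∀ z, μ z ∈ stdSimplex ℝ Ω)
    (hQ : ∀ x, Q x ∈ stdSimplex ℝ Y) (hσ : σ ∈ senderStrategies Ω X n k) :
    ∑ y, ∑ t, relEntropy (marginal (jointLaw μ Q z σ y) t)
        (fun a => (∑ ω, jointLaw μ Q z σ y ω) * μ (z t) a) ≤ k * (capacity Q * Real.log 2) :=
  (Finset.sum_le_sum fun y _ => sum_relEntropy_marginal_le (jointLaw_nonneg hμ hQ hσ y)
    fun _ t hW => Finset.prod_ne_zero_iff.1 (left_ne_zero_of_mul hW) t (Finset.mem_univ t)).trans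
    (sum_relEntropy_jointLaw_le hμ hQ hσ)

lemma sum_empFreq_mul [Fintype Z] (z : Fin n → Z) (f : Z → ℝ) :
    ∑ z₀, empFreq z z₀ * f z₀ = 1 / n * ∑ t, f (z t) := by
  classical
  rw [← Fintype.sum_fiberwise z, Finset.mul_sum]
  refine Finset.sum_congr rfl fun z₀ _ => ?_
  rw [Finset.sum_congr rfl fun t _ => congrArg f t.2, Finset.sum_const, Finset.card_univ,
    empFreq, Nat.card_eq_fintype_card, nsmul_eq_mul]
  ring

/-- Belief of the receiver on the state of problem `t` after the outputs `y`; it is the prior when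
`y` has probability zero. -/
noncomputable def belief (μ : Z → Ω → ℝ) (Q : X → Y → ℝ) (z : Fin n → Z)
    (σ : (Fin n → Ω) → (Fin k → X) → ℝ) (y : Fin k → Y) (t : Fin n) : Ω → ℝ :=
  normalize (μ (z t)) (marginal (jointLaw μ Q z σ y) t)

lemma sum_jointLaw_mul_belief (hμ : ∀ z, μ z ∈ stdSimplex ℝ Ω) (hQ : ∀ x, Q x ∈ stdSimplex ℝ Y)
    (hσ : σ ∈ senderStrategies Ω X n k) (y : Fin k → Y) (t : Fin n) (a : Ω) :
    (∑ ω, jointLaw μ Q z σ y ω) * belief μ Q z σ y t a = marginal (jointLaw μ Q z σ y) t a := by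
  rw [← sum_marginal _ t]
  exact sum_mul_normalize _ (marginal_nonneg (jointLaw_nonneg hμ hQ hσ y) t) a

lemma exists_splitting_belief [Fintype Z] (hμ : ∀ z, μ z ∈ stdSimplex ℝ Ω)
    (hQ : ∀ x, Q x ∈ stdSimplex ℝ Y) (hσ : σ ∈ senderStrategies Ω X n k) :
    ∃ s : (z₀ : Z) → Splitting (μ z₀), ∀ f : Z → (Ω → ℝ) → ℝ,
      ∑ z₀, empFreq z z₀ * ∑ m, (s z₀).weight m * f z₀ ((s z₀).posterior m) =
        1 / n * ∑ t, ∑ y, (∑ ω, jointLaw μ Q z σ y ω) * f (z t) (belief μ Q z σ y t) := by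
  classical
  choose s hs using fun z₀ => exists_splitting_of_sum_eq (hμ z₀)
    (W := fun i : {t // z t = z₀} × (Fin k → Y) => marginal (jointLaw μ Q z σ i.2) i.1)
    (N := Nat.card {t // z t = z₀})
    (fun i => marginal_nonneg (jointLaw_nonneg hμ hQ hσ i.2) i.1)
    (fun a => by
      rw [Fintype.sum_prod_type, Finset.sum_congr rfl fun t _ =>
        (sum_marginal_jointLaw hμ hQ hσ t.1 a).trans (by rw [t.2]), Finset.sum_const,
        Finset.card_univ, Nat.card_eq_fintype_card, nsmul_eq_mul])
  refine ⟨s, fun f => ?_⟩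
  rw [← Fintype.sum_fiberwise z, Finset.mul_sum]
  refine Finset.sum_congr rfl fun z₀ _ => ?_
  rw [empFreq, div_mul_eq_mul_div, hs z₀ (f z₀), Fintype.sum_prod_type, div_eq_inv_mul, one_div]
  refine congrArg _ (Finset.sum_congr rfl fun t _ => Finset.sum_congr rfl fun y _ => ?_)
  rw [sum_marginal, belief, t.2]

lemma entropy_sub_sum_entropy_belief_mul_log_two (hμ : ∀ z, μ z ∈ stdSimplex ℝ Ω)
    (hQ : ∀ x, Q x ∈ stdSimplex ℝ Y) (hσ : σ ∈ senderStrategies Ω X n k) (t : Fin n) :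
    (entropy (μ (z t)) - ∑ y, (∑ ω, jointLaw μ Q z σ y ω) * entropy (belief μ Q z σ y t)) *
        Real.log 2 =
      ∑ y, relEntropy (marginal (jointLaw μ Q z σ y) t)
        (fun a => (∑ ω, jointLaw μ Q z σ y ω) * μ (z t) a) := by
  have hmix : mixture (fun y => ∑ ω, jointLaw μ Q z σ y ω) (fun y => belief μ Q z σ y t) =
      μ (z t) := funext fun a =>
    (Finset.sum_congr rfl fun y _ => sum_jointLaw_mul_belief hμ hQ hσ y t a).trans
      (sum_marginal_jointLaw hμ hQ hσ t a)
  have hinfo := entropy_mixture_sub_mul_log_two (p := fun y => ∑ ω, jointLaw μ Q z σ y ω)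
    (K := fun y => belief μ Q z σ y t)
    (fun y => Finset.sum_nonneg fun ω _ => jointLaw_nonneg hμ hQ hσ y ω)
    (fun y => (normalize_mem_stdSimplex (hμ _)
      (marginal_nonneg (jointLaw_nonneg hμ hQ hσ y) t)).1)
  rw [hmix] at hinfo
  rw [hinfo]
  refine Finset.sum_congr rfl fun y _ => ?_
  simp only [relEntropy, Finset.mul_sum, ← sum_jointLaw_mul_belief hμ hQ hσ]
  refine Finset.sum_congr rfl fun a _ => ?_
  by_cases hy : ∑ ω, jointLaw μ Q z σ y ω = 0
  · simp only [hy, zero_mul]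
  · rw [mul_div_mul_left _ _ hy, mul_assoc]

lemma sum_entropy_sub_sum_entropy_belief_le (hμ : ∀ z, μ z ∈ stdSimplex ℝ Ω)
    (hQ : ∀ x, Q x ∈ stdSimplex ℝ Y) (hσ : σ ∈ senderStrategies Ω X n k) :
    ∑ t, (entropy (μ (z t)) -
        ∑ y, (∑ ω, jointLaw μ Q z σ y ω) * entropy (belief μ Q z σ y t)) ≤ k * capacity Q := by
  refine le_of_mul_le_mul_right ?_ (Real.log_pos one_lt_two)
  rw [Finset.sum_mul, mul_assoc]
  simp_rw [entropy_sub_sum_entropy_belief_mul_log_two hμ hQ hσ]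
  rw [Finset.sum_comm]
  exact sum_relEntropy_marginal_jointLaw_le hμ hQ hσ

lemma exists_mem_bestReplies_senderPayoff_eq [Finite A] [Nonempty A]
    (hμ : ∀ z, μ z ∈ stdSimplex ℝ Ω) (hQ : ∀ x, Q x ∈ stdSimplex ℝ Y) (hn : 0 < n)
    (hσ : σ ∈ senderStrategies Ω X n k) (uS uR : Ω → A → Z → ℝ) :
    ∃ τ ∈ bestReplies uR μ Q z σ, senderPayoff uS μ Q z σ τ =
      1 / n * ∑ t, ∑ y, (∑ ω, jointLaw μ Q z σ y ω) *
        robustPayoff uS uR (z t) (belief μ Q z σ y t) := by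
  choose τ hopt hpayoff using fun (y : Fin k → Y) (t : Fin n) =>
    exists_robustPayoff_eq uS uR (z t) (belief μ Q z σ y t)
  refine ⟨τ, (mem_bestReplies_iff hn).2 fun y t b => ?_, ?_⟩
  · simp_rw [← sum_jointLaw_mul_belief hμ hQ hσ, mul_assoc, ← Finset.mul_sum]
    exact mul_le_mul_of_nonneg_left (hopt y t b)
      (Finset.sum_nonneg fun ω _ => jointLaw_nonneg hμ hQ hσ y ω)
  · rw [senderPayoff_eq, Finset.sum_comm]
    simp_rw [hpayoff, Finset.mul_sum (s := (Finset.univ : Finset Ω)), ← mul_assoc,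
      sum_jointLaw_mul_belief hμ hQ hσ]

lemma coe_le_ofReal_iff {x r : ℝ} (hr : 0 ≤ r) :
    (x : EReal) ≤ (ENNReal.ofReal r : EReal) ↔ x ≤ r := by
  rw [EReal.coe_ennreal_ofReal, max_eq_left hr, EReal.coe_le_coe_iff]

lemma natCast_div_mul_ofReal (hn : 0 < n) (k : ℕ) (c : ℝ) :
    (k : ℝ≥0∞) / n * ENNReal.ofReal c = ENNReal.ofReal (k / n * c) := by
  rw [ENNReal.ofReal_mul (by positivity), ENNReal.ofReal_div_of_pos (by positivity),
    ENNReal.ofReal_natCast, ENNReal.ofReal_natCast]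

variable [Fintype Z] [Finite A] [Nonempty A] [Nonempty X]

lemma sInf_senderPayoff_le_splittingValue (hμ : ∀ z, μ z ∈ stdSimplex ℝ Ω)
    (hQ : ∀ x, Q x ∈ stdSimplex ℝ Y) (hn : 0 < n) (hσ : σ ∈ senderStrategies Ω X n k)
    (uS uR : Ω → A → Z → ℝ) :
    sInf (senderPayoff uS μ Q z σ '' bestReplies uR μ Q z σ) ≤
      splittingValue uS uR μ ((k : ℝ≥0∞) / n * ENNReal.ofReal (capacity Q)) (empFreq z) := by
  obtain ⟨τ, hτ, hpayoff⟩ := exists_mem_bestReplies_senderPayoff_eq hμ hQ hn hσ uS uR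
  obtain ⟨s, hs⟩ := exists_splitting_belief (z := z) hμ hQ hσ
  have hinfo : ∑ z₀, empFreq z z₀ * (s z₀).info ≤ k / n * capacity Q := by
    simp_rw [Splitting.info, mul_sub]
    rw [Finset.sum_sub_distrib, hs fun _ => entropy, sum_empFreq_mul z fun z => entropy (μ z),
      ← mul_sub, ← Finset.sum_sub_distrib, one_div, div_eq_inv_mul, mul_assoc]
    exact mul_le_mul_of_nonneg_left (sum_entropy_sub_sum_entropy_belief_le hμ hQ hσ)
      (by positivity)
  refine (sInf_senderPayoff_le uS uR hτ).trans ?_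
  rw [hpayoff, ← hs (robustPayoff uS uR)]
  refine le_splittingValue s ?_
  rw [natCast_div_mul_ofReal hn,
    coe_le_ofReal_iff (mul_nonneg (by positivity) (capacity_nonneg Q))]
  exact hinfo

lemma optimalRobustPayoff_le_splittingValue (hμ : ∀ z, μ z ∈ stdSimplex ℝ Ω)
    (hQ : ∀ x, Q x ∈ stdSimplex ℝ Y) (hn : 0 < n) (uS uR : Ω → A → Z → ℝ) (k : ℕ)
    (z : Fin n → Z) :
    optimalRobustPayoff uS uR μ Q k z ≤
      splittingValue uS uR μ ((k : ℝ≥0∞) / n * ENNReal.ofReal (capacity Q)) (empFreq z) := by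
  classical
  refine csSup_le (Set.Nonempty.image _ ⟨fun _ => Pi.single (fun _ => Classical.arbitrary X) 1,
    fun _ => single_mem_stdSimplex ℝ _⟩) ?_
  rintro _ ⟨σ, hσ, rfl⟩
  exact sInf_senderPayoff_le_splittingValue hμ hQ hn hσ uS uR

end Converse

section Continuity

variable {Ω A Z : Type*} [Fintype Ω] {p : Ω → ℝ}

lemma Splitting.sum_weight_mul_sum_abs_sub_le (hp : p ∈ stdSimplex ℝ Ω) (s : Splitting p) {θ : ℝ}
    (hθ : 0 < θ) :
    ∑ m, s.weight m * ∑ ω, |s.posterior m ω - p ω| ≤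
      1 / (2 * θ) * (s.info * Real.log 2) + 2 * θ := by
  calc ∑ m, s.weight m * ∑ ω, |s.posterior m ω - p ω|
      ≤ ∑ m, s.weight m * (1 / (2 * θ) * relEntropy (s.posterior m) p + 2 * θ) := by
        refine Finset.sum_le_sum fun m _ => ?_
        by_cases hm : s.weight m = 0
        · rw [hm, zero_mul, zero_mul]
        have hpinsker := sum_abs_sub_le_relEntropy (s.posterior_mem m).1 hp.1
          (fun ω hω => s.posterior_eq_zero hm hω) (hp.2.trans (s.posterior_mem m).2.symm) hθ
        rw [(s.posterior_mem m).2, mul_one] at hpinsker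
        exact mul_le_mul_of_nonneg_left hpinsker (s.weight_mem.1 m)
    _ = 1 / (2 * θ) * (s.info * Real.log 2) + 2 * θ := by
        simp_rw [mul_add, mul_left_comm _ (1 / (2 * θ))]
        rw [Finset.sum_add_distrib, ← Finset.mul_sum, ← Finset.sum_mul, s.weight_mem.2, one_mul,
          s.info_mul_log_two]

lemma Splitting.posterior_eq_of_info_eq_zero (hp : p ∈ stdSimplex ℝ Ω) (s : Splitting p)
    (hs : s.info = 0) {m : Fin s.card} (hm : s.weight m ≠ 0) : s.posterior m = p := by
  have hnonneg : ∀ m, 0 ≤ s.weight m * ∑ ω, |s.posterior m ω - p ω| := fun m =>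
    mul_nonneg (s.weight_mem.1 m) (Finset.sum_nonneg fun ω _ => abs_nonneg _)
  have hle : ∑ m, s.weight m * ∑ ω, |s.posterior m ω - p ω| ≤ 0 :=
    le_of_forall_pos_le_add fun ε hε => by
      have hbound := s.sum_weight_mul_sum_abs_sub_le hp (half_pos hε)
      rw [hs] at hbound
      linarith
  have hzero := (Finset.sum_eq_zero_iff_of_nonneg fun m _ => hnonneg m).1
    (hle.antisymm (Finset.sum_nonneg fun m _ => hnonneg m)) m (Finset.mem_univ m)
  ext ω
  have habs := (Finset.sum_eq_zero_iff_of_nonneg fun ω _ => abs_nonneg _).1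
    ((mul_eq_zero.1 hzero).resolve_left hm) ω (Finset.mem_univ ω)
  exact sub_eq_zero.1 (abs_eq_zero.1 habs)

lemma Splitting.payoff_eq_of_info_eq_zero (hp : p ∈ stdSimplex ℝ Ω) (s : Splitting p)
    (hs : s.info = 0) (uS uR : Ω → A → Z → ℝ) (z : Z) :
    s.payoff uS uR z = robustPayoff uS uR z p := by
  have hterm : ∀ m, s.weight m * robustPayoff uS uR z (s.posterior m) =
      s.weight m * robustPayoff uS uR z p := by
    intro m
    by_cases hm : s.weight m = 0
    · rw [hm, zero_mul, zero_mul]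
    · rw [s.posterior_eq_of_info_eq_zero hp hs hm]
  rw [Splitting.payoff, Finset.sum_congr rfl fun m _ => hterm m, ← Finset.sum_mul, s.weight_mem.2,
    one_mul]

lemma Splitting.exists_sum_eq_lineMap (hp : p ∈ stdSimplex ℝ Ω) (s : Splitting p) {θ : ℝ}
    (hθ0 : 0 ≤ θ) (hθ1 : θ ≤ 1) :
    ∃ s' : Splitting p, ∀ f : (Ω → ℝ) → ℝ, ∑ m, s'.weight m * f (s'.posterior m) =
      θ * f p + (1 - θ) * ∑ m, s.weight m * f (s.posterior m) := by
  let w : Option (Fin s.card) → ℝ := fun i => i.elim θ fun m => (1 - θ) * s.weight m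
  let ν : Option (Fin s.card) → Ω → ℝ := fun i => i.elim p s.posterior
  have hsum : ∀ g : (Ω → ℝ) → ℝ,
      ∑ i, w i * g (ν i) = θ * g p + (1 - θ) * ∑ m, s.weight m * g (s.posterior m) := by
    intro g
    rw [Fintype.sum_option]
    simp only [w, ν, Option.elim_none, Option.elim_some, mul_assoc, Finset.mul_sum]
  have hw : w ∈ stdSimplex ℝ (Option (Fin s.card)) := by
    refine ⟨?_, ?_⟩
    · rintro (_ | m)
      · exact hθ0
      · exact mul_nonneg (sub_nonneg.2 hθ1) (s.weight_mem.1 m)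
    · have hone := hsum fun _ => 1
      simp only [mul_one, s.weight_mem.2] at hone
      rw [hone, add_sub_cancel]
  have hν : ∀ i, ν i ∈ stdSimplex ℝ Ω := by
    rintro (_ | m)
    · exact hp
    · exact s.posterior_mem m
  have hmix : mixture w ν = p := by
    ext ω
    refine (hsum fun q => q ω).trans ?_
    have hs : ∑ m, s.weight m * s.posterior m ω = p ω := congrFun s.mixture_eq ω
    rw [hs]
    ring
  exact ⟨Splitting.ofFintype hw hν hmix, fun f =>
    (Splitting.sum_ofFintype hw hν hmix f).trans (hsum f)⟩

variable [Finite A] [Nonempty A] {uS uR : Ω → A → Z → ℝ} {μ : Z → Ω → ℝ} {B : ℝ}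

lemma exists_robustPayoff_le_add_mul_sum_abs {z : Z} (hp : p ∈ stdSimplex ℝ Ω)
    {ε : ℝ} (hε : 0 < ε) (hcont : ContinuousWithinAt (robustPayoff uS uR z)
      {ν | ν ∈ stdSimplex ℝ Ω ∧ ∀ ω, p ω = 0 → ν ω = 0} p) :
    ∃ K, 0 ≤ K ∧ ∀ ν ∈ stdSimplex ℝ Ω, (∀ ω, p ω = 0 → ν ω = 0) →
      robustPayoff uS uR z ν ≤ robustPayoff uS uR z p + ε + K * ∑ ω, |ν ω - p ω| := by
  obtain ⟨ρ, hρ, hclose⟩ := Metric.continuousWithinAt_iff.1 hcont ε hε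
  obtain ⟨B, hB0, hB⟩ := exists_abs_le fun i : Ω × A => uS i.1 i.2 z
  have hbound : ∀ {q}, q ∈ stdSimplex ℝ Ω → |robustPayoff uS uR z q| ≤ B :=
    abs_robustPayoff_le uR fun ω a => hB (ω, a)
  refine ⟨2 * B / ρ, by positivity, fun ν hν hsupp => ?_⟩
  rcases lt_or_ge (dist ν p) ρ with hnear | hfar
  · have hdiff := (abs_lt.1 (Real.dist_eq _ _ ▸ hclose ⟨hν, hsupp⟩ hnear)).2
    have : 0 ≤ 2 * B / ρ * ∑ ω, |ν ω - p ω| := by positivity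
    linarith
  · have hρsum : ρ ≤ ∑ ω, |ν ω - p ω| := hfar.trans <| (dist_pi_le_iff (by positivity)).2
      fun ω => abs_le_sum_abs_univ (fun ω => ν ω - p ω) ω
    have : 2 * B ≤ 2 * B / ρ * ∑ ω, |ν ω - p ω| := by
      rw [div_mul_eq_mul_div, le_div_iff₀ hρ]
      exact mul_le_mul_of_nonneg_left hρsum (by positivity)
    linarith [(abs_le.1 (hbound hν)).2, (abs_le.1 (hbound hp)).1]

lemma exists_payoff_le_add_mul_info {z : Z} (hp : p ∈ stdSimplex ℝ Ω)
    {ε : ℝ} (hε : 0 < ε) (hcont : ContinuousWithinAt (robustPayoff uS uR z)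
      {ν | ν ∈ stdSimplex ℝ Ω ∧ ∀ ω, p ω = 0 → ν ω = 0} p) :
    ∃ K, 0 ≤ K ∧ ∀ s : Splitting p, s.payoff uS uR z ≤ robustPayoff uS uR z p + ε + K * s.info := by
  obtain ⟨L, hL0, hL⟩ := exists_robustPayoff_le_add_mul_sum_abs hp (half_pos hε) hcont
  set θ := ε / (4 * (L + 1))
  have hθ : 0 < θ := by positivity
  have : 0 < Real.log 2 := Real.log_pos one_lt_two
  refine ⟨L * (1 / (2 * θ) * Real.log 2), by positivity, fun s => ?_⟩
  have hLθ : L * (2 * θ) ≤ ε / 2 := by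
    have hθ_eq : (L + 1) * (2 * θ) = ε / 2 := by
      simp only [θ]
      field_simp
      norm_num
    linarith
  calc s.payoff uS uR z
      ≤ ∑ m, s.weight m * (robustPayoff uS uR z p + ε / 2 +
          L * ∑ ω, |s.posterior m ω - p ω|) := by
        refine Finset.sum_le_sum fun m _ => ?_
        by_cases hm : s.weight m = 0
        · rw [hm, zero_mul, zero_mul]
        · exact mul_le_mul_of_nonneg_left (hL _ (s.posterior_mem m) fun ω hω =>
            s.posterior_eq_zero hm hω) (s.weight_mem.1 m)
    _ = robustPayoff uS uR z p + ε / 2 +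
          L * ∑ m, s.weight m * ∑ ω, |s.posterior m ω - p ω| := by
        simp_rw [mul_add _ (robustPayoff uS uR z p + ε / 2), mul_left_comm _ L]
        rw [Finset.sum_add_distrib, ← Finset.sum_mul, s.weight_mem.2, one_mul, Finset.mul_sum]
    _ ≤ robustPayoff uS uR z p + ε / 2 + L * (1 / (2 * θ) * (s.info * Real.log 2) + 2 * θ) := by
        gcongr
        exact s.sum_weight_mul_sum_abs_sub_le hp hθ
    _ ≤ robustPayoff uS uR z p + ε + L * (1 / (2 * θ) * Real.log 2) * s.info := by linarith

variable [Fintype Z] {π π' : Z → ℝ}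

lemma splittingValue_zero (hμ : ∀ z, μ z ∈ stdSimplex ℝ Ω) (hπ : ∀ z, 0 ≤ π z) :
    splittingValue uS uR μ 0 π = ∑ z, π z * robustPayoff uS uR z (μ z) := by
  refine le_antisymm (splittingValue_le hμ fun s hs => ?_) ?_
  · have hinfo : ∑ z, π z * (s z).info ≤ 0 := by
      rwa [← ENNReal.ofReal_zero, coe_le_ofReal_iff le_rfl] at hs
    have hnonneg : ∀ z, 0 ≤ π z * (s z).info := fun z =>
      mul_nonneg (hπ z) ((s z).info_nonneg (hμ z))
    have hzero := (Finset.sum_eq_zero_iff_of_nonneg fun z _ => hnonneg z).1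
      (hinfo.antisymm (Finset.sum_nonneg fun z _ => hnonneg z))
    refine (Finset.sum_congr rfl fun z hz => ?_).le
    rcases mul_eq_zero.1 (hzero z hz) with hz0 | hz0
    · rw [hz0, zero_mul, zero_mul]
    · rw [(s z).payoff_eq_of_info_eq_zero (hμ z) hz0]
  · refine le_trans (le_of_eq ?_) (le_splittingValue (fun z => Splitting.trivial (hμ z)) ?_)
    · exact Finset.sum_congr rfl fun z _ => by rw [Splitting.payoff, Splitting.sum_trivial]
    · simp [Splitting.info_trivial]

lemma exists_splittingValue_le_add (hμ : ∀ z, μ z ∈ stdSimplex ℝ Ω) (hπ : π ∈ stdSimplex ℝ Z)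
    (hcont : ∀ z, 0 < π z → ContinuousWithinAt (robustPayoff uS uR z)
      {ν | ν ∈ stdSimplex ℝ Ω ∧ ∀ ω, μ z ω = 0 → ν ω = 0} (μ z)) {ε : ℝ} (hε : 0 < ε) :
    ∃ c, 0 < c ∧ splittingValue uS uR μ (ENNReal.ofReal c) π ≤
      ∑ z, π z * robustPayoff uS uR z (μ z) + ε := by
  have hlip : ∀ z, ∃ K, 0 ≤ K ∧ ∀ s : Splitting (μ z), π z * s.payoff uS uR z ≤
      π z * (robustPayoff uS uR z (μ z) + ε / 2 + K * s.info) := by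
    intro z
    rcases (hπ.1 z).eq_or_lt with hz | hz
    · exact ⟨0, le_rfl, fun s => by rw [← hz, zero_mul, zero_mul]⟩
    · obtain ⟨K, hK0, hK⟩ := exists_payoff_le_add_mul_info (hμ z) (half_pos hε) (hcont z hz)
      exact ⟨K, hK0, fun s => mul_le_mul_of_nonneg_left (hK s) hz.le⟩
  choose K hK0 hK using hlip
  set L := ∑ z, K z
  have hL0 : 0 ≤ L := Finset.sum_nonneg fun z _ => hK0 z
  refine ⟨ε / (2 * (L + 1)), by positivity, splittingValue_le hμ fun s hs => ?_⟩
  rw [coe_le_ofReal_iff (by positivity)] at hs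
  calc ∑ z, π z * (s z).payoff uS uR z
      ≤ ∑ z, (π z * robustPayoff uS uR z (μ z) + π z * (ε / 2) + L * (π z * (s z).info)) := by
        refine Finset.sum_le_sum fun z _ => (hK z (s z)).trans ?_
        have : K z * (π z * (s z).info) ≤ L * (π z * (s z).info) :=
          mul_le_mul_of_nonneg_right (Finset.single_le_sum (fun z _ => hK0 z) (Finset.mem_univ z))
            (mul_nonneg (hπ.1 z) ((s z).info_nonneg (hμ z)))
        linarith
    _ = ∑ z, π z * robustPayoff uS uR z (μ z) + ε / 2 + L * ∑ z, π z * (s z).info := by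
        rw [Finset.sum_add_distrib, Finset.sum_add_distrib, ← Finset.sum_mul, ← Finset.mul_sum,
          hπ.2, one_mul]
    _ ≤ ∑ z, π z * robustPayoff uS uR z (μ z) + ε / 2 + (L + 1) * (ε / (2 * (L + 1))) := by
        have := mul_le_mul (le_add_of_nonneg_right zero_le_one) hs
          (Finset.sum_nonneg fun z _ => mul_nonneg (hπ.1 z) ((s z).info_nonneg (hμ z)))
          (by positivity : 0 ≤ L + 1)
        linarith
    _ = ∑ z, π z * robustPayoff uS uR z (μ z) + ε := by
        field_simp
        ring

lemma splittingValue_le_add_mul_sum_abs_sub (hμ : ∀ z, μ z ∈ stdSimplex ℝ Ω)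
    (hB : ∀ ω a z, |uS ω a z| ≤ B) {c c' : ℝ≥0∞}
    (hinfo : ∀ s : (z : Z) → Splitting (μ z), ((∑ z, π' z * (s z).info : ℝ) : EReal) ≤ c →
      ((∑ z, π z * (s z).info : ℝ) : EReal) ≤ c') :
    splittingValue uS uR μ c π' ≤ splittingValue uS uR μ c' π + B * ∑ z, |π' z - π z| := by
  refine splittingValue_le hμ fun s hs => ?_
  have hdiff := (abs_le.1 (abs_sum_mul_le (w := fun z => π' z - π z) fun z =>
    (s z).abs_payoff_le (uR := uR) fun ω a => hB ω a z)).2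
  simp_rw [sub_mul] at hdiff
  rw [Finset.sum_sub_distrib] at hdiff
  linarith [le_splittingValue (uS := uS) (uR := uR) s (hinfo s hs)]

lemma splittingValue_ofReal_le_add_mul_sum_abs_sub (hμ : ∀ z, μ z ∈ stdSimplex ℝ Ω)
    (hB : ∀ ω a z, |uS ω a z| ≤ B) {δ c c' : ℝ} (hδ : 0 ≤ δ) (hc : 0 ≤ c)
    (hcc' : (1 + δ) * c ≤ c') (hπ : ∀ z, π z ≤ (1 + δ) * π' z) :
    splittingValue uS uR μ (ENNReal.ofReal c) π' ≤
      splittingValue uS uR μ (ENNReal.ofReal c') π + B * ∑ z, |π' z - π z| := by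
  refine splittingValue_le_add_mul_sum_abs_sub hμ hB fun s hs => ?_
  rw [coe_le_ofReal_iff hc] at hs
  rw [coe_le_ofReal_iff (le_trans (by positivity) hcc')]
  calc ∑ z, π z * (s z).info ≤ ∑ z, (1 + δ) * π' z * (s z).info :=
        Finset.sum_le_sum fun z _ =>
          mul_le_mul_of_nonneg_right (hπ z) ((s z).info_nonneg (hμ z))
    _ = (1 + δ) * ∑ z, π' z * (s z).info := by simp_rw [Finset.mul_sum, mul_assoc]
    _ ≤ (1 + δ) * c := by gcongr
    _ ≤ c' := hcc'

lemma splittingValue_ofReal_le_add_of_one_sub_mul_le (hμ : ∀ z, μ z ∈ stdSimplex ℝ Ω)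
    (hB : ∀ ω a z, |uS ω a z| ≤ B) (hπ : π ∈ stdSimplex ℝ Z) {θ c c' : ℝ} (hθ0 : 0 ≤ θ)
    (hθ1 : θ ≤ 1) (hc : 0 ≤ c) (hc' : 0 ≤ c') (hcc' : (1 - θ) * c' ≤ c) :
    splittingValue uS uR μ (ENNReal.ofReal c') π ≤
      splittingValue uS uR μ (ENNReal.ofReal c) π + 2 * B * θ := by
  refine splittingValue_le hμ fun s hs => ?_
  rw [coe_le_ofReal_iff hc'] at hs
  choose s' hs' using fun z => (s z).exists_sum_eq_lineMap (hμ z) hθ0 hθ1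
  have hinfo : ∑ z, π z * (s' z).info ≤ c := by
    refine le_trans (le_of_eq ?_)
      ((mul_le_mul_of_nonneg_left hs (sub_nonneg.2 hθ1)).trans hcc')
    rw [Finset.mul_sum]
    refine Finset.sum_congr rfl fun z _ => ?_
    rw [Splitting.info, hs' z entropy, Splitting.info]
    ring
  have hpayoff : ∀ z, (s z).payoff uS uR z ≤ (s' z).payoff uS uR z + 2 * B * θ := by
    intro z
    have hs'z : (s' z).payoff uS uR z =
        θ * robustPayoff uS uR z (μ z) + (1 - θ) * (s z).payoff uS uR z := hs' z _
    have hprior := (abs_le.1 (abs_robustPayoff_le uR (fun ω a => hB ω a z) (hμ z))).1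
    have hpost := (abs_le.1 ((s z).abs_payoff_le (uR := uR) fun ω a => hB ω a z)).2
    rw [hs'z]
    nlinarith
  calc ∑ z, π z * (s z).payoff uS uR z ≤ ∑ z, π z * ((s' z).payoff uS uR z + 2 * B * θ) :=
        Finset.sum_le_sum fun z _ => mul_le_mul_of_nonneg_left (hpayoff z) (hπ.1 z)
    _ = ∑ z, π z * (s' z).payoff uS uR z + 2 * B * θ := by
        simp_rw [mul_add]
        rw [Finset.sum_add_distrib, ← Finset.sum_mul, hπ.2, one_mul]
    _ ≤ splittingValue uS uR μ (ENNReal.ofReal c) π + 2 * B * θ := by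
        gcongr
        exact le_splittingValue s' ((coe_le_ofReal_iff hc).2 hinfo)

end Continuity

section SplittingFamilies

variable {Ω A Z S : Type*} [Fintype Ω] [Fintype S] {μ : Z → Ω → ℝ}

/-- Splittings of the priors of all types, with the same set `S` of messages. -/
structure SplittingFamily (μ : Z → Ω → ℝ) (S : Type*) [Fintype S] where
  weight : Z → S → ℝ
  posterior : Z → S → Ω → ℝ
  weight_mem : ∀ z, weight z ∈ stdSimplex ℝ S
  posterior_mem : ∀ z s, posterior z s ∈ stdSimplex ℝ Ω
  mixture_eq : ∀ z, mixture (weight z) (posterior z) = μ z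

namespace SplittingFamily

/-- Robust payoff of the sender from the splitting of the prior of type `z`. -/
noncomputable def value (F : SplittingFamily μ S) (uS uR : Ω → A → Z → ℝ) (z : Z) : ℝ :=
  ∑ s, F.weight z s * robustPayoff uS uR z (F.posterior z s)

lemma prior_mem_stdSimplex (F : SplittingFamily μ S) (z : Z) : μ z ∈ stdSimplex ℝ Ω :=
  F.mixture_eq z ▸ mixture_mem_stdSimplex (F.weight_mem z) (F.posterior_mem z)

variable {n : ℕ}

/-- Law of the messages of `n` problems of types `z` that are split independently. -/
def messageLaw (F : SplittingFamily μ S) (z : Fin n → Z) : (Fin n → S) → ℝ :=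
  prodLaw fun t => F.weight (z t)

/-- Law of the states of the `n` problems given their messages `m`. -/
def stateLaw (F : SplittingFamily μ S) (z : Fin n → Z) (m : Fin n → S) : (Fin n → Ω) → ℝ :=
  prodLaw fun t => F.posterior (z t) (m t)

variable (F : SplittingFamily μ S) (z : Fin n → Z)

lemma messageLaw_mem_stdSimplex : F.messageLaw z ∈ stdSimplex ℝ (Fin n → S) :=
  prodLaw_mem_stdSimplex fun _ => F.weight_mem _

lemma stateLaw_mem_stdSimplex (m : Fin n → S) : F.stateLaw z m ∈ stdSimplex ℝ (Fin n → Ω) :=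
  prodLaw_mem_stdSimplex fun _ => F.posterior_mem _ _

lemma mixture_messageLaw_stateLaw : mixture (F.messageLaw z) (F.stateLaw z) = seqPrior μ z := by
  refine (mixture_prodLaw _ fun t => F.posterior (z t)).trans ?_
  simp only [F.mixture_eq]
  rfl

lemma sum_messageLaw_mul_robustPayoff (uS uR : Ω → A → Z → ℝ) :
    ∑ m, F.messageLaw z m * ∑ t, robustPayoff uS uR (z t) (F.posterior (z t) (m t)) =
      ∑ t, F.value uS uR (z t) :=
  sum_prodLaw_mul_sum (fun _ => (F.weight_mem _).2)
    fun t s => robustPayoff uS uR (z t) (F.posterior (z t) s)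

lemma marginal_stateLaw (m : Fin n → S) (t : Fin n) :
    marginal (F.stateLaw z m) t = F.posterior (z t) (m t) :=
  funext fun a => marginal_prodLaw (fun _ => (F.posterior_mem _ _).2) t a

variable {z} [Finite A] [Nonempty A] {uS : Ω → A → Z → ℝ} {B : ℝ}

lemma abs_sum_robustPayoff_le (uR : Ω → A → Z → ℝ) (hB : ∀ ω a z, |uS ω a z| ≤ B)
    (m : Fin n → S) :
    |∑ t, robustPayoff uS uR (z t) (F.posterior (z t) (m t))| ≤ n * B := by
  simpa using abs_sum_le_card_mul fun t =>
    abs_robustPayoff_le uR (fun ω a => hB ω a (z t)) (F.posterior_mem (z t) (m t))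

lemma exists_forall_lowerBoundAt [Finite Z] (uS uR : Ω → A → Z → ℝ) :
    ∃ K, 0 ≤ K ∧ ∀ z s, LowerBoundAt uS uR z (F.posterior z s) K := by
  choose K _ hK using fun i : Z × S => exists_lowerBoundAt uS uR i.1 (F.posterior_mem i.1 i.2)
  obtain ⟨L, hL0, hL⟩ := exists_abs_le K
  exact ⟨L, hL0, fun z s => (hK (z, s)).mono ((le_abs_self _).trans (hL (z, s)))⟩

end SplittingFamily

end SplittingFamilies

section Decoding

variable {Ω U V : Type*} [Fintype U] {p : U → ℝ} {ε : ℝ}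

lemma mass_compProd_le [Fintype V] {K : U → V → ℝ} {E : Set (U × V)} (hp : p ∈ stdSimplex ℝ U)
    (hE : ∀ u, mass (K u) {v | (u, v) ∈ E} ≤ ε) : mass (compProd p K) E ≤ ε := by
  rw [mass_compProd]
  exact (Finset.sum_le_sum fun u _ => mul_le_mul_of_nonneg_left (hE u) (hp.1 u)).trans_eq
    (by rw [← Finset.sum_mul, hp.2, one_mul])

lemma sum_mul_sub_mul_mass_le_sum_mixture_mul [Fintype V] {K : U → V → ℝ} {g : U → ℝ} {G : ℝ}
    (hp : ∀ u, 0 ≤ p u) (hK : ∀ u, K u ∈ stdSimplex ℝ V) (hg : ∀ u, |g u| ≤ G) (d : V → U) :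
    ∑ u, p u * g u - 2 * G * mass (compProd p K) {a | a.1 ≠ d a.2} ≤
      ∑ v, mixture p K v * g (d v) := by
  have herror := neg_mul_mass_le_sum_mul (compProd_nonneg hp fun u => (hK u).1)
    (f := fun a => g (d a.2) - g a.1) (G := 2 * G) (E := {a | a.1 ≠ d a.2})
    (fun a ha => by simp [← not_not.1 ha])
    fun a => by linarith [(abs_le.1 (hg (d a.2))).1, (abs_le.1 (hg a.1)).2]
  simp only [mul_sub, Finset.sum_sub_distrib] at herror
  rw [sum_compProd_mul_fst hK p g, sum_compProd_mul_snd p K fun v => g (d v)] at herror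
  linarith

lemma sum_abs_sub_le_two [Fintype Ω] {ν ν' : Ω → ℝ} (hν : ν ∈ stdSimplex ℝ Ω)
    (hν' : ν' ∈ stdSimplex ℝ Ω) : ∑ ω, |ν ω - ν' ω| ≤ 2 := by
  calc ∑ ω, |ν ω - ν' ω| ≤ ∑ ω, (ν ω + ν' ω) := Finset.sum_le_sum fun ω _ => by
        simpa only [abs_of_nonneg (hν.1 ω), abs_of_nonneg (hν'.1 ω)] using abs_sub (ν ω) (ν' ω)
    _ = 2 := by rw [Finset.sum_add_distrib, hν.2, hν'.2]; norm_num

lemma deviation_mixture_le [Fintype Ω] {ν : U → Ω → ℝ} (hp : ∀ u, 0 ≤ p u)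
    (hν : ∀ u, ν u ∈ stdSimplex ℝ Ω) (u₀ : U) :
    deviation (mixture p ν) (ν u₀) ≤ 2 * mass p {u₀}ᶜ := by
  classical
  have hsum : ∑ ω, mixture p ν ω = ∑ u, p u := sum_mixture (fun u => (hν u).2) p
  calc deviation (mixture p ν) (ν u₀)
      = ∑ ω, |∑ u, p u * (ν u ω - ν u₀ ω)| := by
        simp only [deviation, hsum]
        simp only [mixture, Finset.sum_mul, ← Finset.sum_sub_distrib, mul_sub]
    _ ≤ ∑ ω, ∑ u, p u * |ν u ω - ν u₀ ω| := Finset.sum_le_sum fun ω _ =>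
        (Finset.abs_sum_le_sum_abs _ _).trans_eq
          (Finset.sum_congr rfl fun u _ => by rw [abs_mul, abs_of_nonneg (hp u)])
    _ = ∑ u, p u * ∑ ω, |ν u ω - ν u₀ ω| := by
        rw [Finset.sum_comm]
        simp only [Finset.mul_sum]
    _ ≤ 2 * mass p {u₀}ᶜ := by
        rw [mass, Finset.mul_sum]
        refine Finset.sum_le_sum fun u _ => ?_
        by_cases hu : u = u₀
        · simp [hu]
        · rw [Set.indicator_of_mem (by simpa using hu), mul_comm]
          exact mul_le_mul_of_nonneg_right (sum_abs_sub_le_two (hν u) (hν u₀)) (hp u)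

lemma sum_deviation_mixture_le [Fintype Ω] [Fintype V] {K : U → V → ℝ} {ν : U → Ω → ℝ}
    (hp : ∀ u, 0 ≤ p u) (hK : ∀ u v, 0 ≤ K u v) (hν : ∀ u, ν u ∈ stdSimplex ℝ Ω) (d : V → U) :
    ∑ v, deviation (mixture (fun u => p u * K u v) ν) (ν (d v)) ≤
      2 * mass (compProd p K) {a | a.1 ≠ d a.2} := by
  rw [mass_prod_right, Finset.mul_sum]
  exact Finset.sum_le_sum fun v _ =>
    deviation_mixture_le (fun u => mul_nonneg (hp u) (hK u v)) hν (d v)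

lemma marginal_mixture {ι : Type*} [Fintype ι] [DecidableEq ι] [Fintype Ω] (p : U → ℝ)
    (K : U → (ι → Ω) → ℝ) (t : ι) :
    marginal (mixture p K) t = mixture p fun i => marginal (K i) t := by
  funext a
  refine (sum_marginal_comm (fun i ω => p i * K i ω) t a).symm.trans ?_
  simp only [marginal, mass_mul_left, mixture]

end Decoding

section UncompressedMessages

variable {Ω A Z X Y S T : Type*} [Fintype X] [Fintype S] [Fintype T] {n k : ℕ}
  {μ : Z → Ω → ℝ} {Q : X → Y → ℝ} {z : Fin n → Z}

lemma exists_jointLaw_eq_mixture {p : T → ℝ} {K : T → (Fin n → Ω) → ℝ} (hp : p ∈ stdSimplex ℝ T)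
    (hK : ∀ i ω, 0 ≤ K i ω) (hmix : mixture p K = seqPrior μ z) (Q : X → Y → ℝ)
    (c : T → Fin k → X) :
    ∃ σ ∈ senderStrategies Ω X n k, ∀ y,
      jointLaw μ Q z σ y = mixture (fun i => p i * seqChannel Q (c i) y) K := by
  classical
  have hpK : ∀ ω i, 0 ≤ p i * K i ω := fun ω i => mul_nonneg (hp.1 i) (hK i ω)
  refine ⟨fun ω => mixture (normalize p fun i => p i * K i ω) fun i => Pi.single (c i) 1,
    fun ω => mixture_mem_stdSimplex (normalize_mem_stdSimplex hp (hpK ω))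
      fun i => single_mem_stdSimplex ℝ (c i), fun y => funext fun ω => ?_⟩
  calc jointLaw μ Q z _ y ω
      = (∑ i, p i * K i ω) * ∑ i, normalize p (fun i => p i * K i ω) i *
          ∑ x, (Pi.single (c i) 1 : (Fin k → X) → ℝ) x * seqChannel Q x y := by
        rw [jointLaw, ← hmix, ← sum_mixture_mul]
        rfl
    _ = mixture (fun i => p i * seqChannel Q (c i) y) K ω := by
        rw [Finset.mul_sum]
        refine Finset.sum_congr rfl fun i _ => ?_
        rw [← mul_assoc, sum_mul_normalize p (hpK ω), mul_right_comm]
        simp [Pi.single_apply]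

variable [Fintype Ω] [Finite A] [Nonempty A] [Fintype Y]

lemma le_optimalRobustPayoff_of_code (hQ : ∀ x, Q x ∈ stdSimplex ℝ Y) (hn : 0 < n)
    {uS uR : Ω → A → Z → ℝ} (F : SplittingFamily μ S) {B K ε : ℝ} (hB0 : 0 ≤ B)
    (hB : ∀ ω a z, |uS ω a z| ≤ B) (hK0 : 0 ≤ K)
    (hK : ∀ z s, LowerBoundAt uS uR z (F.posterior z s) K)
    (c : (Fin n → S) → Fin k → X) (d : (Fin k → Y) → Fin n → S)
    (hcd : ∀ m, mass (seqChannel Q (c m)) {y | m ≠ d y} ≤ ε) :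
    1 / n * ∑ t, F.value uS uR (z t) - 2 * (B + K) * ε ≤ optimalRobustPayoff uS uR μ Q k z := by
  set L := F.messageLaw z
  have hL : L ∈ stdSimplex ℝ (Fin n → S) := F.messageLaw_mem_stdSimplex z
  have hch : ∀ m, seqChannel Q (c m) ∈ stdSimplex ℝ (Fin k → Y) :=
    fun m => seqChannel_mem_stdSimplex hQ (c m)
  set err := mass (compProd L fun m => seqChannel Q (c m)) {a | a.1 ≠ d a.2}
  have herr : err ≤ ε := mass_compProd_le hL hcd
  obtain ⟨σ, hσ, hjoint⟩ := exists_jointLaw_eq_mixture hL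
    (fun m => (F.stateLaw_mem_stdSimplex z m).1) (F.mixture_messageLaw_stateLaw z) Q c
  have htotal : ∀ y, ∑ ω, jointLaw μ Q z σ y ω = mixture L (fun m => seqChannel Q (c m)) y :=
    fun y => by
      rw [hjoint, sum_mixture fun m => (F.stateLaw_mem_stdSimplex z m).2]
      rfl
  have hdev : ∑ y, ∑ t, deviation (marginal (jointLaw μ Q z σ y) t)
      (F.posterior (z t) (d y t)) ≤ n * (2 * err) := by
    rw [Finset.sum_comm]
    refine (Finset.sum_le_card_nsmul Finset.univ _ (2 * err) fun t _ => ?_).trans_eq (by simp)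
    simp only [hjoint, marginal_mixture, F.marginal_stateLaw]
    exact sum_deviation_mixture_le hL.1 (fun m => (hch m).1)
      (fun m => F.posterior_mem (z t) (m t)) d
  have hpay := sum_mul_sub_mul_mass_le_sum_mixture_mul hL.1 hch
    (F.abs_sum_robustPayoff_le (z := z) uR hB) d
  rw [F.sum_messageLaw_mul_robustPayoff] at hpay
  refine le_trans ?_ (le_optimalRobustPayoff_of_deviation (z := z) F.prior_mem_stdSimplex hQ hσ
    hn (β := fun y t => F.posterior (z t) (d y t)) fun y t => hK _ _)
  simp only [htotal]
  calc 1 / n * ∑ t, F.value uS uR (z t) - 2 * (B + K) * ε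
      ≤ 1 / n * ∑ t, F.value uS uR (z t) - 2 * (B + K) * err := by gcongr
    _ = 1 / n * (∑ t, F.value uS uR (z t) - 2 * (n * B) * err - K * (n * (2 * err))) := by
        have : (n : ℝ) ≠ 0 := by positivity
        field
    _ ≤ _ := by gcongr

lemma card_fun_le_exp {c : ℝ} [Nonempty S] (h : n * Real.log (Fintype.card S) ≤ c) :
    (Fintype.card (Fin n → S) : ℝ) ≤ Real.exp c := by
  have : (0 : ℝ) < Fintype.card S := by exact_mod_cast Fintype.card_pos
  rwa [Fintype.card_fun, Fintype.card_fin, Nat.cast_pow, ← Real.log_le_iff_le_exp (by positivity),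
    Real.log_pow]

lemma exists_pos_mul_le {C ε : ℝ} (hC : 0 ≤ C) (hε : 0 < ε) : ∃ η, 0 < η ∧ C * η ≤ ε :=
  ⟨ε / (C + 1), by positivity, by rw [mul_div_assoc', div_le_iff₀ (by positivity)]; nlinarith⟩

theorem eventually_le_optimalRobustPayoff_of_tendsto_atTop [Finite Z] [Nonempty X]
    (hQ : ∀ x, Q x ∈ stdSimplex ℝ Y) (hC : 0 < capacity Q)
    (uS uR : Ω → A → Z → ℝ) (F : SplittingFamily μ S) {k n : ℕ → ℕ} (hn : ∀ j, 0 < n j)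
    (z : (j : ℕ) → Fin (n j) → Z) (hkn : Tendsto (fun j => (k j : ℝ) / n j) atTop atTop)
    {ε : ℝ} (hε : 0 < ε) :
    ∀ᶠ j in atTop, 1 / (n j : ℝ) * ∑ t, F.value uS uR (z j t) - ε ≤
      optimalRobustPayoff uS uR μ Q (k j) (z j) := by
  obtain ⟨B, hB0, hB⟩ := exists_abs_le fun i : Ω × A × Z => uS i.1 i.2.1 i.2.2
  obtain ⟨K, hK0, hK⟩ := F.exists_forall_lowerBoundAt uS uR
  obtain ⟨η, hη, hηε⟩ : ∃ η, 0 < η ∧ 2 * (B + K) * η ≤ ε := exists_pos_mul_le (by positivity) hε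
  have hrate : 0 < capacity Q * Real.log 2 := mul_pos hC (Real.log_pos one_lt_two)
  have hk : Tendsto k atTop atTop :=
    (tendsto_natCast_atTop_iff (R := ℝ)).1 <| tendsto_atTop_mono
      (fun j => div_le_self (Nat.cast_nonneg _) (by exact_mod_cast hn j)) hkn
  filter_upwards [hk.eventually (eventually_exists_code_of_card_le hQ (half_lt_self hrate) hη),
    hkn.eventually_ge_atTop (Real.log (Fintype.card S) / (capacity Q * Real.log 2 / 2))]
    with j hcode hlarge
  have hnj : (0 : ℝ) < n j := by exact_mod_cast hn j
  obtain ⟨s₀, -⟩ := exists_apply_le_sum_mul (F.weight_mem (z j ⟨0, hn j⟩)) 0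
  have : Nonempty S := ⟨s₀⟩
  obtain ⟨c, d, hcd⟩ := hcode (Fin (n j) → S) <| card_fun_le_exp <| by
    rw [div_le_div_iff₀ (by positivity) hnj] at hlarge
    linarith
  linarith [le_optimalRobustPayoff_of_code (z := z j) (uR := uR) hQ (hn j) F hB0
    (fun ω a z => hB (ω, a, z)) hK0 hK c d hcd]

end UncompressedMessages

section Typicality

lemma natCeil_exp_le {x y : ℝ} (hx : 0 ≤ x) (hy : Real.log 2 ≤ y) :
    (⌈Real.exp x⌉₊ : ℝ) ≤ Real.exp (x + y) := by
  have hceil : (⌈Real.exp x⌉₊ : ℝ) < Real.exp x + 1 := Nat.ceil_lt_add_one (Real.exp_pos x).le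
  have htwo : 2 ≤ Real.exp y := (Real.log_le_iff_le_exp two_pos).1 hy
  rw [Real.exp_add]
  nlinarith [Real.one_le_exp hx]

variable {Ω A Z S : Type*} [Fintype Ω] [Fintype S] {μ : Z → Ω → ℝ}

namespace SplittingFamily

variable (F : SplittingFamily μ S)

/-- Logarithm of the density of the posteriors with respect to the prior. -/
noncomputable def logDensity (z : Z) (s : S) (ω : Ω) : ℝ :=
  Real.log (F.posterior z s ω / μ z ω)

/-- Mutual information, in nats, of the splitting of the prior of type `z`. -/
noncomputable def info (z : Z) : ℝ :=
  ∑ s, F.weight z s * relEntropy (F.posterior z s) (μ z)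

/-- Every posterior has the same support as the prior that is split. -/
def FullSupport : Prop :=
  ∀ z s ω, F.posterior z s ω = 0 ↔ μ z ω = 0

variable {F}

lemma FullSupport.mul_exp_logDensity (hF : F.FullSupport) (z : Z) (s : S) (ω : Ω) :
    μ z ω * Real.exp (F.logDensity z s ω) = F.posterior z s ω := by
  by_cases hω : μ z ω = 0
  · rw [hω, zero_mul, (hF z s ω).2 hω]
  have hμ : 0 < μ z ω := ((F.prior_mem_stdSimplex z).1 ω).lt_of_ne' hω
  have hν : 0 < F.posterior z s ω := ((F.posterior_mem z s).1 ω).lt_of_ne' (mt (hF z s ω).1 hω)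
  rw [logDensity, Real.exp_log (by positivity), mul_div_cancel₀ _ hμ.ne']

lemma FullSupport.stateLaw_eq (hF : F.FullSupport) {n : ℕ} (z : Fin n → Z) (m : Fin n → S)
    (ω : Fin n → Ω) : F.stateLaw z m ω =
      seqPrior μ z ω * Real.exp (∑ t, F.logDensity (z t) (m t) (ω t)) := by
  rw [Real.exp_sum, seqPrior, ← Finset.prod_mul_distrib, stateLaw]
  exact Finset.prod_congr rfl fun t _ => (hF.mul_exp_logDensity (z t) (m t) (ω t)).symm

lemma FullSupport.info_nonneg (hF : F.FullSupport) (z : Z) : 0 ≤ F.info z :=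
  Finset.sum_nonneg fun s _ => mul_nonneg ((F.weight_mem z).1 s) <| by
    have hgibbs := sum_sub_sum_le_relEntropy (F.posterior_mem z s).1 (F.prior_mem_stdSimplex z).1
      fun ω => (hF z s ω).2
    rwa [(F.posterior_mem z s).2, (F.prior_mem_stdSimplex z).2, sub_self] at hgibbs

variable (F)

lemma sum_compProd_mul_logDensity (z : Z) :
    ∑ a, compProd (F.weight z) (F.posterior z) a * F.logDensity z a.1 a.2 = F.info z := by
  simp only [compProd, logDensity, info, relEntropy, Fintype.sum_prod_type, Finset.mul_sum,
    mul_assoc]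

lemma sum_compProd_mul_robustPayoff (uS uR : Ω → A → Z → ℝ) (z : Z) :
    ∑ a, compProd (F.weight z) (F.posterior z) a * robustPayoff uS uR z (F.posterior z a.1) =
      F.value uS uR z :=
  sum_compProd_mul_fst (F.posterior_mem z) _ fun s => robustPayoff uS uR z (F.posterior z s)

lemma exists_abs_logDensity_le [Finite Z] : ∃ Λ, 0 ≤ Λ ∧ ∀ z s ω, |F.logDensity z s ω| ≤ Λ := by
  obtain ⟨Λ, hΛ0, hΛ⟩ := exists_abs_le fun i : Z × S × Ω => F.logDensity i.1 i.2.1 i.2.2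
  exact ⟨Λ, hΛ0, fun z s ω => hΛ (z, s, ω)⟩

variable {n : ℕ} (uS uR : Ω → A → Z → ℝ) (z : Fin n → Z) (δ : ℝ)

/-- Pairs of messages and states whose average log-density and average robust payoff are
`δ`-close to their expectations. -/
def typicalSet : Set ((Fin n → S) × (Fin n → Ω)) :=
  {a | |∑ t, F.logDensity (z t) (a.1 t) (a.2 t) - ∑ t, F.info (z t)| < n * δ ∧
    |∑ t, robustPayoff uS uR (z t) (F.posterior (z t) (a.1 t)) - ∑ t, F.value uS uR (z t)| < n * δ}

variable {F uS uR z δ}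

lemma mass_compl_typicalSet_le [Finite A] [Nonempty A] {B Λ : ℝ} (hB : ∀ ω a z, |uS ω a z| ≤ B)
    (hΛ : ∀ z s ω, |F.logDensity z s ω| ≤ Λ) (hδ : 0 < δ) (hn : 0 < n) :
    mass (compProd (F.messageLaw z) (F.stateLaw z)) (F.typicalSet uS uR z δ)ᶜ ≤
      (Λ ^ 2 + B ^ 2) / (n * δ ^ 2) := by
  have : Nonempty (Fin n) := ⟨⟨0, hn⟩⟩
  have hw : ∀ t, compProd (F.weight (z t)) (F.posterior (z t)) ∈ stdSimplex ℝ (S × Ω) := fun t =>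
    compProd_mem_stdSimplex (F.weight_mem (z t)) (F.posterior_mem (z t))
  have hdensity := mass_prodLaw_le_of_abs_sub_sum_ge hw
    (fun t a => hΛ (z t) a.1 a.2) hδ
  have hpayoff := mass_prodLaw_le_of_abs_sub_sum_ge hw
    (fun t a => abs_robustPayoff_le uR (fun ω a => hB ω a (z t)) (F.posterior_mem (z t) a.1)) hδ
  simp only [Fintype.card_fin, sum_compProd_mul_logDensity] at hdensity
  simp only [Fintype.card_fin, sum_compProd_mul_robustPayoff] at hpayoff
  rw [add_div]
  refine le_trans ?_ (add_le_add hdensity hpayoff)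
  refine (mass_compProd_prodLaw _ (fun t => F.posterior (z t)) _).trans_le <| le_trans ?_ <|
    mass_union_le (prodLaw_mem_stdSimplex hw).1 _ _
  refine mass_mono (prodLaw_mem_stdSimplex hw).1 fun a ha _ => ?_
  by_contra hnot
  simp only [Set.mem_union, Set.mem_ofPred_eq, not_or, not_le] at hnot
  exact ha hnot

lemma compProd_le_of_mem_typicalSet (hF : F.FullSupport) {m : Fin n → S} {ω : Fin n → Ω}
    (h : (m, ω) ∈ F.typicalSet uS uR z δ) :
    compProd (F.messageLaw z) (F.stateLaw z) (m, ω) ≤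
      Real.exp (∑ t, F.info (z t) + n * δ) * (F.messageLaw z m * seqPrior μ z ω) := by
  calc compProd (F.messageLaw z) (F.stateLaw z) (m, ω)
      = Real.exp (∑ t, F.logDensity (z t) (m t) (ω t)) *
          (F.messageLaw z m * seqPrior μ z ω) := by
        rw [compProd, hF.stateLaw_eq]
        ring
    _ ≤ _ := by
        gcongr
        · exact mul_nonneg ((F.messageLaw_mem_stdSimplex z).1 m)
            ((seqPrior_mem_stdSimplex F.prior_mem_stdSimplex z).1 ω)
        · linarith [(abs_lt.1 h.1).2]

lemma eventually_exists_typical_cover [Finite A] [Nonempty A] [Finite Z] (hF : F.FullSupport)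
    (uS uR : Ω → A → Z → ℝ) {ε : ℝ} (hδ : 0 < δ) (hε : 0 < ε) :
    ∀ᶠ n : ℕ in atTop, ∀ z : Fin n → Z, ∃ M : ℕ, 0 < M ∧
      (M : ℝ) ≤ Real.exp (∑ t, F.info (z t) + n * (3 * δ)) ∧ ∃ b : Fin M → Fin n → S,
        mass (seqPrior μ z) {ω | ∀ j, (b j, ω) ∉ F.typicalSet uS uR z δ} ≤ ε := by
  obtain ⟨B, -, hB⟩ := exists_abs_le fun i : Ω × A × Z => uS i.1 i.2.1 i.2.2
  obtain ⟨Λ, -, hΛ⟩ := F.exists_abs_logDensity_le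
  filter_upwards [eventually_div_add_exp_le (2 * (Λ ^ 2 + B ^ 2)) hδ hε, eventually_gt_atTop 0,
    (tendsto_natCast_atTop_atTop.atTop_mul_const hδ).eventually_ge_atTop (Real.log 2)]
    with n hsmall hn hlog z
  set I := ∑ t, F.info (z t)
  have hI : 0 ≤ I := Finset.sum_nonneg fun t _ => hF.info_nonneg (z t)
  set M := ⌈Real.exp (I + n * (2 * δ))⌉₊
  have hM : Real.exp (I + n * (2 * δ)) ≤ M := Nat.le_ceil _
  obtain ⟨b, hb⟩ := exists_cover (G := F.typicalSet uS uR z δ) (a := Real.exp (I + n * δ))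
    (compProd_nonneg (F.messageLaw_mem_stdSimplex z).1 fun m => (F.stateLaw_mem_stdSimplex z m).1)
    (F.messageLaw_mem_stdSimplex z) (seqPrior_mem_stdSimplex F.prior_mem_stdSimplex z)
    (congrFun (F.mixture_messageLaw_stateLaw z)) (Real.one_le_exp (by positivity))
    (fun _ _ => compProd_le_of_mem_typicalSet hF) M
  refine ⟨M, Nat.ceil_pos.2 (Real.exp_pos _), ?_, b, ?_⟩
  · exact (natCeil_exp_le (by positivity) hlog).trans_eq (by ring_nf)
  have htypical := mass_compl_typicalSet_le (uR := uR) (z := z) (fun ω a z => hB (ω, a, z)) hΛ hδ hn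
  have hexp : n * δ ≤ M / (2 * Real.exp (I + n * δ)) := by
    rw [le_div_iff₀ (by positivity)]
    calc n * δ * (2 * Real.exp (I + n * δ))
        = 2 * (n * δ) * Real.exp (I + n * δ) := by ring
      _ ≤ Real.exp (n * δ) * Real.exp (I + n * δ) := by gcongr; exact Real.two_mul_le_exp
      _ ≤ M := by rw [← Real.exp_add]; exact (by ring_nf : _ = _).trans_le hM
  calc mass (seqPrior μ z) {ω | ∀ j, (b j, ω) ∉ F.typicalSet uS uR z δ}
      ≤ 2 * ((Λ ^ 2 + B ^ 2) / (n * δ ^ 2)) + Real.exp (-(n * δ)) := by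
        refine hb.trans (add_le_add ?_ ?_) <;> gcongr
    _ ≤ ε := by rwa [← mul_div_assoc]

end SplittingFamily

end Typicality

section Pinsker

variable {ι Ω Y : Type*} [Fintype Ω]

lemma deviation_le_relEntropy {w β : Ω → ℝ} {θ : ℝ} (hw : ∀ ω, 0 ≤ w ω) (hβ : β ∈ stdSimplex ℝ Ω)
    (hwβ : ∀ ω, w ω ≠ 0 → β ω ≠ 0) (hθ : 0 < θ) :
    deviation w β ≤
      1 / (2 * θ) * relEntropy w (fun ω => (∑ ω', w ω') * β ω) + 2 * θ * ∑ ω, w ω := by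
  have hsum : 0 ≤ ∑ ω, w ω := Finset.sum_nonneg fun ω _ => hw ω
  refine sum_abs_sub_le_relEntropy hw (fun ω => mul_nonneg hsum (hβ.1 ω)) (fun ω hω => ?_)
    (by rw [← Finset.mul_sum, hβ.2, mul_one]) hθ
  rcases mul_eq_zero.1 hω with h | h
  · exact (Finset.sum_eq_zero_iff_of_nonneg fun ω _ => hw ω).1 h ω (Finset.mem_univ ω)
  · exact by_contra fun hne => hwβ ω hne h

variable [Fintype ι] [DecidableEq ι] [Fintype Y] {W : Y → (ι → Ω) → ℝ} {β : Y → ι → Ω → ℝ}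

lemma exists_of_marginal_ne_zero {P : (ι → Ω) → ℝ} {t : ι} {a : Ω} (h : marginal P t a ≠ 0) :
    ∃ ω, ω t = a ∧ P ω ≠ 0 := by
  obtain ⟨ω, -, hω⟩ := Finset.exists_ne_zero_of_sum_ne_zero h
  obtain ⟨hωa, hωP⟩ := Set.indicator_apply_ne_zero.1 hω
  exact ⟨ω, hωa, hωP⟩

lemma sum_deviation_marginal_le {θ : ℝ} (hW : ∀ y ω, 0 ≤ W y ω)
    (hβ : ∀ y t, β y t ∈ stdSimplex ℝ Ω) (hWβ : ∀ y ω t, W y ω ≠ 0 → β y t (ω t) ≠ 0)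
    (hθ : 0 < θ) :
    ∑ y, ∑ t, deviation (marginal (W y) t) (β y t) ≤
      1 / (2 * θ) * (∑ y, relEntropy (W y) fun ω => (∑ ω', W y ω') * prodLaw (β y) ω) +
        2 * θ * (Fintype.card ι * ∑ y, ∑ ω, W y ω) := by
  have hpinsker : ∀ y t, deviation (marginal (W y) t) (β y t) ≤
      1 / (2 * θ) * relEntropy (marginal (W y) t) (fun a => (∑ ω, W y ω) * β y t a) +
        2 * θ * ∑ ω, W y ω := fun y t => by
    simpa only [sum_marginal] using deviation_le_relEntropy (marginal_nonneg (hW y) t) (hβ y t)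
      (fun a ha => by
        obtain ⟨ω, rfl, hω⟩ := exists_of_marginal_ne_zero ha
        exact hWβ y ω t hω) hθ
  calc ∑ y, ∑ t, deviation (marginal (W y) t) (β y t)
      ≤ ∑ y, ∑ t, (1 / (2 * θ) * relEntropy (marginal (W y) t)
          (fun a => (∑ ω, W y ω) * β y t a) + 2 * θ * ∑ ω, W y ω) :=
        Finset.sum_le_sum fun y _ => Finset.sum_le_sum fun t _ => hpinsker y t
    _ = ∑ y, (1 / (2 * θ) * (∑ t, relEntropy (marginal (W y) t)
          (fun a => (∑ ω, W y ω) * β y t a)) + 2 * θ * (Fintype.card ι * ∑ ω, W y ω)) := by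
        simp only [Finset.sum_add_distrib, ← Finset.mul_sum, Finset.sum_const, Finset.card_univ,
          nsmul_eq_mul]
    _ ≤ ∑ y, (1 / (2 * θ) * relEntropy (W y) (fun ω => (∑ ω', W y ω') * prodLaw (β y) ω) +
          2 * θ * (Fintype.card ι * ∑ ω, W y ω)) := by
        gcongr with y
        exact sum_relEntropy_marginal_le (hW y) (hWβ y)
    _ = _ := by simp only [Finset.sum_add_distrib, ← Finset.mul_sum]

end Pinsker

section CoverDecoding

variable {T U V : Type*} [Fintype U] [Fintype V] {m : U → ℝ} {K : T → V → ℝ} {f : U → T}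

lemma sub_mul_mass_le_sum_mul {p g : U → ℝ} {v G : ℝ} {E : Set U} (hp : p ∈ stdSimplex ℝ U)
    (hg : ∀ u ∉ E, v ≤ g u) (hG : ∀ u, v - G ≤ g u) : v - G * mass p E ≤ ∑ u, p u * g u := by
  have herror := neg_mul_mass_le_sum_mul (f := fun u => g u - v) (G := G) hp.1
    (fun u hu => sub_nonneg.2 (hg u hu)) fun u => by linarith [hG u]
  simp only [mul_sub, Finset.sum_sub_distrib, ← Finset.sum_mul, hp.2, one_mul] at herror
  linarith

lemma mass_compProd_preimage_fst {p : U → ℝ} {K : U → V → ℝ} (hK : ∀ u, K u ∈ stdSimplex ℝ V)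
    (E : Set U) : mass (compProd p K) {a | a.1 ∈ E} = mass p E := by
  rw [mass_compProd]
  refine Finset.sum_congr rfl fun u _ => ?_
  by_cases hu : u ∈ E
  · simp [hu, mass, (hK u).2]
  · simp [hu, mass]

lemma mass_compProd_notMem_le {G : Set (T × U)} {d : V → T} {ε ε' : ℝ} (hm : m ∈ stdSimplex ℝ U)
    (hK : ∀ i, K i ∈ stdSimplex ℝ V) (hd : ∀ i, mass (K i) {v | i ≠ d v} ≤ ε)
    (hf : mass m {u | (f u, u) ∉ G} ≤ ε') :
    mass (compProd m fun u => K (f u)) {a | (d a.2, a.1) ∉ G} ≤ ε + ε' := by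
  have hnonneg := compProd_nonneg hm.1 fun u => (hK (f u)).1
  calc mass (compProd m fun u => K (f u)) {a | (d a.2, a.1) ∉ G}
      ≤ mass (compProd m fun u => K (f u))
          ({a | f a.1 ≠ d a.2} ∪ {a | a.1 ∈ {u | (f u, u) ∉ G}}) :=
        mass_mono hnonneg fun a ha _ => or_iff_not_imp_left.2 fun h => by
          simpa [not_not.1 h] using ha
    _ ≤ _ := mass_union_le hnonneg _ _
    _ ≤ ε + ε' := add_le_add (mass_compProd_le hm fun u => hd (f u))
        ((mass_compProd_preimage_fst (fun u => hK (f u)) _).trans_le hf)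

variable [Fintype T]

lemma mul_log_div_mul_exp_le {w k q M l : ℝ} (hw : 0 ≤ w) (hk : 0 ≤ k) (hq : 0 ≤ q)
    (hkq : k ≤ M * q) :
    w * k * Real.log (w * k / (q * (w * Real.exp l))) ≤ w * k * (Real.log M - l) := by
  rcases hw.eq_or_lt' with rfl | hw
  · simp
  rcases hk.eq_or_lt' with rfl | hk
  · simp
  have hq : 0 < q := hq.lt_of_ne' (by rintro rfl; linarith)
  have hratio : w * k / (q * (w * Real.exp l)) = k / q / Real.exp l := by field
  rw [hratio, Real.log_div (by positivity) (Real.exp_pos _).ne', Real.log_exp]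
  gcongr
  exact (div_le_iff₀ hq).2 hkq

-- The reference output law is the one of a uniform index, whose density is at most `card T`.
lemma sum_relEntropy_sum_mul_exp_le [Nonempty T] (hm : m ∈ stdSimplex ℝ U)
    (hK : ∀ i, K i ∈ stdSimplex ℝ V) (f : U → T) (l : V → U → ℝ) :
    ∑ v, relEntropy (fun u => m u * K (f u) v)
        (fun u => (∑ u', m u' * K (f u') v) * (m u * Real.exp (l v u))) ≤
      Real.log (Fintype.card T) - ∑ a, compProd m (fun u => K (f u)) a * l a.2 a.1 := by
  set q : V → ℝ := mixture (fun _ : T => (Fintype.card T : ℝ)⁻¹) K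
  have hcard : (0 : ℝ) < Fintype.card T := by exact_mod_cast Fintype.card_pos
  have hq : q ∈ stdSimplex ℝ V := mixture_mem_stdSimplex ⟨fun _ => by positivity, by simp⟩ hK
  have hKq : ∀ i v, K i v ≤ Fintype.card T * q v := fun i v => by
    have hle := mul_le_mixture (p := fun _ : T => (Fintype.card T : ℝ)⁻¹)
      (fun _ => by positivity) (fun i => (hK i).1) i v
    rwa [inv_mul_le_iff₀ hcard] at hle
  have hq_ne : ∀ v u, m u * K (f u) v ≠ 0 → q v ≠ 0 := fun v u h hqv =>
    h (by rw [((hKq (f u) v).trans_eq (by rw [hqv, mul_zero])).antisymm ((hK _).1 v), mul_zero])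
  have htotal : ∑ v, ∑ u, m u * K (f u) v = 1 :=
    (mixture_mem_stdSimplex hm fun u => hK (f u)).2
  refine (sum_relEntropy_sum_mul_le (fun v u => mul_nonneg (hm.1 u) ((hK _).1 v)) hq.1
    (by rw [hq.2, htotal]) hq_ne
    fun v u h => mul_ne_zero (left_ne_zero_of_mul h) (Real.exp_pos _).ne').trans ?_
  refine (Finset.sum_le_sum fun v _ => Finset.sum_le_sum fun u _ =>
    mul_log_div_mul_exp_le (hm.1 u) ((hK _).1 v) (hq.1 v) (hKq (f u) v)).trans_eq ?_
  simp only [mul_sub, Finset.sum_sub_distrib, ← Finset.sum_mul, htotal, one_mul, compProd,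
    Fintype.sum_prod_type_right]

end CoverDecoding

section CoveringStrategy

variable {Ω A Z X Y S T : Type*} [Fintype Ω] [Fintype S] {μ : Z → Ω → ℝ}
  {F : SplittingFamily μ S} {uS uR : Ω → A → Z → ℝ} {n k : ℕ} {z : Fin n → Z} {B K Λ δ ε θ : ℝ}

namespace SplittingFamily

lemma abs_info_le (hΛ : ∀ z s ω, |F.logDensity z s ω| ≤ Λ) (z : Z) : |F.info z| ≤ Λ := by
  rw [← sum_compProd_mul_logDensity]
  exact abs_sum_mul_le_of_mem
    (compProd_mem_stdSimplex (F.weight_mem z) (F.posterior_mem z)) fun a => hΛ z a.1 a.2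

lemma abs_value_le [Finite A] [Nonempty A] (hB : ∀ ω a z, |uS ω a z| ≤ B) (z : Z) :
    |F.value uS uR z| ≤ B :=
  abs_sum_mul_le_of_mem (F.weight_mem z) fun s =>
    abs_robustPayoff_le uR (fun ω a => hB ω a z) (F.posterior_mem z s)

variable {U : Type*} [Fintype U] {p : U → ℝ}

lemma sum_info_sub_le_sum_mul_logDensity (hp : p ∈ stdSimplex ℝ U)
    (hΛ : ∀ z s ω, |F.logDensity z s ω| ≤ Λ) (hδ : 0 ≤ δ) (g : U → (Fin n → S) × (Fin n → Ω)) :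
    ∑ t, F.info (z t) - n * δ - 2 * (n * Λ) * mass p {u | g u ∉ F.typicalSet uS uR z δ} ≤
      ∑ u, p u * ∑ t, F.logDensity (z t) ((g u).1 t) ((g u).2 t) := by
  refine sub_mul_mass_le_sum_mul hp (fun u hu => ?_) fun u => ?_
  · linarith [(abs_lt.1 (not_not.1 hu).1).1]
  · have hinfo := abs_sum_le_card_mul fun t => abs_info_le hΛ (z t)
    have hdensity := abs_sum_le_card_mul fun t => hΛ (z t) ((g u).1 t) ((g u).2 t)
    rw [Fintype.card_fin] at hinfo hdensity
    have : 0 ≤ n * δ := by positivity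
    linarith [(abs_le.1 hinfo).2, (abs_le.1 hdensity).1]

lemma sum_value_sub_le_sum_mul_robustPayoff [Finite A] [Nonempty A] (hp : p ∈ stdSimplex ℝ U)
    (hB : ∀ ω a z, |uS ω a z| ≤ B) (hδ : 0 ≤ δ) (g : U → (Fin n → S) × (Fin n → Ω)) :
    ∑ t, F.value uS uR (z t) - n * δ - 2 * (n * B) * mass p {u | g u ∉ F.typicalSet uS uR z δ} ≤
      ∑ u, p u * ∑ t, robustPayoff uS uR (z t) (F.posterior (z t) ((g u).1 t)) := by
  refine sub_mul_mass_le_sum_mul hp (fun u hu => ?_) fun u => ?_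
  · linarith [(abs_lt.1 (not_not.1 hu).2).1]
  · have hvalue := abs_sum_le_card_mul fun t => F.abs_value_le (uR := uR) hB (z t)
    have hpayoff := F.abs_sum_robustPayoff_le (z := z) uR hB (g u).1
    rw [Fintype.card_fin] at hvalue
    have : 0 ≤ n * δ := by positivity
    linarith [(abs_le.1 hvalue).2, (abs_le.1 hpayoff).1]

end SplittingFamily

variable [Fintype Y] {Q : X → Y → ℝ}

lemma sum_deviation_posterior_le [Fintype T] [Nonempty T] (hQ : ∀ x, Q x ∈ stdSimplex ℝ Y)
    (hF : F.FullSupport) (b : T → Fin n → S) (f : (Fin n → Ω) → T) (c : T → Fin k → X)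
    (d : (Fin k → Y) → T) (hθ : 0 < θ) :
    ∑ y, ∑ t, deviation (marginal (fun ω => seqPrior μ z ω * seqChannel Q (c (f ω)) y) t)
        (F.posterior (z t) (b (d y) t)) ≤
      1 / (2 * θ) * (Real.log (Fintype.card T) -
        ∑ a, compProd (seqPrior μ z) (fun ω => seqChannel Q (c (f ω))) a *
          ∑ t, F.logDensity (z t) (b (d a.2) t) (a.1 t)) + 2 * θ * n := by
  have hprior := seqPrior_mem_stdSimplex F.prior_mem_stdSimplex z
  have hchannel := fun i => seqChannel_mem_stdSimplex hQ (c i)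
  have hlaw : ∀ y, prodLaw (fun t => F.posterior (z t) (b (d y) t)) = fun ω =>
      seqPrior μ z ω * Real.exp (∑ t, F.logDensity (z t) (b (d y) t) (ω t)) := fun y =>
    funext fun ω => hF.stateLaw_eq z (b (d y)) ω
  have htotal : ∑ y, ∑ ω, seqPrior μ z ω * seqChannel Q (c (f ω)) y = 1 :=
    (mixture_mem_stdSimplex hprior fun ω => hchannel (f ω)).2
  have hpinsker := sum_deviation_marginal_le
    (W := fun y ω => seqPrior μ z ω * seqChannel Q (c (f ω)) y)
    (β := fun y t => F.posterior (z t) (b (d y) t))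
    (fun y ω => mul_nonneg (hprior.1 ω) ((hchannel _).1 y))
    (fun y t => F.posterior_mem (z t) (b (d y) t))
    (fun y ω t hω => mt (hF (z t) _ (ω t)).1 <|
      Finset.prod_ne_zero_iff.1 (left_ne_zero_of_mul hω) t (Finset.mem_univ t)) hθ
  simp only [hlaw, htotal, mul_one, Fintype.card_fin] at hpinsker
  refine hpinsker.trans ?_
  gcongr
  exact sum_relEntropy_sum_mul_exp_le hprior hchannel f
    fun y ω => ∑ t, F.logDensity (z t) (b (d y) t) (ω t)

lemma exists_forall_exists_imp [Nonempty T] {U : Type*} (R : T → U → Prop) :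
    ∃ f : U → T, ∀ u, (∃ i, R i u) → R (f u) u :=
  ⟨fun u => Classical.epsilon fun i => R i u, fun _ h => Classical.epsilon_spec h⟩

lemma exists_encoding_of_cover [Nonempty T] (hQ : ∀ x, Q x ∈ stdSimplex ℝ Y)
    {b : T → Fin n → S} (hb : mass (seqPrior μ z) {ω | ∀ i, (b i, ω) ∉ F.typicalSet uS uR z δ} ≤ ε)
    {c : T → Fin k → X} {d : (Fin k → Y) → T}
    (hcd : ∀ i, mass (seqChannel Q (c i)) {y | i ≠ d y} ≤ ε) :
    ∃ f : (Fin n → Ω) → T, mass (compProd (seqPrior μ z) fun ω => seqChannel Q (c (f ω)))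
      {a | (b (d a.2), a.1) ∉ F.typicalSet uS uR z δ} ≤ 2 * ε := by
  obtain ⟨f, hf⟩ := exists_forall_exists_imp fun i ω => (b i, ω) ∈ F.typicalSet uS uR z δ
  have hprior := seqPrior_mem_stdSimplex F.prior_mem_stdSimplex z
  have huncovered : mass (seqPrior μ z) {ω | (b (f ω), ω) ∉ F.typicalSet uS uR z δ} ≤ ε :=
    (mass_mono hprior.1 fun ω (hω : (b (f ω), ω) ∉ _) _ i hi => hω (hf ω ⟨i, hi⟩)).trans hb
  exact ⟨f, (mass_compProd_notMem_le (G := {a | (b a.1, a.2) ∈ F.typicalSet uS uR z δ}) hprior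
    (fun i => seqChannel_mem_stdSimplex hQ (c i)) hcd huncovered).trans_eq (two_mul ε).symm⟩

lemma sum_deviation_posterior_le_of_mass_le [Fintype T] [Nonempty T]
    (hQ : ∀ x, Q x ∈ stdSimplex ℝ Y) (hF : F.FullSupport)
    (hΛ : ∀ z s ω, |F.logDensity z s ω| ≤ Λ) (hΛ0 : 0 ≤ Λ) (hδ : 0 < δ) (hθ : 0 < θ)
    (hT : (Fintype.card T : ℝ) ≤ Real.exp (∑ t, F.info (z t) + n * (3 * δ)))
    {b : T → Fin n → S} {f : (Fin n → Ω) → T} {c : T → Fin k → X} {d : (Fin k → Y) → T}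
    (herror : mass (compProd (seqPrior μ z) fun ω => seqChannel Q (c (f ω)))
      {a | (b (d a.2), a.1) ∉ F.typicalSet uS uR z δ} ≤ 2 * ε) :
    ∑ y, ∑ t, deviation (marginal (fun ω => seqPrior μ z ω * seqChannel Q (c (f ω)) y) t)
        (F.posterior (z t) (b (d y) t)) ≤
      n * (1 / (2 * θ) * (4 * δ + 4 * Λ * ε) + 2 * θ) := by
  have hlog : Real.log (Fintype.card T) ≤ ∑ t, F.info (z t) + n * (3 * δ) :=
    (Real.log_le_iff_le_exp (by exact_mod_cast Fintype.card_pos)).2 hT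
  have hdensity := F.sum_info_sub_le_sum_mul_logDensity (uS := uS) (uR := uR) (z := z)
    (compProd_mem_stdSimplex (seqPrior_mem_stdSimplex F.prior_mem_stdSimplex z)
      fun ω => seqChannel_mem_stdSimplex hQ (c (f ω))) hΛ hδ.le fun a => (b (d a.2), a.1)
  have hloss := mul_le_mul_of_nonneg_left herror (by positivity : 0 ≤ 2 * (n * Λ))
  refine (sum_deviation_posterior_le hQ hF b f c d hθ).trans ?_
  calc _ ≤ 1 / (2 * θ) * (n * (4 * δ + 4 * Λ * ε)) + 2 * θ * n := by gcongr; linarith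
    _ = _ := by ring

lemma le_optimalRobustPayoff_of_cover [Finite A] [Nonempty A] [Fintype X]
    (hQ : ∀ x, Q x ∈ stdSimplex ℝ Y) (hn : 0 < n) (hF : F.FullSupport)
    (hB : ∀ ω a z, |uS ω a z| ≤ B) (hB0 : 0 ≤ B)
    (hΛ : ∀ z s ω, |F.logDensity z s ω| ≤ Λ) (hΛ0 : 0 ≤ Λ)
    (hK : ∀ z s, LowerBoundAt uS uR z (F.posterior z s) K) (hK0 : 0 ≤ K) (hδ : 0 < δ) (hθ : 0 < θ)
    [Fintype T] [Nonempty T]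
    (hT : (Fintype.card T : ℝ) ≤ Real.exp (∑ t, F.info (z t) + n * (3 * δ)))
    {b : T → Fin n → S} (hb : mass (seqPrior μ z) {ω | ∀ i, (b i, ω) ∉ F.typicalSet uS uR z δ} ≤ ε)
    {c : T → Fin k → X} {d : (Fin k → Y) → T}
    (hcd : ∀ i, mass (seqChannel Q (c i)) {y | i ≠ d y} ≤ ε) :
    1 / n * ∑ t, F.value uS uR (z t) -
      (δ + 4 * B * ε + K * (1 / (2 * θ) * (4 * δ + 4 * Λ * ε) + 2 * θ)) ≤
      optimalRobustPayoff uS uR μ Q k z := by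
  obtain ⟨f, herror⟩ := exists_encoding_of_cover hQ hb hcd
  have hlaw : ∀ y, jointLaw μ Q z (pureStrategy fun ω => c (f ω)) y =
      fun ω => seqPrior μ z ω * seqChannel Q (c (f ω)) y := fun y =>
    funext fun ω => jointLaw_pureStrategy μ Q z _ y ω
  have hpayoff := le_optimalRobustPayoff_of_deviation F.prior_mem_stdSimplex hQ
    (pureStrategy_mem fun ω => c (f ω)) hn (uS := uS) (uR := uR) (z := z)
    (β := fun y t => F.posterior (z t) (b (d y) t)) fun y t => hK (z t) _
  simp only [hlaw] at hpayoff
  have hdeviation := mul_le_mul_of_nonneg_left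
    (sum_deviation_posterior_le_of_mass_le hQ hF hΛ hΛ0 hδ hθ hT herror) hK0
  have hvalue := F.sum_value_sub_le_sum_mul_robustPayoff (uR := uR) (z := z)
    (compProd_mem_stdSimplex (seqPrior_mem_stdSimplex F.prior_mem_stdSimplex z)
      fun ω => seqChannel_mem_stdSimplex hQ (c (f ω))) hB hδ.le fun a => (b (d a.2), a.1)
  rw [sum_compProd_mul_snd (f := fun y =>
    ∑ t, robustPayoff uS uR (z t) (F.posterior (z t) (b (d y) t)))] at hvalue
  simp only [mixture] at hvalue
  have hloss := mul_le_mul_of_nonneg_left herror (by positivity : 0 ≤ 2 * (n * B))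
  have hn' : (0 : ℝ) < n := by exact_mod_cast hn
  refine le_trans ?_ hpayoff
  rw [one_div, inv_mul_eq_div, inv_mul_eq_div, sub_le_iff_le_add, div_add' _ _ _ hn'.ne']
  gcongr
  linarith

lemma exists_covering_parameters {G : ℝ} (hB : 0 ≤ B) (hK : 0 ≤ K) (hΛ : 0 ≤ Λ) (hG : 0 < G)
    (hε : 0 < ε) : ∃ δ θ, 0 < δ ∧ δ ≤ G ∧ 0 < θ ∧
      δ + 4 * B * δ + K * (1 / (2 * θ) * (4 * δ + 4 * Λ * δ) + 2 * θ) ≤ ε := by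
  obtain ⟨θ, hθ, hKθ⟩ := exists_pos_mul_le (by positivity : 0 ≤ K * 2) (half_pos hε)
  obtain ⟨δ, hδ, hloss⟩ := exists_pos_mul_le
    (by positivity : 0 ≤ 1 + 4 * B + K * (1 / (2 * θ) * (4 + 4 * Λ))) (half_pos hε)
  refine ⟨min δ G, θ, lt_min hδ hG, min_le_right δ G, hθ, ?_⟩
  calc _ = (1 + 4 * B + K * (1 / (2 * θ) * (4 + 4 * Λ))) * min δ G + K * 2 * θ := by ring
    _ ≤ (1 + 4 * B + K * (1 / (2 * θ) * (4 + 4 * Λ))) * δ + K * 2 * θ := by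
        gcongr
        exact min_le_left δ G
    _ ≤ ε := by linarith

lemma tendsto_atTop_of_tendsto_div {k n : ℕ → ℕ} {r : ℝ} (hn : Tendsto n atTop atTop) (hr : 0 < r)
    (hkn : Tendsto (fun j => (k j : ℝ) / n j) atTop (𝓝 r)) : Tendsto k atTop atTop := by
  have hmul : Tendsto (fun j => (k j : ℝ) / n j * n j) atTop atTop :=
    hkn.pos_mul_atTop hr ((tendsto_natCast_atTop_iff (R := ℝ)).2 hn)
  refine (tendsto_natCast_atTop_iff (R := ℝ)).1 (hmul.congr' ?_)
  filter_upwards [hn.eventually_gt_atTop 0] with j hj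
  exact div_mul_cancel₀ _ (by positivity)

lemma tendsto_sum_empFreq_mul [Fintype Z] {n : ℕ → ℕ} {z : (j : ℕ) → Fin (n j) → Z} {π : Z → ℝ}
    (hπ : Tendsto (fun j => empFreq (z j)) atTop (𝓝 π)) (f : Z → ℝ) :
    Tendsto (fun j => ∑ z₀, empFreq (z j) z₀ * f z₀) atTop (𝓝 (∑ z₀, π z₀ * f z₀)) :=
  tendsto_finsetSum _ fun z₀ _ => (tendsto_pi_nhds.1 hπ z₀).mul_const (f z₀)

lemma eventually_sum_add_le_mul [Fintype Z] {k n : ℕ → ℕ} {z : (j : ℕ) → Fin (n j) → Z}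
    {π f : Z → ℝ} {r ρ : ℝ} (hn : Tendsto n atTop atTop)
    (hkn : Tendsto (fun j => (k j : ℝ) / n j) atTop (𝓝 r))
    (hπ : Tendsto (fun j => empFreq (z j)) atTop (𝓝 π)) (hlt : ∑ z₀, π z₀ * f z₀ + δ < r * ρ) :
    ∀ᶠ j in atTop, ∑ t, f (z j t) + n j * δ ≤ k j * ρ := by
  filter_upwards [((tendsto_sum_empFreq_mul hπ f).add_const δ).eventually_lt
    (hkn.mul_const ρ) hlt, hn.eventually_gt_atTop 0] with j hrate hnj
  have hnj' : (0 : ℝ) < n j := by exact_mod_cast hnj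
  rw [sum_empFreq_mul, one_div, inv_mul_eq_div, div_mul_eq_mul_div, div_add' _ _ _ hnj'.ne',
    div_lt_div_iff_of_pos_right hnj'] at hrate
  linarith

theorem eventually_le_optimalRobustPayoff_of_info_lt [Finite A] [Nonempty A] [Fintype Z]
    [Fintype X] [Nonempty X] (hQ : ∀ x, Q x ∈ stdSimplex ℝ Y) (uS uR : Ω → A → Z → ℝ)
    (hF : F.FullSupport) {k n : ℕ → ℕ} {z : (j : ℕ) → Fin (n j) → Z} {π : Z → ℝ} {r : ℝ}
    (hn : Tendsto n atTop atTop) (hr : 0 < r)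
    (hkn : Tendsto (fun j => (k j : ℝ) / n j) atTop (𝓝 r))
    (hπ : Tendsto (fun j => empFreq (z j)) atTop (𝓝 π))
    (hinfo : ∑ z, π z * F.info z < r * (capacity Q * Real.log 2)) (hε : 0 < ε) :
    ∀ᶠ j in atTop, 1 / (n j : ℝ) * ∑ t, F.value uS uR (z j t) - ε ≤
      optimalRobustPayoff uS uR μ Q (k j) (z j) := by
  obtain ⟨B, hB0, hB⟩ := exists_abs_le fun i : Ω × A × Z => uS i.1 i.2.1 i.2.2
  obtain ⟨Λ, hΛ0, hΛ⟩ := F.exists_abs_logDensity_le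
  obtain ⟨K, hK0, hK⟩ := F.exists_forall_lowerBoundAt uS uR
  obtain ⟨ρ, hρ, hρC⟩ := exists_between ((div_lt_iff₀' hr).2 hinfo)
  rw [div_lt_iff₀' hr] at hρ
  obtain ⟨δ, θ, hδ, hδρ, hθ, hloss⟩ := exists_covering_parameters hB0 hK0 hΛ0
    (by linarith : 0 < (r * ρ - ∑ z, π z * F.info z) / 4) hε
  filter_upwards [
    (tendsto_atTop_of_tendsto_div hn hr hkn).eventually
      (eventually_exists_code_of_card_le hQ hρC hδ),
    hn.eventually (SplittingFamily.eventually_exists_typical_cover hF uS uR hδ hδ),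
    eventually_sum_add_le_mul (δ := 3 * δ) hn hkn hπ (by linarith : _ < r * ρ),
    hn.eventually_gt_atTop 0] with j hcode hcover hrate hnj
  obtain ⟨M, hM0, hM, b, hb⟩ := hcover (z j)
  have : Nonempty (Fin M) := ⟨⟨0, hM0⟩⟩
  rw [← Fintype.card_fin M] at hM
  obtain ⟨c, d, hcd⟩ := hcode (Fin M) (hM.trans (Real.exp_le_exp.2 hrate))
  linarith [le_optimalRobustPayoff_of_cover hQ hnj hF (fun ω a z => hB (ω, a, z)) hB0 hΛ hΛ0 hK
    hK0 hδ hθ hM hb hcd]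

end CoveringStrategy

section FullSupportFamilies

variable {Ω A Z S : Type*} [Fintype Ω] [Fintype S] {μ : Z → Ω → ℝ} {η : ℝ}

lemma exists_splittingFamily [Fintype Z] (hμ : ∀ z, μ z ∈ stdSimplex ℝ Ω)
    (s : (z : Z) → Splitting (μ z)) :
    ∃ F : SplittingFamily μ (Σ z, Fin (s z).card),
      (∀ z i ω, μ z ω = 0 → F.posterior z i ω = 0) ∧
      ∀ z (f : (Ω → ℝ) → ℝ), ∑ i, F.weight z i * f (F.posterior z i) =
        ∑ m, (s z).weight m * f ((s z).posterior m) := by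
  classical
  let w (z : Z) (i : Σ z, Fin (s z).card) : ℝ := if i.1 = z then (s i.1).weight i.2 else 0
  let ν (z : Z) (i : Σ z, Fin (s z).card) : Ω → ℝ :=
    if w z i = 0 then μ z else (s i.1).posterior i.2
  have hsum z (f : (Ω → ℝ) → ℝ) : ∑ i, w z i * f (ν z i) =
      ∑ m, (s z).weight m * f ((s z).posterior m) := by
    have hterm i : w z i * f (ν z i) = w z i * f ((s i.1).posterior i.2) := by
      by_cases hi : w z i = 0 <;> simp [ν, hi]
    rw [Finset.sum_congr rfl fun i _ => hterm i, Fintype.sum_sigma, Finset.sum_eq_single z]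
    · simp [w]
    · intro z' _ hz'
      simp [w, hz']
    · simp
  refine ⟨⟨w, ν, fun z => ⟨fun i => ?_, ?_⟩, fun z i => ?_, fun z => ?_⟩, fun z i ω hω => ?_, hsum⟩
  · exact ite_nonneg ((s i.1).weight_mem.1 _) le_rfl
  · simpa [(s z).weight_mem.2] using hsum z fun _ => 1
  · by_cases hi : w z i = 0
    · simpa [ν, hi] using hμ z
    · simpa [ν, hi] using (s i.1).posterior_mem i.2
  · exact funext fun ω => (hsum z fun p => p ω).trans (congrFun (s z).mixture_eq ω)
  · by_cases hi : w z i = 0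
    · simpa [ν, hi] using hω
    · obtain ⟨rfl, hw⟩ := ite_ne_right_iff.1 hi
      simpa [ν, hi] using (s i.1).posterior_eq_zero hw hω

lemma relEntropy_mix_le {p q : Ω → ℝ} (hp : ∀ ω, 0 ≤ p ω) (hq : ∀ ω, 0 ≤ q ω)
    (hη : η ∈ Set.Icc (0 : ℝ) 1) :
    relEntropy (fun ω => (1 - η) * p ω + η * q ω) q ≤ (1 - η) * relEntropy p q := by
  rw [relEntropy, relEntropy, Finset.mul_sum]
  refine Finset.sum_le_sum fun ω _ => ?_
  rcases (hq ω).eq_or_lt with h0 | hpos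
  · simp [← h0]
  have hconv := Real.convexOn_mul_log.2 (div_nonneg (hp ω) hpos.le : p ω / q ω ∈ Set.Ici (0 : ℝ))
    (Set.mem_Ici.2 zero_le_one) (sub_nonneg.2 hη.2) hη.1 (sub_add_cancel 1 η)
  simp only [smul_eq_mul, mul_one, Real.log_one, mul_zero, add_zero] at hconv
  have hdiv : ((1 - η) * p ω + η * q ω) / q ω = (1 - η) * (p ω / q ω) + η := by
    field_simp
  calc ((1 - η) * p ω + η * q ω) * Real.log (((1 - η) * p ω + η * q ω) / q ω)
      = q ω * (((1 - η) * (p ω / q ω) + η) * Real.log ((1 - η) * (p ω / q ω) + η)) := by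
        rw [← mul_assoc, ← hdiv, mul_div_cancel₀ _ hpos.ne']
    _ ≤ q ω * ((1 - η) * (p ω / q ω * Real.log (p ω / q ω))) := by gcongr
    _ = (1 - η) * (p ω * Real.log (p ω / q ω)) := by field_simp

lemma LowerBoundAt.robustPayoff_sub_le [Finite A] [Nonempty A] {uS uR : Ω → A → Z → ℝ} {z : Z}
    {ν p : Ω → ℝ} {K : ℝ} (h : LowerBoundAt uS uR z ν K) (hp : p ∈ stdSimplex ℝ Ω) :
    robustPayoff uS uR z ν - K * ∑ ω, |p ω - ν ω| ≤ robustPayoff uS uR z p := by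
  obtain ⟨a, ha, hau⟩ := exists_robustPayoff_eq uS uR z p
  simpa [deviation, hp.2, hau] using h p hp.1 a ha

namespace SplittingFamily

/-- Mixing all posteriors with the prior, of weight `η`: this equalizes the supports and strictly
decreases the information. -/
def mix (F : SplittingFamily μ S) (hη : η ∈ Set.Icc (0 : ℝ) 1) : SplittingFamily μ S where
  weight := F.weight
  posterior z s ω := (1 - η) * F.posterior z s ω + η * μ z ω
  weight_mem := F.weight_mem
  posterior_mem z s := by
    have hprior := F.prior_mem_stdSimplex z
    refine ⟨fun ω => add_nonneg (mul_nonneg (sub_nonneg.2 hη.2) ((F.posterior_mem z s).1 ω))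
      (mul_nonneg hη.1 (hprior.1 ω)), ?_⟩
    rw [Finset.sum_add_distrib, ← Finset.mul_sum, ← Finset.mul_sum, (F.posterior_mem z s).2,
      hprior.2]
    ring
  mixture_eq z := by
    ext ω
    have hsplit s : F.weight z s * ((1 - η) * F.posterior z s ω + η * μ z ω) =
        (1 - η) * (F.weight z s * F.posterior z s ω) + F.weight z s * (η * μ z ω) := by ring
    simp only [mixture, hsplit]
    rw [Finset.sum_add_distrib, ← Finset.mul_sum, ← Finset.sum_mul, (F.weight_mem z).2]
    have hmix : ∑ s, F.weight z s * F.posterior z s ω = μ z ω := congrFun (F.mixture_eq z) ω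
    rw [hmix]
    ring

variable (F : SplittingFamily μ S)

lemma fullSupport_mix (hF : ∀ z s ω, μ z ω = 0 → F.posterior z s ω = 0)
    (hη : η ∈ Set.Icc (0 : ℝ) 1) (hη0 : 0 < η) : (F.mix hη).FullSupport := by
  refine fun z s ω => ⟨fun h => ?_, fun h => by simp [mix, h, hF z s ω h]⟩
  have hprior := (F.prior_mem_stdSimplex z).1 ω
  have hpost := mul_nonneg (sub_nonneg.2 hη.2) ((F.posterior_mem z s).1 ω)
  have hzero := ((add_eq_zero_iff_of_nonneg hpost (mul_nonneg hη.1 hprior)).1 h).2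
  exact (mul_eq_zero.1 hzero).resolve_left hη0.ne'

lemma info_mix_le (hη : η ∈ Set.Icc (0 : ℝ) 1) (z : Z) :
    (F.mix hη).info z ≤ (1 - η) * F.info z := by
  rw [info, info, Finset.mul_sum]
  refine Finset.sum_le_sum fun s _ => ?_
  rw [mul_left_comm]
  exact mul_le_mul_of_nonneg_left (relEntropy_mix_le (F.posterior_mem z s).1
    (F.prior_mem_stdSimplex z).1 hη) ((F.weight_mem z).1 s)

lemma sum_abs_posterior_mix_sub_le (hη : η ∈ Set.Icc (0 : ℝ) 1) (z : Z) (s : S) :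
    ∑ ω, |(F.mix hη).posterior z s ω - F.posterior z s ω| ≤ η * 2 := by
  have hterm ω : |(F.mix hη).posterior z s ω - F.posterior z s ω| =
      η * |μ z ω - F.posterior z s ω| := by
    have hdiff : (F.mix hη).posterior z s ω - F.posterior z s ω =
        η * (μ z ω - F.posterior z s ω) := by
      simp only [mix]
      ring
    rw [hdiff, abs_mul, abs_of_nonneg hη.1]
  simp only [hterm]
  rw [← Finset.mul_sum]
  exact mul_le_mul_of_nonneg_left
    (sum_abs_sub_le_two (F.prior_mem_stdSimplex z) (F.posterior_mem z s)) hη.1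

lemma value_sub_le_value_mix [Finite A] [Nonempty A] {uS uR : Ω → A → Z → ℝ} {K : ℝ} (hK0 : 0 ≤ K)
    (hη : η ∈ Set.Icc (0 : ℝ) 1) {z : Z} (hK : ∀ s, LowerBoundAt uS uR z (F.posterior z s) K) :
    F.value uS uR z - K * (η * 2) ≤ (F.mix hη).value uS uR z := by
  have hloss s : robustPayoff uS uR z (F.posterior z s) - K * (η * 2) ≤
      robustPayoff uS uR z ((F.mix hη).posterior z s) :=
    calc robustPayoff uS uR z (F.posterior z s) - K * (η * 2)
        ≤ robustPayoff uS uR z (F.posterior z s) -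
            K * ∑ ω, |(F.mix hη).posterior z s ω - F.posterior z s ω| := by
          gcongr
          exact F.sum_abs_posterior_mix_sub_le hη z s
      _ ≤ robustPayoff uS uR z ((F.mix hη).posterior z s) :=
          (hK s).robustPayoff_sub_le ((F.mix hη).posterior_mem z s)
  calc F.value uS uR z - K * (η * 2)
      = ∑ s, F.weight z s * (robustPayoff uS uR z (F.posterior z s) - K * (η * 2)) := by
        simp only [mul_sub, Finset.sum_sub_distrib, ← Finset.sum_mul, (F.weight_mem z).2, one_mul]
        rfl
    _ ≤ (F.mix hη).value uS uR z :=
        Finset.sum_le_sum fun s _ => mul_le_mul_of_nonneg_left (hloss s) ((F.weight_mem z).1 s)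

end SplittingFamily

lemma exists_fullSupport_splittingFamily [Finite A] [Nonempty A] [Fintype Z]
    (hμ : ∀ z, μ z ∈ stdSimplex ℝ Ω) (s : (z : Z) → Splitting (μ z)) (uS uR : Ω → A → Z → ℝ)
    {ε : ℝ} (hε : 0 < ε) :
    ∃ η : ℝ, 0 < η ∧ η ≤ 1 ∧ ∃ F : SplittingFamily μ (Σ z, Fin (s z).card), F.FullSupport ∧
      (∀ z, F.info z ≤ (1 - η) * ((s z).info * Real.log 2)) ∧
      ∀ z, (s z).payoff uS uR z - ε ≤ F.value uS uR z := by
  obtain ⟨F, hF0, hFs⟩ := exists_splittingFamily hμ s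
  obtain ⟨K, hK0, hK⟩ := F.exists_forall_lowerBoundAt uS uR
  obtain ⟨η', hη'0, hη'⟩ := exists_pos_mul_le (mul_nonneg hK0 zero_le_two) hε
  have hη0 : 0 < min 1 η' := lt_min one_pos hη'0
  have hη : min 1 η' ∈ Set.Icc (0 : ℝ) 1 := ⟨hη0.le, min_le_left _ _⟩
  refine ⟨min 1 η', hη0, hη.2, F.mix hη, F.fullSupport_mix hF0 hη hη0, fun z => ?_, fun z => ?_⟩
  · have hinfo : F.info z = (s z).info * Real.log 2 :=
      (hFs z fun ν => relEntropy ν (μ z)).trans (s z).info_mul_log_two.symm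
    exact hinfo ▸ F.info_mix_le hη z
  · have hvalue : F.value uS uR z = (s z).payoff uS uR z := hFs z (robustPayoff uS uR z)
    have hloss : K * (min 1 η' * 2) ≤ ε :=
      calc K * (min 1 η' * 2) = K * 2 * min 1 η' := by ring
        _ ≤ K * 2 * η' := by gcongr; exact min_le_right _ _
        _ ≤ ε := hη'
    have hmix := F.value_sub_le_value_mix hK0 hη (hK z)
    linarith

end FullSupportFamilies

section Sequences

variable {Z : Type*} {π : Z → ℝ} {k n : ℕ → ℕ} {z : (j : ℕ) → Fin (n j) → Z}

lemma tendsto_sum_abs_empFreq_sub [Fintype Z] (hπ : Tendsto (fun j => empFreq (z j)) atTop (𝓝 π)) :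
    Tendsto (fun j => ∑ z₀, |empFreq (z j) z₀ - π z₀|) atTop (𝓝 0) := by
  have hlim : Tendsto (fun j => ∑ z₀, |empFreq (z j) z₀ - π z₀|) atTop
      (𝓝 (∑ z₀, |π z₀ - π z₀|)) :=
    tendsto_finsetSum _ fun z₀ _ => ((tendsto_pi_nhds.1 hπ z₀).sub_const _).abs
  simpa using hlim

lemma eventually_le_mul_empFreq [Finite Z] (hπ0 : ∀ z, 0 ≤ π z)
    (hπ : Tendsto (fun j => empFreq (z j)) atTop (𝓝 π)) {δ : ℝ} (hδ : 0 < δ) :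
    ∀ᶠ j in atTop, ∀ z₀, π z₀ ≤ (1 + δ) * empFreq (z j) z₀ := by
  refine eventually_all.2 fun z₀ => ?_
  rcases (hπ0 z₀).eq_or_lt with h0 | hpos
  · refine Eventually.of_forall fun j => ?_
    rw [← h0, empFreq]
    positivity
  · have hlt : π z₀ < (1 + δ) * π z₀ := lt_mul_of_one_lt_left hpos (lt_add_of_pos_right 1 hδ)
    exact (((tendsto_pi_nhds.1 hπ z₀).const_mul (1 + δ)).eventually_const_lt hlt).mono
      fun j hj => hj.le

lemma eventually_lt_of_lt_sum_mul [Fintype Z] (hπ : Tendsto (fun j => empFreq (z j)) atTop (𝓝 π))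
    {v : Z → ℝ} {a : ℝ} (ha : a < ∑ z₀, π z₀ * v z₀) {u : ℕ → ℝ}
    (hu : ∀ ε > 0, ∀ᶠ j in atTop, 1 / (n j : ℝ) * ∑ t, v (z j t) - ε ≤ u j) :
    ∀ᶠ j in atTop, a < u j := by
  obtain ⟨b, hab, hb⟩ := exists_between ha
  filter_upwards [(tendsto_sum_empFreq_mul hπ v).eventually_const_lt hb,
    hu (b - a) (sub_pos.2 hab)] with j hbj huj
  rw [sum_empFreq_mul] at hbj
  linarith

lemma tendsto_div_toReal {r : ℝ≥0∞} (hr : r ≠ ⊤)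
    (hkn : Tendsto (fun j => (k j : ℝ≥0∞) / n j) atTop (𝓝 r)) :
    Tendsto (fun j => (k j : ℝ) / n j) atTop (𝓝 r.toReal) :=
  ((ENNReal.tendsto_toReal hr).comp hkn).congr fun j => by simp

lemma tendsto_div_atTop (hn : ∀ j, 0 < n j)
    (hkn : Tendsto (fun j => (k j : ℝ≥0∞) / n j) atTop (𝓝 ⊤)) :
    Tendsto (fun j => (k j : ℝ) / n j) atTop atTop := by
  refine ENNReal.tendsto_ofReal_nhds_top.1 (hkn.congr fun j => ?_)
  simpa using natCast_div_mul_ofReal (hn j) (k j) 1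

lemma tendsto_atTop_of_tendsto_max (hn : ∀ j, 0 < n j)
    (hmax : Tendsto (fun j => max (n j) (k j)) atTop atTop) {r : ℝ} (hr : 0 ≤ r)
    (hkn : Tendsto (fun j => (k j : ℝ) / n j) atTop (𝓝 r)) : Tendsto n atTop atTop := by
  rw [← tendsto_natCast_atTop_iff (R := ℝ)]
  have hdiv : Tendsto (fun j => ((max (n j) (k j) : ℕ) : ℝ) / (r + 1)) atTop atTop :=
    (tendsto_natCast_atTop_iff.2 hmax).atTop_div_const (by positivity)
  refine tendsto_atTop_mono' _ ?_ hdiv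
  filter_upwards [hkn.eventually_lt_const (lt_add_one r)] with j hj
  have hn0 : (0 : ℝ) < n j := Nat.cast_pos.2 (hn j)
  rw [div_le_iff₀ (by positivity), Nat.cast_max]
  refine max_le (le_mul_of_one_le_right hn0.le (le_add_of_nonneg_left hr)) ?_
  rw [div_lt_iff₀ hn0] at hj
  linarith

end Sequences

section Limit

variable {Ω A Z X Y : Type*} [Fintype Ω] [Finite A] [Nonempty A] [Fintype Z] [Fintype X]
  [Nonempty X] [Fintype Y] {μ : Z → Ω → ℝ} {uS uR : Ω → A → Z → ℝ} {Q : X → Y → ℝ} {π : Z → ℝ}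
  {k n : ℕ → ℕ} {z : (j : ℕ) → Fin (n j) → Z} {r : ℝ}

lemma eventually_optimalRobustPayoff_le_add (hμ : ∀ z, μ z ∈ stdSimplex ℝ Ω)
    (hQ : ∀ x, Q x ∈ stdSimplex ℝ Y) (hn : ∀ j, 0 < n j) (hπ0 : ∀ z, 0 ≤ π z)
    (hπ : Tendsto (fun j => empFreq (z j)) atTop (𝓝 π)) {c δ ε : ℝ} (hδ : 0 < δ)
    (hc : ∀ᶠ j in atTop, (1 + δ) * (k j / n j * capacity Q) ≤ c) (hε : 0 < ε) :
    ∀ᶠ j in atTop, optimalRobustPayoff uS uR μ Q (k j) (z j) ≤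
      splittingValue uS uR μ (ENNReal.ofReal c) π + ε := by
  obtain ⟨B, -, hB⟩ := exists_abs_le fun i : Ω × A × Z => uS i.1 i.2.1 i.2.2
  have herr : Tendsto (fun j => B * ∑ z₀, |empFreq (z j) z₀ - π z₀|) atTop (𝓝 0) := by
    simpa using (tendsto_sum_abs_empFreq_sub hπ).const_mul B
  filter_upwards [hc, eventually_le_mul_empFreq hπ0 hπ hδ, herr.eventually_lt_const hε]
    with j hcj hπj herrj
  have hupper := optimalRobustPayoff_le_splittingValue hμ hQ (hn j) uS uR (k j) (z j)
  rw [natCast_div_mul_ofReal (hn j)] at hupper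
  have hchange := splittingValue_ofReal_le_add_mul_sum_abs_sub (uR := uR) hμ
    (fun ω a z => hB (ω, a, z)) hδ.le (mul_nonneg (by positivity) (capacity_nonneg Q)) hcj hπj
  linarith

lemma tendsto_optimalRobustPayoff_zero (hμ : ∀ z, μ z ∈ stdSimplex ℝ Ω)
    (hQ : ∀ x, Q x ∈ stdSimplex ℝ Y) (hn : ∀ j, 0 < n j) (hπ0 : ∀ z, 0 ≤ π z)
    (hπ : Tendsto (fun j => empFreq (z j)) atTop (𝓝 π))
    (hc : ∀ ε > 0, ∃ c, (∀ᶠ j in atTop, (1 + 1) * ((k j : ℝ) / n j * capacity Q) ≤ c) ∧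
      splittingValue uS uR μ (ENNReal.ofReal c) π ≤ splittingValue uS uR μ 0 π + ε) :
    Tendsto (fun j => optimalRobustPayoff uS uR μ Q (k j) (z j)) atTop
      (𝓝 (splittingValue uS uR μ 0 π)) := by
  refine tendsto_order.2 ⟨fun a ha => ?_, fun a ha => ?_⟩
  · rw [splittingValue_zero hμ hπ0] at ha
    exact eventually_lt_of_lt_sum_mul hπ ha fun ε hε => Eventually.of_forall fun j =>
      (sub_le_self _ hε.le).trans
        (sum_robustPayoff_prior_le_optimalRobustPayoff hμ hQ (hn j) uS uR)
  · obtain ⟨ε, hε, hεa⟩ := exists_pos_mul_lt (sub_pos.2 ha) 2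
    obtain ⟨c, hcj, hcV⟩ := hc ε hε
    filter_upwards [eventually_optimalRobustPayoff_le_add (uS := uS) (uR := uR) hμ hQ hn hπ0 hπ
      one_pos hcj hε] with j hj
    linarith

lemma tendsto_optimalRobustPayoff_of_capacity_eq_zero (hμ : ∀ z, μ z ∈ stdSimplex ℝ Ω)
    (hQ : ∀ x, Q x ∈ stdSimplex ℝ Y) (hn : ∀ j, 0 < n j) (hπ0 : ∀ z, 0 ≤ π z)
    (hπ : Tendsto (fun j => empFreq (z j)) atTop (𝓝 π)) (hC : capacity Q = 0) :
    Tendsto (fun j => optimalRobustPayoff uS uR μ Q (k j) (z j)) atTop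
      (𝓝 (splittingValue uS uR μ 0 π)) :=
  tendsto_optimalRobustPayoff_zero hμ hQ hn hπ0 hπ fun ε hε =>
    ⟨0, Eventually.of_forall fun j => by simp [hC], by simpa using hε.le⟩

lemma tendsto_optimalRobustPayoff_of_tendsto_zero (hμ : ∀ z, μ z ∈ stdSimplex ℝ Ω)
    (hQ : ∀ x, Q x ∈ stdSimplex ℝ Y) (hn : ∀ j, 0 < n j) (hπm : π ∈ stdSimplex ℝ Z)
    (hπ : Tendsto (fun j => empFreq (z j)) atTop (𝓝 π))
    (hkn : Tendsto (fun j => (k j : ℝ) / n j) atTop (𝓝 0))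
    (hcont : ∀ z, 0 < π z → ContinuousWithinAt (robustPayoff uS uR z)
      {ν | ν ∈ stdSimplex ℝ Ω ∧ ∀ ω, μ z ω = 0 → ν ω = 0} (μ z)) :
    Tendsto (fun j => optimalRobustPayoff uS uR μ Q (k j) (z j)) atTop
      (𝓝 (splittingValue uS uR μ 0 π)) := by
  refine tendsto_optimalRobustPayoff_zero hμ hQ hn hπm.1 hπ fun ε hε => ?_
  rw [splittingValue_zero hμ hπm.1]
  obtain ⟨c, hc0, hcV⟩ := exists_splittingValue_le_add hμ hπm hcont hε
  have hlim : Tendsto (fun j => (1 + 1) * ((k j : ℝ) / n j * capacity Q)) atTop (𝓝 0) := by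
    simpa using (hkn.mul_const (capacity Q)).const_mul (1 + 1)
  exact ⟨c, (hlim.eventually_lt_const hc0).mono fun j hj => hj.le, hcV⟩

lemma tendsto_optimalRobustPayoff_of_tendsto_atTop (hμ : ∀ z, μ z ∈ stdSimplex ℝ Ω)
    (hQ : ∀ x, Q x ∈ stdSimplex ℝ Y) (hn : ∀ j, 0 < n j)
    (hπ : Tendsto (fun j => empFreq (z j)) atTop (𝓝 π)) (hC : 0 < capacity Q)
    (hkn : Tendsto (fun j => (k j : ℝ) / n j) atTop atTop) :
    Tendsto (fun j => optimalRobustPayoff uS uR μ Q (k j) (z j)) atTop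
      (𝓝 (splittingValue uS uR μ ⊤ π)) := by
  obtain ⟨B, -, hB⟩ := exists_abs_le fun i : Ω × A × Z => uS i.1 i.2.1 i.2.2
  refine tendsto_order.2 ⟨fun a ha => ?_, fun a ha => ?_⟩
  · obtain ⟨s, -, hs⟩ := exists_splitting_of_lt_splittingValue hμ ha
    obtain ⟨F, -, hF⟩ := exists_splittingFamily hμ s
    have hvalue z : (s z).payoff uS uR z = F.value uS uR z := (hF z (robustPayoff uS uR z)).symm
    simp only [hvalue] at hs
    exact eventually_lt_of_lt_sum_mul hπ hs fun ε hε =>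
      eventually_le_optimalRobustPayoff_of_tendsto_atTop hQ hC uS uR F hn z hkn hε
  · have hlim : Tendsto (fun j => splittingValue uS uR μ ⊤ π + B * ∑ z₀, |empFreq (z j) z₀ - π z₀|)
        atTop (𝓝 (splittingValue uS uR μ ⊤ π)) := by
      simpa using ((tendsto_sum_abs_empFreq_sub hπ).const_mul B).const_add _
    filter_upwards [hlim.eventually_lt_const ha] with j hj
    exact ((optimalRobustPayoff_le_splittingValue hμ hQ (hn j) uS uR (k j) (z j)).trans
      (splittingValue_le_add_mul_sum_abs_sub hμ (fun ω a z => hB (ω, a, z)) fun _ _ => by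
        simp)).trans_lt hj

lemma exists_fullSupport_info_lt_of_lt_splittingValue (hμ : ∀ z, μ z ∈ stdSimplex ℝ Ω)
    (hπm : π ∈ stdSimplex ℝ Z) {c a : ℝ} (hc : 0 < c)
    (ha : a < splittingValue uS uR μ (ENNReal.ofReal c) π) :
    ∃ s : (z : Z) → Splitting (μ z), ∃ F : SplittingFamily μ (Σ z, Fin (s z).card),
      F.FullSupport ∧ ∑ z, π z * F.info z < c * Real.log 2 ∧
        a < ∑ z, π z * F.value uS uR z := by
  obtain ⟨s, hs, hsa⟩ := exists_splitting_of_lt_splittingValue hμ ha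
  rw [coe_le_ofReal_iff hc.le] at hs
  obtain ⟨ε, hε, hεa⟩ := exists_between (sub_pos.2 hsa)
  obtain ⟨η, hη0, hη1, F, hF, hinfo, hvalue⟩ := exists_fullSupport_splittingFamily hμ s uS uR hε
  have hlog : 0 < Real.log 2 := Real.log_pos one_lt_two
  refine ⟨s, F, hF, ?_, ?_⟩
  · calc ∑ z, π z * F.info z ≤ ∑ z, π z * ((1 - η) * ((s z).info * Real.log 2)) :=
          Finset.sum_le_sum fun z _ => mul_le_mul_of_nonneg_left (hinfo z) (hπm.1 z)
      _ = (1 - η) * ((∑ z, π z * (s z).info) * Real.log 2) := by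
          rw [Finset.sum_mul, Finset.mul_sum]
          exact Finset.sum_congr rfl fun z _ => by ring
      _ ≤ (1 - η) * (c * Real.log 2) := by
          have := sub_nonneg.2 hη1
          gcongr
      _ < c * Real.log 2 := mul_lt_of_lt_one_left (mul_pos hc hlog) (sub_lt_self 1 hη0)
  · calc a < ∑ z, π z * (s z).payoff uS uR z - ε := lt_sub_comm.1 hεa
      _ = ∑ z, π z * ((s z).payoff uS uR z - ε) := by
          simp only [mul_sub, Finset.sum_sub_distrib, ← Finset.sum_mul, hπm.2, one_mul]
      _ ≤ ∑ z, π z * F.value uS uR z :=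
          Finset.sum_le_sum fun z _ => mul_le_mul_of_nonneg_left (hvalue z) (hπm.1 z)

lemma exists_splittingValue_ofReal_le_add (hμ : ∀ z, μ z ∈ stdSimplex ℝ Ω)
    (hπm : π ∈ stdSimplex ℝ Z) {c ε : ℝ} (hc : 0 < c) (hε : 0 < ε) :
    ∃ δ > 0, ∃ c', (1 + δ) * c < c' ∧ splittingValue uS uR μ (ENNReal.ofReal c') π ≤
      splittingValue uS uR μ (ENNReal.ofReal c) π + ε := by
  obtain ⟨B, hB0, hB⟩ := exists_abs_le fun i : Ω × A × Z => uS i.1 i.2.1 i.2.2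
  obtain ⟨θ', hθ'0, hθ'⟩ := exists_pos_mul_le (mul_nonneg zero_le_two hB0) hε
  set θ := min (1 / 2) θ'
  have hθ0 : 0 < θ := lt_min one_half_pos hθ'0
  have hθ1 : θ < 1 := (min_le_left _ _).trans_lt one_half_lt_one
  have hsub : 0 < 1 - θ := sub_pos.2 hθ1
  have hlt : (1 + θ) * c < c / (1 - θ) := by
    rw [lt_div_iff₀ hsub]
    nlinarith [mul_pos hc (mul_pos hθ0 hθ0)]
  have hloss : 2 * B * θ ≤ ε :=
    (mul_le_mul_of_nonneg_left (min_le_right _ _) (mul_nonneg zero_le_two hB0)).trans hθ'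
  refine ⟨θ, hθ0, c / (1 - θ), hlt, ?_⟩
  have hscale := splittingValue_ofReal_le_add_of_one_sub_mul_le (uR := uR) hμ
    (fun ω a z => hB (ω, a, z)) hπm hθ0.le hθ1.le hc.le (div_nonneg hc.le hsub.le)
    (mul_div_cancel₀ c hsub.ne').le
  linarith

lemma tendsto_optimalRobustPayoff (hμ : ∀ z, μ z ∈ stdSimplex ℝ Ω)
    (hQ : ∀ x, Q x ∈ stdSimplex ℝ Y) (hn : ∀ j, 0 < n j) (hnt : Tendsto n atTop atTop)
    (hπm : π ∈ stdSimplex ℝ Z) (hπ : Tendsto (fun j => empFreq (z j)) atTop (𝓝 π))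
    (hC : 0 < capacity Q) (hr : 0 < r) (hkn : Tendsto (fun j => (k j : ℝ) / n j) atTop (𝓝 r)) :
    Tendsto (fun j => optimalRobustPayoff uS uR μ Q (k j) (z j)) atTop
      (𝓝 (splittingValue uS uR μ (ENNReal.ofReal (r * capacity Q)) π)) := by
  refine tendsto_order.2 ⟨fun a ha => ?_, fun a ha => ?_⟩
  · obtain ⟨s, F, hF, hinfo, hvalue⟩ :=
      exists_fullSupport_info_lt_of_lt_splittingValue hμ hπm (mul_pos hr hC) ha
    rw [mul_assoc] at hinfo
    exact eventually_lt_of_lt_sum_mul hπ hvalue fun ε hε =>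
      eventually_le_optimalRobustPayoff_of_info_lt hQ uS uR hF hnt hr hkn hπ hinfo hε
  · obtain ⟨ε, hε, hεa⟩ := exists_pos_mul_lt (sub_pos.2 ha) 2
    obtain ⟨δ, hδ, c', hc', hV⟩ :=
      exists_splittingValue_ofReal_le_add (uS := uS) (uR := uR) hμ hπm (mul_pos hr hC) hε
    have hrate := ((hkn.mul_const (capacity Q)).const_mul (1 + δ)).eventually_lt_const hc'
    filter_upwards [eventually_optimalRobustPayoff_le_add (uS := uS) (uR := uR) hμ hQ hn hπm.1 hπ hδ
      (hrate.mono fun j hj => hj.le) hε] with j hj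
    linarith

end Limit

end Persuasion

theorem theorem2 {Ω A Z X Y : Type*}
    [Fintype Ω] [Fintype A] [Fintype Z] [Fintype X] [Fintype Y] [Nonempty A] [Nonempty X]
    (μ : Z → Ω → ℝ) (hμ : ∀ z, μ z ∈ stdSimplex ℝ Ω)
    (uS uR : Ω → A → Z → ℝ)
    (Q : X → Y → ℝ) (hQ : ∀ x, Q x ∈ stdSimplex ℝ Y) :
    (∀ (n k : ℕ), 0 < n → ∀ z : Fin n → Z,
      Persuasion.optimalRobustPayoff uS uR μ Q k z ≤
        Persuasion.splittingValue uS uR μ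
          ((k : ℝ≥0∞) / (n : ℝ≥0∞) * ENNReal.ofReal (Persuasion.capacity Q))
          (Persuasion.empFreq z)) ∧
    (∀ (π : Z → ℝ), π ∈ stdSimplex ℝ Z → ∀ (r : ℝ≥0∞),
      -- only for `r = 0` and positive capacity: continuity of the robust payoff at the priors
      (r = 0 → 0 < Persuasion.capacity Q → ∀ z, 0 < π z →
        ContinuousWithinAt (Persuasion.robustPayoff uS uR z)
          {ν | ν ∈ stdSimplex ℝ Ω ∧ ∀ ω, μ z ω = 0 → ν ω = 0} (μ z)) →
      ∀ (k n : ℕ → ℕ), (∀ j, 0 < n j) → ∀ z : (j : ℕ) → Fin (n j) → Z,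
        Tendsto (fun j => max (n j) (k j)) atTop atTop →
        Tendsto (fun j => (k j : ℝ≥0∞) / (n j : ℝ≥0∞)) atTop (𝓝 r) →
        Tendsto (fun j => Persuasion.empFreq (z j)) atTop (𝓝 π) →
        Tendsto (fun j => Persuasion.optimalRobustPayoff uS uR μ Q (k j) (z j)) atTop
          (𝓝 (Persuasion.splittingValue uS uR μ
            (r * ENNReal.ofReal (Persuasion.capacity Q)) π))) := by
  refine ⟨fun n k hn z =>
    Persuasion.optimalRobustPayoff_le_splittingValue hμ hQ hn uS uR k z, ?_⟩
  intro π hπm r hcont k n hn z hmax hkn hπ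
  rcases (Persuasion.capacity_nonneg Q).eq_or_lt with hC | hC
  · rw [← hC, ENNReal.ofReal_zero, mul_zero]
    exact Persuasion.tendsto_optimalRobustPayoff_of_capacity_eq_zero hμ hQ hn hπm.1 hπ hC.symm
  rcases eq_or_ne r ⊤ with rfl | hr
  · rw [ENNReal.top_mul (ENNReal.ofReal_pos.2 hC).ne']
    exact Persuasion.tendsto_optimalRobustPayoff_of_tendsto_atTop hμ hQ hn hπ hC
      (Persuasion.tendsto_div_atTop hn hkn)
  replace hkn := Persuasion.tendsto_div_toReal hr hkn
  rcases eq_or_ne r 0 with rfl | hr0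
  · rw [zero_mul]
    exact Persuasion.tendsto_optimalRobustPayoff_of_tendsto_zero hμ hQ hn hπm hπ hkn (hcont rfl hC)
  rw [← ENNReal.ofReal_toReal hr, ← ENNReal.ofReal_mul ENNReal.toReal_nonneg]
  exact Persuasion.tendsto_optimalRobustPayoff hμ hQ hn
    (Persuasion.tendsto_atTop_of_tendsto_max hn hmax ENNReal.toReal_nonneg hkn) hπm hπ hC
    (ENNReal.toReal_pos hr0 hr) hkn
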